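/- Let $r<n$ be nonnegative integers, let $x=(x_1,\dots,x_n)$ be $n$ variables, and let $\lambda=(\lambda_1\ge\cdots\ge\lambda_r\ge 0)$ and $\mu=(\mu_1\ge\cdots\ge\mu_r\ge 0)$ be partitions with at most $r$ parts, also regarded as partitions with at most $n$ parts by appending zeros. For a sequence $\nu=(\nu_1\ge\cdots\ge\nu_n\ge 0)$ let $s_\nu(x)=\det(h_{\nu_i-i+j}(x))_{1\le i,j\le n}$ be the Schur polynomial, where $h_k(x)$ is the sum of all monomials of degree $k$ in $x_1,\dots,x_n$ (and $h_k=0$ for $k<0$); a shorter sequence is extended by zeros. Define the integers $c_{\mu\nu}^{\lambda}$ by $s_\mu(x)s_\nu(x)=\sum_\lambda c_{\mu\nu}^\lambda s_\lambda(x)$, where $\lambda$ runs over the partitions with at most $n$ parts, and define the skew Schur polynomial by $s_{\lambda/\mu}(x)=\sum_\nu c_{\mu\nu}^{\lambda}s_\nu(x)$, where $\nu$ runs over the partitions with at most $n$ parts; only finitely many terms of this sum are nonzero. For integers $\nu_1\ge\cdots\ge\nu_r$ let $\rho_\nu$ denote the irreducible rational representation of $GL_r(\mathbb{C})$ with highest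 weight $\nu=(\nu_1,\dots,\nu_r)$. Let $N_{\mu\lambda}^{\nu}$ be the multiplicity of $\rho_\nu$ in $\rho_\mu^\vee\otimes\rho_\lambda$, that is $\dim\mathrm{Hom}_{GL_r(\mathbb{C})}(\rho_\nu,\rho_\mu^\vee\otimes\rho_\lambda)$, if $\nu_i\ge 0$ for all $i$ (for $r\ge 1$, equivalently $\nu_r\ge 0$), and let $N_{\mu\lambda}^\nu=0$ otherwise. Then $N_{\mu\lambda}^\nu\neq 0$ for only finitely many $\nu$, and $$s_{\lambda/\mu}(x)=\sum_{\nu}N_{\mu\lambda}^{\nu}\,s_\nu(x),$$ where $\nu$ runs over all dominant weights $\nu_1\ge\cdots\ge\nu_r$ of $GL_r(\mathbb{C})$. -/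

import Mathlib

open scoped MatrixGroups TensorProduct

namespace SkewSchur

/-! ### Weights and partitions -/

/-- Dominant weights of `GL_r(ℂ)`: integer sequences `ν_1 ≥ ⋯ ≥ ν_r`. -/
abbrev DominantWeight (r : ℕ) : Type := {a : Fin r → ℤ // Antitone a}

/-- Partitions with at most `n` parts: integer sequences `ν_1 ≥ ⋯ ≥ ν_n ≥ 0`. -/
abbrev BoundedPartition (n : ℕ) : Type := {a : Fin n → ℤ // Antitone a ∧ ∀ i, 0 ≤ a i}

/-- Forget that the entries of a partition are nonnegative. -/
def BoundedPartition.toWeight {r : ℕ} (a : BoundedPartition r) : DominantWeight r :=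
  ⟨a.1, a.2.1⟩

/-- The sequence of length `n` obtained by appending zeros:
`(a_1, …, a_r) ↦ (a_1, …, a_r, 0, …, 0)` (used for `r ≤ n`). -/
def pad {r : ℕ} (n : ℕ) (a : Fin r → ℤ) : Fin n → ℤ :=
  fun i => if h : (i : ℕ) < r then a ⟨i, h⟩ else 0

theorem pad_spec {r : ℕ} (n : ℕ) (a : BoundedPartition r) :
    Antitone (pad n a.1) ∧ ∀ i, 0 ≤ pad n a.1 i := by
  refine ⟨fun i j hij => ?_, fun i => ?_⟩
  · unfold pad
    split_ifs with hj hi hi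
    · exact a.2.1 (by simpa using hij)
    · exact absurd (lt_of_le_of_lt (Fin.le_def.1 hij) hj) hi
    · exact a.2.2 _
    · exact le_rfl
  · unfold pad
    split_ifs
    · exact a.2.2 _
    · exact le_rfl

/-- A partition with at most `r` parts, regarded as a partition with at most `n` parts. -/
def BoundedPartition.pad {r : ℕ} (n : ℕ) (a : BoundedPartition r) : BoundedPartition n :=
  ⟨SkewSchur.pad n a.1, pad_spec n a⟩

/-! ### Schur polynomials -/

/-- The complete homogeneous symmetric polynomial `h_k(x_1, …, x_n)`, the sum of all monomials
of degree `k`; it is `0` for `k < 0`. -/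
noncomputable def completeSymm (n : ℕ) (k : ℤ) : MvPolynomial (Fin n) ℤ :=
  if 0 ≤ k then MvPolynomial.hsymm (Fin n) ℤ k.toNat else 0

/-- The Schur polynomial `s_a(x_1, …, x_n) = det (h_{a_i - i + j})_{1 ≤ i, j ≤ n}`. -/
noncomputable def schur (n : ℕ) (a : Fin n → ℤ) : MvPolynomial (Fin n) ℤ :=
  (Matrix.of fun i j : Fin n => completeSymm n (a i - (i : ℤ) + (j : ℤ))).det

open Classical in
/-- The integers `c_{μν}^λ`, for fixed `μ, ν`: the coefficients of the expansion
`s_μ s_ν = ∑_λ c_{μν}^λ s_λ` over partitions `λ` with at most `n` parts, in `n` variables. -/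
noncomputable def lrCoeff (n : ℕ) (mu nu : BoundedPartition n) : BoundedPartition n →₀ ℤ :=
  if h : ∃ c : BoundedPartition n →₀ ℤ,
      schur n mu.1 * schur n nu.1 = c.sum fun lam m => m • schur n lam.1
  then h.choose else 0

/-- The skew Schur polynomial `s_{λ/μ}(x_1, …, x_n) = ∑_ν c_{μν}^λ s_ν(x_1, …, x_n)`. -/
noncomputable def skewSchur (n : ℕ) (lam mu : BoundedPartition n) : MvPolynomial (Fin n) ℤ :=
  ∑ᶠ nu : BoundedPartition n, lrCoeff n mu nu lam • schur n nu.1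

/-! ### The irreducible representations of `GL_r(ℂ)` -/

/-- A representation of `GL_r(ℂ)` is rational if each matrix coefficient is a polynomial in the
matrix entries times an integral power of the determinant. -/
def IsRational {r : ℕ} {V : Type*} [AddCommGroup V] [Module ℂ V]
    (ρ : Representation ℂ (GL (Fin r) ℂ) V) : Prop :=
  ∀ (v : V) (φ : Module.Dual ℂ V), ∃ (e : ℤ) (p : MvPolynomial (Fin r × Fin r) ℂ),
    ∀ g : GL (Fin r) ℂ,
      φ (ρ g v) = (g : Matrix (Fin r) (Fin r) ℂ).det ^ e * p.eval fun q => g q.1 q.2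

/-- `ρ` is an irreducible (finite-dimensional, rational) representation of `GL_r(ℂ)` with
highest weight `a`: some nonzero vector is an eigenvector of every invertible upper triangular
matrix `b`, with eigenvalue `∏ i, b_ii ^ a_i`. -/
structure IsIrrepOfHighestWeight {r : ℕ} {V : Type*} [AddCommGroup V] [Module ℂ V]
    (ρ : Representation ℂ (GL (Fin r) ℂ) V) (a : Fin r → ℤ) : Prop where
  finite : Module.Finite ℂ V
  rational : IsRational ρ
  irreducible : ρ.IsIrreducible
  highest : ∃ v : V, v ≠ 0 ∧ ∀ b : GL (Fin r) ℂ, (∀ i j : Fin r, j < i → b i j = 0) →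
    ρ b v = (∏ i, b i i ^ a i) • v

/-- The action of `GL_r(ℂ)` on functions on `GL_r(ℂ)` by right translation,
`(g • F) x = F (x g)`. -/
def rightRegular (r : ℕ) : Representation ℂ (GL (Fin r) ℂ) (GL (Fin r) ℂ → ℂ) where
  toFun g :=
    { toFun := fun F x => F (x * g)
      map_add' := fun _ _ => rfl
      map_smul' := fun _ _ => rfl }
  map_one' := by ext F x; simp
  map_mul' g h := by ext F x; simp [mul_assoc]

/-- The leading principal minor of size `i + 1`. -/
noncomputable def leadingMinor {r : ℕ} (i : Fin r) (x : Matrix (Fin r) (Fin r) ℂ) : ℂ :=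
  (x.toSquareBlockProp fun j => j ≤ i).det

/-- The difference `a_i - a_{i+1}`, where `a_{r+1} = 0`. -/
def gap {r : ℕ} (a : Fin r → ℤ) (i : Fin r) : ℤ :=
  a i - if h : (i : ℕ) + 1 < r then a ⟨i + 1, h⟩ else 0

/-- The function `∏ i, Δ_i ^ (a_i - a_{i+1})` on `GL_r(ℂ)`, where `Δ_i` is the leading principal
minor of size `i`. -/
noncomputable def highestWeightFunction {r : ℕ} (a : Fin r → ℤ) : GL (Fin r) ℂ → ℂ :=
  fun x => ∏ i, leadingMinor i (x : Matrix (Fin r) (Fin r) ℂ) ^ gap a i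

/-- The space of functions on `GL_r(ℂ)` spanned by the right translates of
`highestWeightFunction a`. -/
noncomputable def irrepSub {r : ℕ} (a : DominantWeight r) : Subrepresentation (rightRegular r) where
  toSubmodule := Submodule.span ℂ
    (Set.range fun g : GL (Fin r) ℂ => rightRegular r g (highestWeightFunction a.1))
  apply_mem_toSubmodule g v hv := by
    induction hv using Submodule.span_induction with
    | mem x hx =>
      obtain ⟨h, rfl⟩ := hx
      refine Submodule.subset_span ⟨g * h, ?_⟩
      simp only [map_mul, Module.End.mul_apply]
    | zero => simp
    | add x y _ _ hx hy => rw [map_add]; exact Submodule.add_mem _ hx hy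
    | smul c x _ hx => rw [map_smul]; exact Submodule.smul_mem _ c hx

/-- The underlying space of `ρ_a`. -/
abbrev IrrepSpace {r : ℕ} (a : DominantWeight r) : Type := (irrepSub a).toSubmodule

/-- The irreducible representation `ρ_a` of `GL_r(ℂ)` with highest weight `a`, realized on
functions on `GL_r(ℂ)`; `irrep_spec` below shows that it is irreducible with highest weight `a`. -/
noncomputable def irrep {r : ℕ} (a : DominantWeight r) :
    Representation ℂ (GL (Fin r) ℂ) (IrrepSpace a) :=
  (irrepSub a).toRepresentation

/-! #### Verification that `irrep a` is irreducible, rational, with highest weight `a` -/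

section IrrepSpec

open Matrix

variable {r : ℕ}

theorem sum_subtype_of_zero (p : Fin r → Prop) [DecidablePred p] (f : Fin r → ℂ)
    (hf : ∀ l, ¬ p l → f l = 0) : ∑ l : {l // p l}, f l = ∑ l, f l := by
  rw [← Finset.sum_subtype (Finset.univ.filter p) (by simp) f, Finset.sum_filter]
  refine Finset.sum_congr rfl fun l _ => ?_
  split_ifs with h
  · rfl
  · exact (hf l h).symm

theorem minor_mul_upper (i : Fin r) (x b : Matrix (Fin r) (Fin r) ℂ)
    (hb : ∀ k j : Fin r, j < k → b k j = 0) :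
    leadingMinor i (x * b) = leadingMinor i x * leadingMinor i b := by
  unfold leadingMinor
  rw [← Matrix.det_mul]
  congr 1
  ext k j
  simp only [toSquareBlockProp_def, Matrix.of_apply, Matrix.mul_apply]
  refine (sum_subtype_of_zero (fun l => l ≤ i) (fun l => x k l * b l j) fun l hl => ?_).symm
  rw [hb l j (lt_of_le_of_lt j.2 (not_le.1 hl)), mul_zero]

theorem minor_transpose (i : Fin r) (x : Matrix (Fin r) (Fin r) ℂ) :
    leadingMinor i xᵀ = leadingMinor i x := by
  unfold leadingMinor
  rw [← Matrix.det_transpose]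
  rfl

theorem minor_lower_mul (i : Fin r) (l x : Matrix (Fin r) (Fin r) ℂ)
    (hl : ∀ k j : Fin r, k < j → l k j = 0) :
    leadingMinor i (l * x) = leadingMinor i l * leadingMinor i x := by
  rw [← minor_transpose, Matrix.transpose_mul, minor_mul_upper, minor_transpose, minor_transpose,
    mul_comm]
  intro k j h
  exact hl j k h

theorem minor_upper (i : Fin r) (b : Matrix (Fin r) (Fin r) ℂ)
    (hb : ∀ k j : Fin r, j < k → b k j = 0) :
    leadingMinor i b = ∏ j : {j // j ≤ i}, b j j := by
  unfold leadingMinor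
  rw [Matrix.det_of_isUpperTriangular]
  · rfl
  · intro k j h
    exact hb k j h

theorem sum_gap (a : Fin r → ℤ) (j : Fin r) :
    ∑ i, (if j ≤ i then gap a i else 0) = a j := by
  let L : ℕ → ℤ := fun k => if h : k < r then a ⟨k, h⟩ else 0
  have h1 : ∀ i : Fin r, gap a i = L i - L (i + 1) := by
    intro i; simp [gap, L]
  have h2 : ∑ i : Fin r, (if j ≤ i then gap a i else 0)
      = ∑ k ∈ Finset.range r, (if (j : ℕ) ≤ k then L k - L (k + 1) else 0) := by
    rw [← Fin.sum_univ_eq_sum_range (fun k => if (j : ℕ) ≤ k then L k - L (k + 1) else 0)]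
    refine Finset.sum_congr rfl fun i _ => ?_
    rw [h1]
    rfl
  have h3 : ∀ m : ℕ, (j : ℕ) ≤ m →
      ∑ k ∈ Finset.range m, (if (j : ℕ) ≤ k then L k - L (k + 1) else 0) = L j - L m := by
    intro m hm
    induction m, hm using Nat.le_induction with
    | base =>
      rw [sub_self]
      refine Finset.sum_eq_zero fun k hk => ?_
      rw [if_neg (by simpa using hk)]
    | succ m hm ih => rw [Finset.sum_range_succ, ih, if_pos hm]; ring
  rw [h2, h3 r j.2.le]
  simp [L]

theorem hwf_upper (a : Fin r → ℤ) (b : GL (Fin r) ℂ)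
    (hb : ∀ k j : Fin r, j < k → b k j = 0) :
    highestWeightFunction a b = ∏ j, b j j ^ a j := by
  have hne : ∀ j : Fin r, (b : Matrix (Fin r) (Fin r) ℂ) j j ≠ 0 := by
    have h := (Matrix.isUnit_iff_isUnit_det _).1 b.isUnit
    rw [Matrix.det_of_isUpperTriangular (fun k j h => hb k j h), isUnit_iff_ne_zero,
      Finset.prod_ne_zero_iff] at h
    exact fun j => h j (Finset.mem_univ j)
  unfold highestWeightFunction
  have h1 : ∀ i : Fin r, leadingMinor i (b : Matrix (Fin r) (Fin r) ℂ) ^ gap a i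
      = ∏ j, b j j ^ (if j ≤ i then gap a i else 0) := by
    intro i
    rw [minor_upper i _ hb, ← Finset.prod_subtype (Finset.univ.filter fun j => j ≤ i) (by simp)
      (fun j => (b : Matrix (Fin r) (Fin r) ℂ) j j), ← Finset.prod_zpow, Finset.prod_filter]
    refine Finset.prod_congr rfl fun j _ => ?_
    split_ifs <;> simp
  rw [Finset.prod_congr rfl fun i _ => h1 i, Finset.prod_comm]
  refine Finset.prod_congr rfl fun j _ => ?_
  conv_rhs => rw [← sum_gap a j]
  generalize hf : (fun i => if j ≤ i then gap a i else 0) = f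
  have hf' : ∀ i, (if j ≤ i then gap a i else 0) = f i := fun i => by rw [← hf]
  simp only [hf']
  induction (Finset.univ : Finset (Fin r)) using Finset.induction_on with
  | empty => simp
  | insert i s hi ih => rw [Finset.prod_insert hi, Finset.sum_insert hi, zpow_add₀ (hne j), ih]

theorem hwf_mul_upper (a : Fin r → ℤ) (x b : GL (Fin r) ℂ)
    (hb : ∀ k j : Fin r, j < k → b k j = 0) :
    highestWeightFunction a (x * b) = highestWeightFunction a x * highestWeightFunction a b := by
  unfold highestWeightFunction
  rw [← Finset.prod_mul_distrib]
  refine Finset.prod_congr rfl fun i _ => ?_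
  rw [Units.val_mul, minor_mul_upper i _ _ hb, mul_zpow]

theorem hwf_lower_mul (a : Fin r → ℤ) (l x : GL (Fin r) ℂ)
    (hl : ∀ k j : Fin r, k < j → l k j = 0) :
    highestWeightFunction a (l * x) = highestWeightFunction a l * highestWeightFunction a x := by
  unfold highestWeightFunction
  rw [← Finset.prod_mul_distrib]
  refine Finset.prod_congr rfl fun i _ => ?_
  rw [Units.val_mul, minor_lower_mul i _ _ hl, mul_zpow]

theorem mem_lower_mul (a : DominantWeight r) (F : GL (Fin r) ℂ → ℂ)
    (hF : F ∈ (irrepSub a).toSubmodule) (l x : GL (Fin r) ℂ)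
    (hl : ∀ k j : Fin r, k < j → l k j = 0) :
    F (l * x) = highestWeightFunction a.1 l * F x := by
  induction hF using Submodule.span_induction with
  | mem F h =>
    obtain ⟨g, rfl⟩ := h
    change highestWeightFunction a.1 (l * x * g) = _ * highestWeightFunction a.1 (x * g)
    rw [mul_assoc, hwf_lower_mul a.1 l _ hl]
  | zero => simp
  | add F F' _ _ h h' => simp only [Pi.add_apply, h, h']; ring
  | smul c F _ h => simp only [Pi.smul_apply, smul_eq_mul, h]; ring

/-- Evaluation of the coefficients at `x` and of the variables at the entries of `g`. -/
noncomputable def evalAt (x g : GL (Fin r) ℂ) :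
    MvPolynomial (Fin r × Fin r) (GL (Fin r) ℂ → ℂ) →+* ℂ :=
  MvPolynomial.eval₂Hom (Pi.evalRingHom (fun _ => ℂ) x)
    (fun p => (g : Matrix (Fin r) (Fin r) ℂ) p.1 p.2)

theorem evalAt_C (x g : GL (Fin r) ℂ) (f : GL (Fin r) ℂ → ℂ) :
    evalAt x g (MvPolynomial.C f) = f x := by
  simp [evalAt]

theorem evalAt_X (x g : GL (Fin r) ℂ) (p : Fin r × Fin r) :
    evalAt x g (MvPolynomial.X p) = (g : Matrix (Fin r) (Fin r) ℂ) p.1 p.2 := by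
  simp [evalAt]

theorem evalAt_eq (x g : GL (Fin r) ℂ)
    (q : MvPolynomial (Fin r × Fin r) (GL (Fin r) ℂ → ℂ)) :
    evalAt x g q = ∑ d ∈ q.support,
      q.coeff d x * ∏ p, (g : Matrix (Fin r) (Fin r) ℂ) p.1 p.2 ^ d p := by
  rw [evalAt, MvPolynomial.coe_eval₂Hom, MvPolynomial.eval₂_eq']
  rfl

/-- `F (x g)`, as a function of `g`, is `det g ^ e` times a polynomial in the entries of `g`,
with coefficients functions of `x`. -/
def Reg (e : ℤ) (F : GL (Fin r) ℂ → ℂ) : Prop :=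
  ∃ q : MvPolynomial (Fin r × Fin r) (GL (Fin r) ℂ → ℂ), ∀ x g : GL (Fin r) ℂ,
    F (x * g) = (g : Matrix (Fin r) (Fin r) ℂ).det ^ e * evalAt x g q

theorem det_gl_ne (g : GL (Fin r) ℂ) : (g : Matrix (Fin r) (Fin r) ℂ).det ≠ 0 :=
  ((Matrix.isUnit_iff_isUnit_det _).1 g.isUnit).ne_zero

theorem reg_one : Reg (r := r) 0 1 := ⟨1, by simp⟩

theorem reg_mul {e e' : ℤ} {F F' : GL (Fin r) ℂ → ℂ} (h : Reg e F) (h' : Reg e' F') :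
    Reg (e + e') (F * F') := by
  obtain ⟨q, hq⟩ := h
  obtain ⟨q', hq'⟩ := h'
  refine ⟨q * q', fun x g => ?_⟩
  rw [Pi.mul_apply, hq, hq', map_mul, zpow_add₀ (det_gl_ne g)]
  ring

theorem reg_add {e : ℤ} {F F' : GL (Fin r) ℂ → ℂ} (h : Reg e F) (h' : Reg e F') :
    Reg e (F + F') := by
  obtain ⟨q, hq⟩ := h
  obtain ⟨q', hq'⟩ := h'
  refine ⟨q + q', fun x g => ?_⟩
  rw [Pi.add_apply, hq, hq', map_add]
  ring

theorem reg_smul {e : ℤ} {F : GL (Fin r) ℂ → ℂ} (c : ℂ) (h : Reg e F) :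
    Reg e (c • F) := by
  obtain ⟨q, hq⟩ := h
  refine ⟨MvPolynomial.C (fun _ => c) * q, fun x g => ?_⟩
  rw [Pi.smul_apply, hq, map_mul, evalAt_C, smul_eq_mul]
  ring

theorem reg_translate {e : ℤ} {F : GL (Fin r) ℂ → ℂ} (h : GL (Fin r) ℂ) (hF : Reg e F) :
    Reg e (rightRegular r h F) := by
  obtain ⟨q, hq⟩ := hF
  refine ⟨MvPolynomial.C (fun _ => (h : Matrix (Fin r) (Fin r) ℂ).det ^ e) *
    q.eval₂ MvPolynomial.C fun p => ∑ k, MvPolynomial.X (p.1, k) *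
      MvPolynomial.C (fun _ => (h : Matrix (Fin r) (Fin r) ℂ) k p.2), fun x g => ?_⟩
  change F (x * g * h) = _
  have h1 : (evalAt x g).comp (MvPolynomial.eval₂Hom MvPolynomial.C fun p =>
      ∑ k, MvPolynomial.X (p.1, k) *
        MvPolynomial.C (fun _ => (h : Matrix (Fin r) (Fin r) ℂ) k p.2)) = evalAt x (g * h) := by
    refine MvPolynomial.ringHom_ext (fun f => ?_) fun p => ?_
    · simp [evalAt_C]
    · simp [evalAt_C, evalAt_X, Matrix.mul_apply]
  rw [mul_assoc, hq, ← h1, Units.val_mul, Matrix.det_mul, mul_zpow, map_mul, evalAt_C]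
  simp only [RingHom.comp_apply, MvPolynomial.coe_eval₂Hom]
  ring

theorem reg_prod {ι : Type*} (s : Finset ι) (e : ι → ℤ) (F : ι → GL (Fin r) ℂ → ℂ)
    (h : ∀ i ∈ s, Reg (e i) (F i)) : Reg (∑ i ∈ s, e i) (∏ i ∈ s, F i) := by
  classical
  induction s using Finset.induction_on with
  | empty => simpa using reg_one
  | insert i s hi ih =>
    rw [Finset.sum_insert hi, Finset.prod_insert hi]
    exact reg_mul (h i (by simp)) (ih fun j hj => h j (by simp [hj]))

theorem reg_minor_pow (i : Fin r) (m : ℕ) :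
    Reg 0 (fun x : GL (Fin r) ℂ => leadingMinor i (x : Matrix (Fin r) (Fin r) ℂ) ^ m) := by
  refine ⟨(Matrix.det (Matrix.of fun k j : {j // j ≤ i} => ∑ l,
    MvPolynomial.C (fun x : GL (Fin r) ℂ => (x : Matrix (Fin r) (Fin r) ℂ) k l) *
      MvPolynomial.X (l, (j : Fin r)))) ^ m, fun x g => ?_⟩
  rw [zpow_zero, one_mul, map_pow, RingHom.map_det]
  refine congrArg (· ^ m) ?_
  unfold leadingMinor
  congr 1
  ext k j
  simp [toSquareBlockProp_def, Matrix.mul_apply, RingHom.mapMatrix_apply, evalAt_C, evalAt_X]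

theorem reg_hwf (a : DominantWeight r) : ∃ e, Reg e (highestWeightFunction a.1) := by
  have h : highestWeightFunction a.1 = ∏ i, fun x : GL (Fin r) ℂ =>
      leadingMinor i (x : Matrix (Fin r) (Fin r) ℂ) ^ gap a.1 i := by
    ext x; simp [highestWeightFunction]
  rw [h]
  refine ⟨_, reg_prod Finset.univ
    (fun i : Fin r => if (i : ℕ) + 1 < r then 0 else gap a.1 i) _ fun i _ => ?_⟩
  split_ifs with hi
  · have h0 : 0 ≤ gap a.1 i := by
      rw [gap, dif_pos hi, sub_nonneg]
      exact a.2 (by simp [Fin.le_def])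
    obtain ⟨m, hm⟩ := Int.eq_ofNat_of_zero_le h0
    rw [hm]
    simpa using reg_minor_pow i m
  · have hd : ∀ x : Matrix (Fin r) (Fin r) ℂ, leadingMinor i x = x.det := by
      intro x
      have hle : ∀ j : Fin r, j ≤ i := fun j => by rw [Fin.le_def]; omega
      unfold leadingMinor
      rw [← Matrix.det_submatrix_equiv_self (Equiv.subtypeUnivEquiv hle) x]
      rfl
    refine ⟨MvPolynomial.C fun x => (x : Matrix (Fin r) (Fin r) ℂ).det ^ gap a.1 i, fun x g => ?_⟩
    simp only [hd]
    rw [Units.val_mul, Matrix.det_mul, mul_zpow, evalAt_C, mul_comm]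

theorem reg_of_mem (a : DominantWeight r) {e : ℤ} (he : Reg e (highestWeightFunction a.1))
    (F : GL (Fin r) ℂ → ℂ) (hF : F ∈ (irrepSub a).toSubmodule) : Reg e F := by
  induction hF using Submodule.span_induction with
  | mem F h =>
    obtain ⟨g, rfl⟩ := h
    exact reg_translate g he
  | zero => exact ⟨0, by simp⟩
  | add F F' _ _ h h' => exact reg_add h h'
  | smul c F _ h => exact reg_smul c h

theorem reg_expand {e : ℤ} {F : GL (Fin r) ℂ → ℂ}
    {q : MvPolynomial (Fin r × Fin r) (GL (Fin r) ℂ → ℂ)}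
    (hq : ∀ x g : GL (Fin r) ℂ, F (x * g) = (g : Matrix (Fin r) (Fin r) ℂ).det ^ e * evalAt x g q)
    (g : GL (Fin r) ℂ) :
    rightRegular r g F = (g : Matrix (Fin r) (Fin r) ℂ).det ^ e •
      ∑ d ∈ q.support, (∏ p, (g : Matrix (Fin r) (Fin r) ℂ) p.1 p.2 ^ d p) • q.coeff d := by
  ext x
  change F (x * g) = _
  rw [hq, evalAt_eq]
  simp [Finset.sum_apply, mul_comm]

theorem irrep_finite (a : DominantWeight r) : Module.Finite ℂ (IrrepSpace a) := by
  obtain ⟨e, q, hq⟩ := reg_hwf a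
  have hle : (irrepSub a).toSubmodule ≤
      Submodule.span ℂ (Set.range fun d : q.support => q.coeff d) := by
    refine Submodule.span_le.2 ?_
    rintro _ ⟨g, rfl⟩
    change rightRegular r g _ ∈ _
    rw [reg_expand hq g]
    refine Submodule.smul_mem _ _ (Submodule.sum_mem _ fun d hd => Submodule.smul_mem _ _ ?_)
    exact Submodule.subset_span ⟨⟨d, hd⟩, rfl⟩
  have hfin : FiniteDimensional ℂ
      (Submodule.span ℂ (Set.range fun d : q.support => q.coeff d)) :=
    FiniteDimensional.span_of_finite ℂ (Set.finite_range _)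
  exact Submodule.finiteDimensional_of_le hle

theorem irrep_rational (a : DominantWeight r) : IsRational (irrep a) := by
  intro v φ
  obtain ⟨e, he⟩ := reg_hwf a
  obtain ⟨q, hq⟩ := reg_of_mem a he v.1 v.2
  obtain ⟨ψ, hψ⟩ := φ.exists_extend
  refine ⟨e, ∑ d ∈ q.support, MvPolynomial.monomial d (ψ (q.coeff d)), fun g => ?_⟩
  have h1 : φ (irrep a g v) = ψ (rightRegular r g v.1) := by
    rw [← hψ]; rfl
  rw [h1, reg_expand hq g, map_smul, map_sum, smul_eq_mul, map_sum]
  congr 1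
  refine Finset.sum_congr rfl fun d _ => ?_
  rw [map_smul, smul_eq_mul, MvPolynomial.eval_monomial, mul_comm, Finsupp.prod_fintype]
  simp

theorem coeff_mem {M : Type*} [AddCommGroup M] [Module ℂ M] (W : Submodule ℂ M) (N : ℕ)
    (c : ℕ → M) (h : ∀ s : ℂ, s ≠ 0 → ∑ m ∈ Finset.range N, s ^ m • c m ∈ W) (m : ℕ) (hm : m < N) :
    c m ∈ W := by
  by_contra hc
  obtain ⟨ψ, hψ, hW⟩ := Submodule.exists_le_ker_of_notMem hc
  apply hψ
  let P : Polynomial ℂ := ∑ k ∈ Finset.range N, Polynomial.monomial k (ψ (c k))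
  have hP : P = 0 := by
    refine Polynomial.eq_zero_of_infinite_isRoot P
      (Set.Infinite.mono ?_ (Set.finite_singleton (0 : ℂ)).infinite_compl)
    intro s hs
    have h1 := LinearMap.mem_ker.1 (hW (h s hs))
    simp only [map_sum, map_smul, smul_eq_mul] at h1
    simp only [Set.mem_ofPred_eq, Polynomial.IsRoot.def, P, Polynomial.eval_finsetSum,
      Polynomial.eval_monomial]
    rw [← h1]
    exact Finset.sum_congr rfl fun k _ => mul_comm _ _
  have h2 : P.coeff m = ψ (c m) := by
    simp [P, Polynomial.finsetSum_coeff, Polynomial.coeff_monomial, hm]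
  rw [← h2, hP, Polynomial.coeff_zero]

theorem hwf_one (a : Fin r → ℤ) : highestWeightFunction a 1 = 1 := by
  rw [hwf_upper a 1 fun k j h => by simp [h.ne']]
  simp

/-- The diagonal matrix with entries `1, s, s², …`. -/
noncomputable def torus (r : ℕ) (s : ℂ) (hs : s ≠ 0) : GL (Fin r) ℂ :=
  Matrix.GeneralLinearGroup.mkOfDetNeZero (Matrix.diagonal fun i : Fin r => s ^ (i : ℕ))
    (by rw [Matrix.det_diagonal]; exact Finset.prod_ne_zero_iff.2 fun i _ => pow_ne_zero _ hs)

theorem torus_val (s : ℂ) (hs : s ≠ 0) :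
    (torus r s hs : Matrix (Fin r) (Fin r) ℂ) = Matrix.diagonal fun i : Fin r => s ^ (i : ℕ) := rfl

theorem prod_zpow_sum {ι : Type*} (t : Finset ι) (s : ℂ) (hs : s ≠ 0) (f : ι → ℤ) :
    ∏ i ∈ t, s ^ f i = s ^ ∑ i ∈ t, f i := by
  classical
  induction t using Finset.induction_on with
  | empty => simp
  | insert i t hi ih => rw [Finset.prod_insert hi, Finset.sum_insert hi, zpow_add₀ hs, ih]

theorem hwf_torus (a : Fin r → ℤ) : ∃ α : ℤ, ∀ (s : ℂ) (hs : s ≠ 0),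
    highestWeightFunction a (torus r s hs) = s ^ α := by
  refine ⟨∑ i : Fin r, (i : ℤ) * a i, fun s hs => ?_⟩
  rw [hwf_upper a _ fun k j h => by simp [torus_val, h.ne'], ← prod_zpow_sum _ s hs]
  refine Finset.prod_congr rfl fun i _ => ?_
  rw [torus_val, Matrix.diagonal_apply_eq, _root_.zpow_mul, zpow_natCast]

theorem det_torus (e : ℤ) : ∃ β : ℤ, ∀ (s : ℂ) (hs : s ≠ 0),
    (torus r s hs : Matrix (Fin r) (Fin r) ℂ).det ^ e = s ^ β := by
  refine ⟨(∑ i : Fin r, (i : ℤ)) * e, fun s hs => ?_⟩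
  rw [torus_val, Matrix.det_diagonal, _root_.zpow_mul, ← prod_zpow_sum _ s hs]
  simp

theorem torus_family {e : ℤ} {F : GL (Fin r) ℂ → ℂ} (hF : Reg e F) :
    ∃ Q : Polynomial (GL (Fin r) ℂ → ℂ), ∀ (s : ℂ) (hs : s ≠ 0) (x : GL (Fin r) ℂ),
      F (x * torus r s hs) = (torus r s hs : Matrix (Fin r) (Fin r) ℂ).det ^ e *
        ∑ m ∈ Finset.range (Q.natDegree + 1), s ^ m * Q.coeff m x := by
  obtain ⟨q, hq⟩ := hF
  let T := MvPolynomial.eval₂Hom (Polynomial.C : (GL (Fin r) ℂ → ℂ) →+* _)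
    (fun p : Fin r × Fin r => if p.1 = p.2 then Polynomial.X ^ (p.1 : ℕ) else 0)
  refine ⟨T q, fun s hs x => ?_⟩
  have h1 : (Polynomial.eval₂RingHom (Pi.evalRingHom (fun _ => ℂ) x) s).comp T
      = evalAt x (torus r s hs) := by
    refine MvPolynomial.ringHom_ext (fun f => ?_) fun p => ?_
    · simp [evalAt_C, T]
    · simp only [evalAt_X, T, RingHom.comp_apply, MvPolynomial.eval₂Hom_X', torus_val,
        Matrix.diagonal_apply]
      split_ifs <;> simp
  rw [hq, ← h1, RingHom.comp_apply, Polynomial.coe_eval₂RingHom, Polynomial.eval₂_eq_sum_range]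
  congr 1
  exact Finset.sum_congr rfl fun m _ => mul_comm _ _

theorem upper_family (a : DominantWeight r) {e : ℤ} {F : GL (Fin r) ℂ → ℂ}
    (hF : F ∈ (irrepSub a).toSubmodule) (hR : Reg e F) (b : GL (Fin r) ℂ)
    (hb : ∀ k j : Fin r, j < k → b k j = 0) :
    ∃ P : Polynomial ℂ, P.eval 0 = F 1 * highestWeightFunction a.1 b ∧
      ∀ (s : ℂ) (hs : s ≠ 0), F (b * torus r s hs) =
        highestWeightFunction a.1 (torus r s hs) * P.eval s := by
  obtain ⟨q, hq⟩ := hR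
  let T := MvPolynomial.eval₂Hom (Polynomial.C.comp (Pi.evalRingHom (fun _ => ℂ) (1 : GL (Fin r) ℂ)))
    (fun p : Fin r × Fin r => if p.1 ≤ p.2 then
      Polynomial.C ((b : Matrix (Fin r) (Fin r) ℂ) p.1 p.2) *
        Polynomial.X ^ ((p.2 : ℕ) - (p.1 : ℕ)) else 0)
  have hdet : (b : Matrix (Fin r) (Fin r) ℂ).det = ∏ i, (b : Matrix (Fin r) (Fin r) ℂ) i i :=
    Matrix.det_of_isUpperTriangular fun k j h => hb k j h
  let D : GL (Fin r) ℂ := Matrix.GeneralLinearGroup.mkOfDetNeZero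
    (Matrix.diagonal fun i => (b : Matrix (Fin r) (Fin r) ℂ) i i)
    (by rw [Matrix.det_diagonal, ← hdet]; exact det_gl_ne b)
  have hD : (D : Matrix (Fin r) (Fin r) ℂ)
      = Matrix.diagonal fun i => (b : Matrix (Fin r) (Fin r) ℂ) i i := rfl
  refine ⟨Polynomial.C ((b : Matrix (Fin r) (Fin r) ℂ).det ^ e) * T q, ?_, fun s hs => ?_⟩
  · have h1 : (Polynomial.evalRingHom 0).comp T = evalAt 1 D := by
      refine MvPolynomial.ringHom_ext (fun f => ?_) fun p => ?_
      · simp [evalAt_C, T]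
      · simp only [evalAt_X, T, RingHom.comp_apply, MvPolynomial.eval₂Hom_X', hD,
          Matrix.diagonal_apply]
        rcases lt_trichotomy p.1 p.2 with h | h | h
        · have h' : ((p.2 : ℕ) - (p.1 : ℕ)) ≠ 0 := by have := Fin.lt_def.1 h; omega
          simp [h.le, h.ne, h']
        · simp [h]
        · simp [not_le.2 h, h.ne']
    have h2 : F D = highestWeightFunction a.1 D * F 1 := by
      conv_lhs => rw [← mul_one D]
      exact mem_lower_mul a F hF D 1 fun k j h => by rw [hD, Matrix.diagonal_apply_ne _ h.ne]
    have h3 : highestWeightFunction a.1 D = highestWeightFunction a.1 b := by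
      rw [hwf_upper a.1 D fun k j h => by rw [hD, Matrix.diagonal_apply_ne _ h.ne'],
        hwf_upper a.1 b hb, hD]
      simp
    have h4 := hq 1 D
    rw [one_mul, hD, Matrix.det_diagonal, ← hdet, h2, h3, ← h1] at h4
    rw [Polynomial.eval_mul, Polynomial.eval_C, mul_comm (F 1), h4]
    rfl
  · obtain ⟨y, hy⟩ : ∃ y, torus r s hs * y = b * torus r s hs :=
      ⟨(torus r s hs)⁻¹ * (b * torus r s hs), mul_inv_cancel_left _ _⟩
    have hy' : ∀ i j, (y : Matrix (Fin r) (Fin r) ℂ) i j =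
        if i ≤ j then (b : Matrix (Fin r) (Fin r) ℂ) i j * s ^ ((j : ℕ) - (i : ℕ)) else 0 := by
      intro i j
      have h1 : (torus r s hs * y : GL (Fin r) ℂ).1 i j = (b * torus r s hs : GL (Fin r) ℂ).1 i j := by
        rw [hy]
      rw [Units.val_mul, Units.val_mul, torus_val, Matrix.diagonal_mul, Matrix.mul_diagonal] at h1
      refine mul_left_cancel₀ (pow_ne_zero (i : ℕ) hs) (h1.trans ?_)
      split_ifs with h
      · have h2 : s ^ (j : ℕ) = s ^ (i : ℕ) * s ^ ((j : ℕ) - (i : ℕ)) := by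
          rw [← pow_add]; congr 1; have := Fin.le_def.1 h; omega
        rw [h2]; ring
      · rw [hb i j (not_le.1 h)]; ring
    have h1 : (Polynomial.evalRingHom s).comp T = evalAt 1 y := by
      refine MvPolynomial.ringHom_ext (fun f => ?_) fun p => ?_
      · simp [evalAt_C, T]
      · simp only [evalAt_X, T, RingHom.comp_apply, MvPolynomial.eval₂Hom_X', hy']
        split_ifs <;> simp
    have hdy : (y : Matrix (Fin r) (Fin r) ℂ).det = (b : Matrix (Fin r) (Fin r) ℂ).det := by
      have h2 := congrArg (fun z : GL (Fin r) ℂ => (z : Matrix (Fin r) (Fin r) ℂ).det) hy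
      simp only [Units.val_mul, Matrix.det_mul] at h2
      rw [mul_comm] at h2
      exact mul_right_cancel₀ (det_gl_ne _) h2
    have h3 := hq 1 y
    rw [one_mul, hdy, ← h1] at h3
    rw [← hy, mem_lower_mul a F hF _ y fun k j h => by
      rw [torus_val, Matrix.diagonal_apply_ne _ h.ne], h3, Polynomial.eval_mul, Polynomial.eval_C]
    rfl

theorem zero_of_generic {e : ℤ} {F : GL (Fin r) ℂ → ℂ} (hR : Reg e F)
    (h : ∀ x : GL (Fin r) ℂ, (∀ i : Fin r, ((x : Matrix (Fin r) (Fin r) ℂ).toSquareBlockProp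
      fun j => j < i).det ≠ 0) → F x = 0) : F = 0 := by
  obtain ⟨q, hq⟩ := hR
  let A := Matrix.mvPolynomialX (Fin r) (Fin r) ℂ
  let p : MvPolynomial (Fin r × Fin r) ℂ :=
    MvPolynomial.map (Pi.evalRingHom (fun _ => ℂ) (1 : GL (Fin r) ℂ)) q
  let E : MvPolynomial (Fin r × Fin r) ℂ :=
    A.det * ∏ i : Fin r, (A.toSquareBlockProp fun j => j < i).det
  have hA : ∀ x : Matrix (Fin r) (Fin r) ℂ,
      (MvPolynomial.eval fun p : Fin r × Fin r => x p.1 p.2).mapMatrix A = x :=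
    fun x => Matrix.mvPolynomialX_mapMatrix_eval x
  have hE : ∀ x : Matrix (Fin r) (Fin r) ℂ, MvPolynomial.eval (fun p => x p.1 p.2) E =
      x.det * ∏ i : Fin r, (x.toSquareBlockProp fun j => j < i).det := by
    intro x
    simp only [E, map_mul, map_prod]
    congr 1
    · rw [RingHom.map_det, hA]
    · refine Finset.prod_congr rfl fun i _ => ?_
      rw [RingHom.map_det]
      congr 1
      conv_rhs => rw [← hA x]
      rfl
  have hp : ∀ x : GL (Fin r) ℂ, F x = (x : Matrix (Fin r) (Fin r) ℂ).det ^ e *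
      MvPolynomial.eval (fun p => (x : Matrix (Fin r) (Fin r) ℂ) p.1 p.2) p := by
    intro x
    have h1 := hq 1 x
    rw [one_mul] at h1
    rw [h1, MvPolynomial.eval_map]
    rfl
  have hE0 : E ≠ 0 := by
    intro h0
    have h1 := hE 1
    rw [h0, map_zero, Matrix.det_one, one_mul] at h1
    refine Finset.prod_ne_zero_iff.2 (fun i _ => ?_) h1.symm
    have h2 : ((1 : Matrix (Fin r) (Fin r) ℂ).toSquareBlockProp fun j => j < i) = 1 := by
      ext k j
      simp [toSquareBlockProp_def, Matrix.one_apply, Subtype.ext_iff]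
    rw [h2, Matrix.det_one]
    exact one_ne_zero
  have hpE : p * E = 0 := by
    refine MvPolynomial.funext fun z => ?_
    rw [map_mul, map_zero]
    let x : Matrix (Fin r) (Fin r) ℂ := Matrix.of fun i j => z (i, j)
    have hz : z = fun p => x p.1 p.2 := rfl
    rw [hz]
    by_cases hx : MvPolynomial.eval (fun p => x p.1 p.2) E = 0
    · rw [hx, mul_zero]
    · have hx' := hx
      rw [hE] at hx'
      obtain ⟨hd, hm⟩ := mul_ne_zero_iff.1 hx'
      have h1 := h (Matrix.GeneralLinearGroup.mkOfDetNeZero x hd)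
        fun i => (Finset.prod_ne_zero_iff.1 hm) i (Finset.mem_univ i)
      rw [hp] at h1
      rcases mul_eq_zero.1 h1 with h2 | h2
      · exact absurd h2 (zpow_ne_zero _ hd)
      · exact mul_eq_zero_of_left h2 _
  have hp0 : p = 0 := (mul_eq_zero.1 hpE).resolve_right hE0
  funext x
  rw [hp, hp0, map_zero, mul_zero]
  rfl

theorem exists_lower (x : GL (Fin r) ℂ)
    (hx : ∀ i : Fin r, ((x : Matrix (Fin r) (Fin r) ℂ).toSquareBlockProp
      fun j => j < i).det ≠ 0) :
    ∃ l : GL (Fin r) ℂ, (∀ k j : Fin r, k < j → l k j = 0) ∧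
      ∀ k j : Fin r, j < k → (l * x) k j = 0 := by
  have h1 : ∀ i : Fin r, ∃ v : {j // j < i} → ℂ, ∀ j : {j // j < i},
      ∑ k, v k * (x : Matrix (Fin r) (Fin r) ℂ) k j = - (x : Matrix (Fin r) (Fin r) ℂ) i j := by
    intro i
    let B := (x : Matrix (Fin r) (Fin r) ℂ).toSquareBlockProp fun j => j < i
    let w : {j // j < i} → ℂ := fun j => - (x : Matrix (Fin r) (Fin r) ℂ) i j
    refine ⟨w ᵥ* B⁻¹, fun j => ?_⟩
    have h2 : (w ᵥ* B⁻¹) ᵥ* B = w := by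
      rw [Matrix.vecMul_vecMul, Matrix.nonsing_inv_mul B (isUnit_iff_ne_zero.2 (hx i)),
        Matrix.vecMul_one]
    exact congrFun h2 j
  choose v hv using h1
  let L : Matrix (Fin r) (Fin r) ℂ := Matrix.of fun i j =>
    if h : j < i then v i ⟨j, h⟩ else if j = i then 1 else 0
  have hL : ∀ k j : Fin r, k < j → L k j = 0 := by
    intro k j h
    simp [L, not_lt.2 h.le, h.ne']
  have hdet : L.det = 1 := by
    rw [Matrix.det_of_isLowerTriangular L fun k j h => hL k j h]
    simp [L]
  refine ⟨Matrix.GeneralLinearGroup.mkOfDetNeZero L (by rw [hdet]; exact one_ne_zero), hL, ?_⟩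
  intro k j hjk
  rw [Units.val_mul]
  change (L * (x : Matrix (Fin r) (Fin r) ℂ)) k j = 0
  rw [Matrix.mul_apply]
  have h3 : ∀ m : Fin r, L k m * (x : Matrix (Fin r) (Fin r) ℂ) m j =
      (if h : m < k then v k ⟨m, h⟩ * (x : Matrix (Fin r) (Fin r) ℂ) m j else 0) +
        (if m = k then (x : Matrix (Fin r) (Fin r) ℂ) m j else 0) := by
    intro m
    simp only [L, Matrix.of_apply]
    split_ifs with h h' h'
    · exact absurd h' h.ne
    · simp
    · simp
    · simp
  rw [Finset.sum_congr rfl fun m _ => h3 m, Finset.sum_add_distrib, Finset.sum_ite_eq',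
    if_pos (Finset.mem_univ k), ← sum_subtype_of_zero (fun m => m < k)]
  · have h4 := hv k ⟨j, hjk⟩
    rw [Finset.sum_congr rfl fun (m : {m // m < k}) _ => dif_pos m.2, h4, neg_add_cancel]
  · intro m hm
    rw [dif_neg hm]

theorem hwf_mem (a : DominantWeight r) (W : Submodule ℂ (GL (Fin r) ℂ → ℂ))
    (hW : W ≤ (irrepSub a).toSubmodule) (hinv : ∀ g, ∀ F ∈ W, rightRegular r g F ∈ W)
    (F : GL (Fin r) ℂ → ℂ) (hF : F ∈ W) (hF1 : F 1 ≠ 0) : highestWeightFunction a.1 ∈ W := by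
  obtain ⟨e, he⟩ := reg_hwf a
  have hreg : ∀ F ∈ W, Reg e F := fun F hF => reg_of_mem a he F (hW hF)
  obtain ⟨Q, hQ⟩ := torus_family (hreg F hF)
  obtain ⟨α, hα⟩ := hwf_torus a.1
  obtain ⟨β, hβ⟩ := det_torus (r := r) e
  have hcoeff : ∀ m, Q.coeff m ∈ W := by
    intro m
    by_cases hm : m < Q.natDegree + 1
    · refine coeff_mem W (Q.natDegree + 1) Q.coeff (fun s hs => ?_) m hm
      have h1 := W.smul_mem (s ^ (-β)) (hinv (torus r s hs) F hF)
      convert h1 using 1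
      funext x
      change _ = s ^ (-β) * F (x * torus r s hs)
      rw [hQ, hβ, ← mul_assoc, ← zpow_add₀ hs, neg_add_cancel, zpow_zero, one_mul]
      simp [Finset.sum_apply]
    · rw [Polynomial.coeff_eq_zero_of_natDegree_lt (by omega)]
      exact W.zero_mem
  let R : GL (Fin r) ℂ → Polynomial ℂ := fun b =>
    Q.map (Pi.evalRingHom (fun _ => ℂ) b)
  have hR : ∀ (b : GL (Fin r) ℂ) (s : ℂ), (R b).eval s =
      ∑ m ∈ Finset.range (Q.natDegree + 1), s ^ m * Q.coeff m b := by
    intro b s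
    rw [Polynomial.eval_map, Polynomial.eval₂_eq_sum_range]
    exact Finset.sum_congr rfl fun m _ => mul_comm _ _
  have hext : ∀ P P' : Polynomial ℂ, (∀ s : ℂ, s ≠ 0 → P.eval s = P'.eval s) → P = P' := by
    intro P P' h
    exact Polynomial.eq_of_infinite_eval_eq P P'
      (Set.Infinite.mono h (Set.finite_singleton (0 : ℂ)).infinite_compl)
  have hkey : ∀ b : GL (Fin r) ℂ, (∀ k j : Fin r, j < k → b k j = 0) →
      ∃ P : Polynomial ℂ, P.eval 0 = F 1 * highestWeightFunction a.1 b ∧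
        ∀ s : ℂ, s ≠ 0 → s ^ β * (R b).eval s = s ^ α * P.eval s := by
    intro b hb
    obtain ⟨P, hP0, hP⟩ := upper_family a (hW hF) (hreg F hF) b hb
    refine ⟨P, hP0, fun s hs => ?_⟩
    rw [hR, ← hβ s hs, ← hα s hs, ← hQ s hs, hP s hs]
  have hαβ : β ≤ α := by
    by_contra hlt
    obtain ⟨P, hP0, hP⟩ := hkey 1 fun k j h => by simp [h.ne']
    obtain ⟨k, hk⟩ := Int.eq_ofNat_of_zero_le (show 0 ≤ β - α by omega)
    have hk0 : k ≠ 0 := by omega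
    have h1 : Polynomial.X ^ k * R 1 = P := by
      refine hext _ _ fun s hs => ?_
      have h2 := hP s hs
      rw [show β = α + k by omega, zpow_add₀ hs, mul_assoc] at h2
      have h3 := mul_left_cancel₀ (zpow_ne_zero α hs) h2
      rw [← h3, Polynomial.eval_mul, Polynomial.eval_pow, Polynomial.eval_X, zpow_natCast]
    rw [← h1, hwf_one, mul_one] at hP0
    apply hF1
    rw [← hP0]
    simp [hk0]
  obtain ⟨k, hk⟩ := Int.eq_ofNat_of_zero_le (sub_nonneg.2 hαβ)
  have hc : ∀ b : GL (Fin r) ℂ, (∀ k j : Fin r, j < k → b k j = 0) →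
      Q.coeff k b = F 1 * highestWeightFunction a.1 b := by
    intro b hb
    obtain ⟨P, hP0, hP⟩ := hkey b hb
    have h1 : R b = P * Polynomial.X ^ k := by
      refine hext _ _ fun s hs => ?_
      have h2 := hP s hs
      rw [show α = β + k by omega, zpow_add₀ hs, mul_assoc] at h2
      have h3 := mul_left_cancel₀ (zpow_ne_zero β hs) h2
      rw [h3, Polynomial.eval_mul, Polynomial.eval_pow, Polynomial.eval_X, zpow_natCast, mul_comm]
    have h2 : (R b).coeff k = Q.coeff k b := by simp [R, Polynomial.coeff_map]
    rw [← h2, h1, ← hP0, ← Polynomial.coeff_zero_eq_eval_zero]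
    simpa using Polynomial.coeff_mul_X_pow P k 0
  have hhw : highestWeightFunction a.1 ∈ (irrepSub a).toSubmodule :=
    Submodule.subset_span ⟨1, by simp⟩
  have hzero : Q.coeff k - F 1 • highestWeightFunction a.1 = 0 := by
    have hmem := (irrepSub a).toSubmodule.sub_mem (hW (hcoeff k))
      ((irrepSub a).toSubmodule.smul_mem (F 1) hhw)
    refine zero_of_generic (reg_of_mem a he _ hmem) fun x hx => ?_
    obtain ⟨l, hl, hlx⟩ := exists_lower x hx
    have h1 := mem_lower_mul a _ hmem l x hl
    have h2 : (Q.coeff k - F 1 • highestWeightFunction a.1) (l * x) = 0 := by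
      rw [Pi.sub_apply, Pi.smul_apply, smul_eq_mul, hc _ hlx, sub_self]
    have h3 : highestWeightFunction a.1 l ≠ 0 := by
      have h4 := hwf_lower_mul a.1 l l⁻¹ hl
      rw [mul_inv_cancel, hwf_one] at h4
      exact left_ne_zero_of_mul (h4 ▸ one_ne_zero)
    rw [h2] at h1
    exact (mul_eq_zero.1 h1.symm).resolve_left h3
  have h5 : highestWeightFunction a.1 = (F 1)⁻¹ • Q.coeff k := by
    rw [sub_eq_zero.1 hzero, smul_smul, inv_mul_cancel₀ hF1, one_smul]
  rw [h5]
  exact W.smul_mem _ (hcoeff k)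

theorem irrep_irreducible (a : DominantWeight r) : (irrep a).IsIrreducible := by
  have hhw : highestWeightFunction a.1 ∈ (irrepSub a).toSubmodule :=
    Submodule.subset_span ⟨1, by simp⟩
  have hne : (⊥ : Subrepresentation (irrep a)) ≠ ⊤ := by
    intro h
    have h1 : (⟨_, hhw⟩ : IrrepSpace a) ∈ (⊤ : Subrepresentation (irrep a)).toSubmodule :=
      Submodule.mem_top
    rw [← h] at h1
    have h2 : (⟨_, hhw⟩ : IrrepSpace a) = 0 := (Submodule.mem_bot ℂ).1 h1
    have h3 := congrFun (congrArg Subtype.val h2) 1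
    exact one_ne_zero ((hwf_one a.1).symm.trans h3)
  refine { exists_pair_ne := ⟨⊥, ⊤, hne⟩, eq_bot_or_eq_top := fun S => ?_ }
  by_cases hS : S.toSubmodule = ⊥
  · exact Or.inl (Subrepresentation.toSubmodule_injective hS)
  · refine Or.inr (Subrepresentation.toSubmodule_injective ?_)
    obtain ⟨F, hFS, hF0⟩ := Submodule.exists_mem_ne_zero_of_ne_bot hS
    let W : Submodule ℂ (GL (Fin r) ℂ → ℂ) :=
      S.toSubmodule.map (irrepSub a).toSubmodule.subtype
    have hW : W ≤ (irrepSub a).toSubmodule := by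
      rintro _ ⟨y, _, rfl⟩
      exact y.2
    have hinv : ∀ g, ∀ y ∈ W, rightRegular r g y ∈ W := by
      rintro g _ ⟨y, hy, rfl⟩
      exact ⟨irrep a g y, S.apply_mem_toSubmodule g hy, rfl⟩
    obtain ⟨x, hx⟩ : ∃ x, F.1 x ≠ 0 := by
      by_contra h
      push Not at h
      exact hF0 (Subtype.ext (funext h))
    have hmem : highestWeightFunction a.1 ∈ W := by
      refine hwf_mem a W hW hinv (rightRegular r x F.1) (hinv x _ ⟨F, hFS, rfl⟩) ?_
      change F.1 (1 * x) ≠ 0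
      rwa [one_mul]
    have hle : (irrepSub a).toSubmodule ≤ W := by
      refine Submodule.span_le.2 ?_
      rintro _ ⟨g, rfl⟩
      exact hinv g _ hmem
    refine eq_top_iff.2 fun y _ => ?_
    obtain ⟨z, hz, hzy⟩ := hle y.2
    have : z = y := Subtype.ext hzy
    exact this ▸ hz

/-- `ρ_a` is the irreducible representation with highest weight `a`. -/
theorem irrep_spec (a : DominantWeight r) : IsIrrepOfHighestWeight (irrep a) a.1 where
  finite := irrep_finite a
  rational := irrep_rational a
  irreducible := irrep_irreducible a
  highest := by
    have hhw : highestWeightFunction a.1 ∈ (irrepSub a).toSubmodule :=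
      Submodule.subset_span ⟨1, by simp⟩
    refine ⟨⟨_, hhw⟩, fun h => ?_, fun b hb => Subtype.ext (funext fun x => ?_)⟩
    · have h3 := congrFun (congrArg Subtype.val h) 1
      exact one_ne_zero ((hwf_one a.1).symm.trans h3)
    · change highestWeightFunction a.1 (x * b) = (∏ i, b i i ^ a.1 i) * highestWeightFunction a.1 x
      rw [hwf_mul_upper a.1 x b hb, hwf_upper a.1 b hb, mul_comm]

end IrrepSpec

/-! ### Multiplicities -/

/-- The multiplicity of `ρ_ν` in `ρ_μ^∨ ⊗ ρ_λ`, i.e. the dimension of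
`Hom_{GL_r(ℂ)} (ρ_ν, ρ_μ^∨ ⊗ ρ_λ)`. -/
noncomputable def multiplicity {r : ℕ} (mu lam nu : DominantWeight r) : ℕ :=
  Module.finrank ℂ
    (Representation.IntertwiningMap (irrep nu) ((irrep mu).dual.tprod (irrep lam)))

open Classical in
/-- `N_{μλ}^ν`: the multiplicity of `ρ_ν` in `ρ_μ^∨ ⊗ ρ_λ` if `ν_r ≥ 0` (equivalently, all
`ν_i ≥ 0`), and `0` otherwise. -/
noncomputable def truncMultiplicity {r : ℕ} (mu lam nu : DominantWeight r) : ℕ :=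
  if ∀ i, 0 ≤ nu.1 i then multiplicity mu lam nu else 0

end SkewSchur

open scoped MatrixGroups TensorProduct

namespace SkewSchur

/-! ### Schur polynomials: the bialternant formula, Schur expansions, extraction of coefficients. -/

section SymmetricFunctions

open Finset

/-! Both sides are governed by the Littlewood-Richardson coefficients in `r` variables. Tensor-hom
adjunction turns `N_{μλ}^ν`, for a partition `ν`, into `dim Hom(ρ_ν ⊗ ρ_μ, ρ_λ)`. Two facts remain:
this dimension is the coefficient of `s_λ` in `s_μ s_ν` in `r` variables (`repDim_tprod_irrep`), and
in `n` variables the coefficients for `μ`, `λ` with at most `r` parts are the same when `ν` has at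
most `r` parts and vanish otherwise (`lrCoeff_pad`, `exists_eq_pad_of_lrCoeff_ne_zero`).

The second fact follows by setting variables to zero one at a time: by the bialternant formula `s_ν`
goes to `0` or to the Schur polynomial of the same partition, according to whether its last part is
nonzero.

For the first fact, let `rowRep b` be the space of polynomials in the matrix entries of degree `b_i`
in row `i`, under right translation; it is the tensor product of the `Sym^{b_i}(ℂ^r)`. Frobenius
reciprocity (`frobeniusEquiv`) says that, for a polynomial representation, `dim Hom(ρ, rowRep b)` is
the coefficient of `x^b` in the character of `ρ` (`exists_character`). The coefficient of `s_a` in a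
symmetric polynomial is the alternating sum over `σ` of its coefficients at the exponents `a_i - i +
σ(i)` (`schurCoeff_eq_sum_perm`), and these are the indices in the determinant defining `s_a`. So
the virtual representation `∑ sgn(σ) rowRep(a_i - i + σ(i))` computes Schur coefficients of
characters.

It remains to identify this virtual representation with `ρ_a`. Each `rowRep b` is semisimple,
because the Fischer form makes `g` and its conjugate transpose adjoint (`rowRep_isSemisimple`). The
virtual representation has norm one, since the coefficient of `s_a` in `s_a` is one
(`jacobiTrudi_norm_eq_one`), and a highest weight argument shows that `ρ_a` occurs in it exactly
once (`sum_sign_repDim_irrep`). Hence it has the Hom dimensions of `ρ_a` (`sum_sign_repDim`), the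
character of `ρ_a` is `s_a` (`trace_irrep`), and the character of `ρ_ν ⊗ ρ_μ` is `s_ν s_μ`. -/

theorem hsymm_eq_sum_finsuppAntidiag (n : ℕ) (R : Type*) [CommRing R] (m : ℕ) :
    MvPolynomial.hsymm (Fin n) R m =
      ∑ l ∈ finsuppAntidiag univ m, ∏ i, (MvPolynomial.X i : MvPolynomial (Fin n) R) ^ l i := by
  classical
  unfold MvPolynomial.hsymm
  refine Finset.sum_bij' (fun s _ => (Sym.equivNatSum (Fin n) m s).1)
    (fun l hl => (Sym.equivNatSum (Fin n) m).symm ⟨l, ?_⟩) ?_ ?_ ?_ ?_ ?_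
  · rw [mem_finsuppAntidiag] at hl
    rw [Finsupp.sum_fintype _ _ (by simp)]
    simpa using hl.1
  · intro s _
    rw [mem_finsuppAntidiag]
    refine ⟨?_, by simp⟩
    have := (Sym.equivNatSum (Fin n) m s).2
    rw [Finsupp.sum_fintype _ _ (by simp)] at this
    exact this
  · intro l hl; simp
  · intro s hs; simp
  · intro l hl; simp
  · intro s _
    rw [Finset.prod_multiset_map_count]
    refine Finset.prod_subset (Finset.subset_univ _) fun i _ hi => ?_
    rw [Multiset.count_eq_zero_of_notMem (by simpa using hi), pow_zero]

/-- The polynomial `∏_{i ≠ k} (1 - x_i T)`. -/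
noncomputable def omitProd (n : ℕ) (k : Fin n) : Polynomial (MvPolynomial (Fin n) ℤ) :=
  ∏ i ∈ univ.erase k, (1 - Polynomial.C (MvPolynomial.X i) * Polynomial.X)

/-- There are `n - 1` factors of degree at most one. Thus `n` coefficients carry the whole
polynomial and fit into one column of an `n × n` matrix. -/
theorem omitProd_natDegree_lt (n : ℕ) (k : Fin n) : (omitProd n k).natDegree < n := by
  have hn : 0 < n := k.pos
  have h : (omitProd n k).natDegree ≤ ∑ i ∈ univ.erase k, 1 := by
    refine (Polynomial.natDegree_prod_le _ _).trans (Finset.sum_le_sum fun i _ => ?_)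
    compute_degree
  simp at h
  omega

theorem one_sub_mul_mk_pow {R : Type*} [CommRing R] (a : R) :
    (1 - PowerSeries.C a * PowerSeries.X) * PowerSeries.mk (fun m => a ^ m) = 1 := by
  ext m
  rw [sub_mul, one_mul, map_sub, mul_assoc, PowerSeries.coeff_C_mul]
  cases m with
  | zero => simp
  | succ m => rw [PowerSeries.coeff_succ_X_mul]; simp [pow_succ', PowerSeries.coeff_one]

theorem mk_hsymm_eq_prod (n : ℕ) :
    PowerSeries.mk (fun m => MvPolynomial.hsymm (Fin n) ℤ m) =
      ∏ i, PowerSeries.mk (fun m => (MvPolynomial.X i : MvPolynomial (Fin n) ℤ) ^ m) := by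
  ext m : 1
  rw [PowerSeries.coeff_prod, PowerSeries.coeff_mk, hsymm_eq_sum_finsuppAntidiag]
  simp

/-- The generating series of the `h_m` is `∏ 1 / (1 - x_i T)`, so all factors except the one for `k`
cancel. -/
theorem omitProd_mul_mk_hsymm (n : ℕ) (k : Fin n) :
    (omitProd n k : PowerSeries (MvPolynomial (Fin n) ℤ)) *
      PowerSeries.mk (fun m => MvPolynomial.hsymm (Fin n) ℤ m) =
        PowerSeries.mk (fun m => (MvPolynomial.X k : MvPolynomial (Fin n) ℤ) ^ m) := by
  have h : (omitProd n k : PowerSeries (MvPolynomial (Fin n) ℤ)) =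
      ∏ i ∈ univ.erase k, (1 - PowerSeries.C (MvPolynomial.X i) * PowerSeries.X) := by
    unfold omitProd
    rw [← Polynomial.coeToPowerSeries.ringHom_apply, map_prod]
    simp
  rw [h, mk_hsymm_eq_prod, ← Finset.mul_prod_erase univ _ (mem_univ k), mul_left_comm,
    ← Finset.prod_mul_distrib, Finset.prod_congr rfl fun i _ => one_sub_mul_mk_pow _,
    Finset.prod_const_one, mul_one]

/-- Comparison of the coefficients of `T^N`. The range has length `n` for every `N`: the degree
bound kills the coefficients from `n` on, and `completeSymm` is zero at negative indices. -/
theorem sum_coeff_omitProd_mul_completeSymm (n : ℕ) (k : Fin n) (N : ℕ) :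
    ∑ a ∈ range n, (omitProd n k).coeff a * completeSymm n ((N : ℤ) - a) =
      MvPolynomial.X k ^ N := by
  have h := congrArg (PowerSeries.coeff N) (omitProd_mul_mk_hsymm n k)
  rw [PowerSeries.coeff_mul, PowerSeries.coeff_mk,
    Finset.Nat.sum_antidiagonal_eq_sum_range_succ_mk] at h
  rw [← h]
  have h1 : ∀ a ∈ range (N + 1), (omitProd n k).coeff a * completeSymm n ((N : ℤ) - a) =
      PowerSeries.coeff a (omitProd n k : PowerSeries (MvPolynomial (Fin n) ℤ)) *
      PowerSeries.coeff (N - a) (PowerSeries.mk fun m => MvPolynomial.hsymm (Fin n) ℤ m) := by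
    intro a ha
    have : a ≤ N := by simpa [Nat.lt_succ_iff] using ha
    rw [Polynomial.coeff_coe, PowerSeries.coeff_mk, completeSymm, if_pos (by omega)]
    congr 2
    omega
  rw [← Finset.sum_congr rfl h1]
  have h2 : ∀ M, n ≤ M → ∑ a ∈ range n, (omitProd n k).coeff a * completeSymm n ((N : ℤ) - a) =
      ∑ a ∈ range M, (omitProd n k).coeff a * completeSymm n ((N : ℤ) - a) := by
    intro M hM
    refine Finset.sum_subset (by simpa using hM) fun a _ ha => ?_
    rw [Polynomial.coeff_eq_zero_of_natDegree_lt, zero_mul]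
    have := omitProd_natDegree_lt n k
    simp at ha
    omega
  have h3 : ∀ M, N + 1 ≤ M →
      ∑ a ∈ range (N + 1), (omitProd n k).coeff a * completeSymm n ((N : ℤ) - a) =
      ∑ a ∈ range M, (omitProd n k).coeff a * completeSymm n ((N : ℤ) - a) := by
    intro M hM
    refine Finset.sum_subset (by simpa using hM) fun a _ ha => ?_
    simp at ha
    rw [completeSymm, if_neg (by omega), mul_zero]
  rw [h2 (n + N + 1) (by omega), h3 (n + N + 1) (by omega)]

/-- The alternant `det (x_j ^ γ_i)`. -/
noncomputable def alternant {n : ℕ} (γ : Fin n → ℕ) : MvPolynomial (Fin n) ℤ :=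
  (Matrix.of fun i j : Fin n => (MvPolynomial.X j : MvPolynomial (Fin n) ℤ) ^ γ i).det

/-- The exponent `a + δ`, where `δ = (n - 1, …, 1, 0)`. -/
def shift {n : ℕ} (a : Fin n → ℤ) (i : Fin n) : ℕ := (a i + (n - 1 - (i : ℕ))).toNat

theorem schur_zero (n : ℕ) : schur n 0 = 1 := by
  unfold schur
  rw [Matrix.det_of_isUpperTriangular]
  · simp [completeSymm]
  · intro i j h
    have h' : (j : ℕ) < i := h
    simp only [Matrix.of_apply, Pi.zero_apply]
    rw [completeSymm, if_neg (by omega)]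

/-- Row `i` of the matrix of the `h`'s times column `k` of the coefficient matrix is the sum of the
previous lemma, equal to `x_k` to the power `a_i + n - 1 - i`. The second determinant does not
involve `a`, so the case `a = 0` identifies it with the Vandermonde alternant. -/
theorem schur_mul_det_omitProd {n : ℕ} (a : Fin n → ℤ) (ha : ∀ i, 0 ≤ a i) :
    schur n a * (Matrix.of fun j k : Fin n => (omitProd n k).coeff (n - 1 - j)).det =
      alternant (shift a) := by
  unfold schur alternant
  rw [← Matrix.det_mul]
  congr 1
  ext1 i k
  rw [Matrix.mul_apply, Matrix.of_apply, ← sum_coeff_omitProd_mul_completeSymm,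
    ← Finset.sum_range_reflect,
    ← Fin.sum_univ_eq_sum_range (fun j => (omitProd n k).coeff (n - 1 - j) *
      completeSymm n ((shift a i : ℕ) - ((n - 1 - j : ℕ) : ℤ)))]
  refine Finset.sum_congr rfl fun j _ => ?_
  rw [mul_comm, Matrix.of_apply, Matrix.of_apply]
  congr 2
  have := ha i
  have := i.2
  have := j.2
  unfold shift
  omega

/-- The bialternant formula. -/
theorem schur_mul_alternant {n : ℕ} (a : Fin n → ℤ) (ha : ∀ i, 0 ≤ a i) :
    schur n a * alternant (shift (0 : Fin n → ℤ)) = alternant (shift a) := by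
  rw [← schur_mul_det_omitProd a ha, ← schur_mul_det_omitProd (0 : Fin n → ℤ) (by simp),
    schur_zero, one_mul]

theorem schur_eq_sum_perm (n : ℕ) (a : Fin n → ℤ) : schur n a =
    ∑ σ : Equiv.Perm (Fin n), (Equiv.Perm.sign σ : ℤ) •
      ∏ i, completeSymm n (a i - (i : ℕ) + (σ i : ℕ)) := by
  unfold schur
  rw [← Matrix.det_transpose, Matrix.det_apply]
  rfl

theorem alternant_eq_sum_perm {n : ℕ} (γ : Fin n → ℕ) : alternant γ =
    ∑ σ : Equiv.Perm (Fin n), (Equiv.Perm.sign σ : ℤ) •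
      MvPolynomial.monomial (Finsupp.equivFunOnFinite.symm fun i => γ (σ⁻¹ i)) 1 := by
  unfold alternant
  rw [← Matrix.det_transpose, Matrix.det_apply]
  refine Finset.sum_congr rfl fun σ _ => congrArg _ ?_
  rw [MvPolynomial.monomial_eq, map_one, one_mul, Finsupp.prod_fintype _ _ (by simp),
    ← Equiv.prod_comp σ (fun i => MvPolynomial.X i ^
      (Finsupp.equivFunOnFinite.symm fun i => γ (σ⁻¹ i)) i)]
  simp

/-- A permutation carrying one strictly decreasing sequence to another preserves the order, hence is
the identity. So only one term of the alternant can meet the given monomial. -/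
theorem coeff_alternant {n : ℕ} {γ γ' : Fin n → ℕ} (h : StrictAnti γ) (h' : StrictAnti γ') :
    (alternant γ).coeff (Finsupp.equivFunOnFinite.symm γ') = if γ = γ' then 1 else 0 := by
  classical
  rw [alternant_eq_sum_perm, MvPolynomial.coeff_sum, Finset.sum_eq_single 1]
  · simp [MvPolynomial.coeff_monomial]
  · intro σ _ hσ
    rw [MvPolynomial.coeff_smul, MvPolynomial.coeff_monomial, if_neg, smul_zero]
    intro he
    have he' : (fun i => γ (σ⁻¹ i)) = γ' := Finsupp.equivFunOnFinite.symm.injective he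
    apply hσ
    have hm : StrictMono (σ⁻¹ : Equiv.Perm (Fin n)) := by
      intro i j hij
      have := h' hij
      rw [← he'] at this
      exact h.lt_iff_gt.1 this
    have := (StrictMono.range_inj hm strictMono_id).1 (by simp)
    rw [← inv_eq_one]
    exact Equiv.ext fun i => congrFun this i
  · simp

theorem shift_strictAnti {n : ℕ} (a : BoundedPartition n) : StrictAnti (shift a.1) := by
  intro i j hij
  have h1 := a.2.1 hij.le
  have h2 := a.2.2 i
  have h3 := a.2.2 j
  have h4 : (i : ℕ) < j := hij
  have := j.2
  unfold shift
  omega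

theorem shift_injective {n : ℕ} {a b : BoundedPartition n} (h : shift a.1 = shift b.1) : a = b := by
  refine Subtype.ext (funext fun i => ?_)
  have h0 := congrFun h i
  have h2 := a.2.2 i
  have h3 := b.2.2 i
  have := i.2
  unfold shift at h0
  omega

/-- The empty partition. -/
def BoundedPartition.zero (n : ℕ) : BoundedPartition n := ⟨0, fun _ _ _ => le_rfl, fun _ => le_rfl⟩

theorem alternant_ne_zero {n : ℕ} (a : BoundedPartition n) : alternant (shift a.1) ≠ 0 := by
  intro h
  have := coeff_alternant (shift_strictAnti a) (shift_strictAnti a)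
  simp [h] at this

/-- As `p` is invariant under permuting the variables, multiplication by `p` commutes with
antisymmetrization: it suffices to expand `x^γ p` into monomials and antisymmetrize each. -/
theorem alternant_mul_of_isSymmetric {n : ℕ} (γ : Fin n → ℕ) {p : MvPolynomial (Fin n) ℤ}
    (hp : p.IsSymmetric) :
    alternant γ * p = ∑ d ∈ p.support, p.coeff d • alternant (fun i => γ i + d i) := by
  have h1 : ∀ (σ : Equiv.Perm (Fin n)) (γ : Fin n → ℕ),
      MvPolynomial.monomial (Finsupp.equivFunOnFinite.symm fun i => γ (σ⁻¹ i)) (1 : ℤ) =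
        MvPolynomial.rename σ (MvPolynomial.monomial (Finsupp.equivFunOnFinite.symm γ) 1) := by
    intro σ γ
    rw [MvPolynomial.rename_monomial]
    refine congrArg (fun d => MvPolynomial.monomial d (1 : ℤ)) ?_
    ext i
    rw [show i = σ (σ⁻¹ i) by simp, Finsupp.mapDomain_apply σ.injective]
    simp
  have h2 : MvPolynomial.monomial (Finsupp.equivFunOnFinite.symm γ) 1 * p =
      ∑ d ∈ p.support, p.coeff d •
        MvPolynomial.monomial (Finsupp.equivFunOnFinite.symm fun i => γ i + d i) 1 := by
    conv_lhs => rw [p.as_sum, Finset.mul_sum]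
    refine Finset.sum_congr rfl fun d _ => ?_
    rw [MvPolynomial.monomial_mul, MvPolynomial.smul_monomial, one_mul, smul_eq_mul, mul_one]
    refine congrArg (fun e => MvPolynomial.monomial e (p.coeff d)) ?_
    ext i
    simp
  have h3 : ∀ σ : Equiv.Perm (Fin n),
      MvPolynomial.monomial (Finsupp.equivFunOnFinite.symm fun i => γ (σ⁻¹ i)) 1 * p =
      ∑ d ∈ p.support, p.coeff d • MvPolynomial.monomial
        (Finsupp.equivFunOnFinite.symm fun i => γ (σ⁻¹ i) + d (σ⁻¹ i)) 1 := by
    intro σ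
    conv_lhs => rw [h1, ← hp σ, ← map_mul, h2, map_sum]
    refine Finset.sum_congr rfl fun d _ => ?_
    rw [map_zsmul, h1 σ fun i => γ i + d i]
  simp only [alternant_eq_sum_perm, Finset.sum_mul, smul_mul_assoc, h3, Finset.smul_sum]
  rw [Finset.sum_comm]
  exact Finset.sum_congr rfl fun d _ => Finset.sum_congr rfl fun σ _ => smul_comm _ _ _

/-- Sorting the exponents permutes the rows and costs a sign; a repeated exponent gives two equal
rows and the value zero. -/
theorem exists_alternant_eq_zsmul {n : ℕ} (γ : Fin n → ℕ) :
    ∃ (z : ℤ) (a : BoundedPartition n), alternant γ = z • alternant (shift a.1) := by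
  by_cases hγ : Function.Injective γ
  · let τ : Equiv.Perm (Fin n) := Fin.revPerm.trans (Tuple.sort γ)
    have hanti : StrictAnti (γ ∘ τ) := by
      have h1 : Antitone (γ ∘ τ) := fun i j hij => Tuple.monotone_sort γ (Fin.rev_le_rev.2 hij)
      exact h1.strictAnti_of_injective (hγ.comp τ.injective)
    -- A strictly decreasing sequence of integers drops by at least one at each step. Hence
    -- subtracting `(n - 1, …, 0)` leaves a weakly decreasing sequence, nonnegative because its last
    -- term is.
    have hgap : ∀ (k : ℕ) (i : Fin n) (h : (i : ℕ) + k < n),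
        (γ ∘ τ) ⟨i + k, h⟩ + k ≤ (γ ∘ τ) i := by
      intro k
      induction k with
      | zero => intro i h; exact le_rfl
      | succ k ih =>
        intro i h
        have h1 := ih i (by omega)
        have h2 : (γ ∘ τ) ⟨i + (k + 1), h⟩ < (γ ∘ τ) ⟨i + k, by omega⟩ :=
          hanti (by rw [Fin.lt_def]; simp)
        omega
    have hnn : ∀ i : Fin n, n - 1 - (i : ℕ) ≤ (γ ∘ τ) i := by
      intro i
      have := hgap (n - 1 - i) i (by have := i.2; omega)
      omega
    refine ⟨Equiv.Perm.sign τ, ⟨fun i => ((γ ∘ τ) i : ℤ) - (n - 1 - (i : ℕ)), ?_, ?_⟩, ?_⟩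
    · intro i j hij
      have h1 := hgap (j - i) i (by have := Fin.le_def.1 hij; have := j.2; omega)
      have h2 : (⟨(i : ℕ) + (j - i), by have := Fin.le_def.1 hij; have := j.2; omega⟩ : Fin n) = j := by
        have := Fin.le_def.1 hij
        ext; simp; omega
      rw [h2] at h1
      have := Fin.le_def.1 hij
      simp only
      omega
    · intro i
      have := hnn i
      have := i.2
      simp only
      omega
    · have hs : shift (fun i => ((γ ∘ τ) i : ℤ) - (n - 1 - (i : ℕ))) = γ ∘ τ := by
        funext i
        simp [shift]
      rw [hs]
      have h1 : alternant (γ ∘ τ) = (Equiv.Perm.sign τ : ℤ) * alternant γ := by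
        unfold alternant
        have := Matrix.det_permute τ (Matrix.of fun i j : Fin n =>
          (MvPolynomial.X j : MvPolynomial (Fin n) ℤ) ^ γ i)
        exact_mod_cast this
      rw [h1, zsmul_eq_mul, ← mul_assoc, ← Int.cast_mul]
      simp [← Units.val_mul]
  · refine ⟨0, BoundedPartition.zero n, ?_⟩
    rw [zero_smul]
    unfold Function.Injective at hγ
    push Not at hγ
    obtain ⟨i, j, hij, hne⟩ := hγ
    exact Matrix.det_zero_of_row_eq hne (by ext1 k; simp [hij])

theorem completeSymm_isSymmetric (n : ℕ) (k : ℤ) : (completeSymm n k).IsSymmetric := by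
  unfold completeSymm
  split_ifs
  · exact MvPolynomial.hsymm_isSymmetric _ _ _
  · exact MvPolynomial.IsSymmetric.zero

theorem schur_isSymmetric (n : ℕ) (a : Fin n → ℤ) : (schur n a).IsSymmetric := by
  intro σ
  unfold schur
  rw [AlgHom.map_det]
  congr 1
  ext1 i j
  exact completeSymm_isSymmetric n _ σ

/-- The product of `p` with the Vandermonde alternant is an integral combination of alternants; by
the bialternant formula the Vandermonde factor cancels from every term. -/
theorem exists_schur_expansion {n : ℕ} {p : MvPolynomial (Fin n) ℤ} (hp : p.IsSymmetric) :
    ∃ c : BoundedPartition n →₀ ℤ, p = c.sum fun lam m => m • schur n lam.1 := by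
  have h1 : alternant (shift (0 : Fin n → ℤ)) * p ∈ Submodule.span ℤ
      (Set.range fun a : BoundedPartition n => alternant (shift a.1)) := by
    rw [alternant_mul_of_isSymmetric _ hp]
    refine Submodule.sum_mem _ fun d _ => Submodule.smul_mem _ _ ?_
    obtain ⟨z, a, h⟩ := exists_alternant_eq_zsmul fun i => shift (0 : Fin n → ℤ) i + d i
    rw [h]
    exact Submodule.smul_mem _ _ (Submodule.subset_span ⟨a, rfl⟩)
  obtain ⟨c, hc⟩ := Finsupp.mem_span_range_iff_exists_finsupp.1 h1
  refine ⟨c, mul_left_cancel₀ (alternant_ne_zero (BoundedPartition.zero n)) (hc.symm.trans ?_)⟩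
  rw [Finsupp.sum, Finsupp.sum, Finset.mul_sum]
  refine Finset.sum_congr rfl fun a _ => ?_
  rw [mul_smul_comm, ← schur_mul_alternant a.1 a.2.2, mul_comm]
  rfl

/-- The coefficient of `s_a` in the Schur expansion of a symmetric polynomial. -/
noncomputable def schurCoeff {n : ℕ} (a : BoundedPartition n) (p : MvPolynomial (Fin n) ℤ) : ℤ :=
  (p * alternant (shift (0 : Fin n → ℤ))).coeff (Finsupp.equivFunOnFinite.symm (shift a.1))

theorem schurCoeff_schur {n : ℕ} (a b : BoundedPartition n) :
    schurCoeff a (schur n b.1) = if b = a then 1 else 0 := by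
  rw [schurCoeff, schur_mul_alternant _ b.2.2, coeff_alternant (shift_strictAnti b)
    (shift_strictAnti a)]
  congr 1
  exact propext ⟨shift_injective, fun h => h ▸ rfl⟩

theorem schurCoeff_sum {n : ℕ} (a : BoundedPartition n) (c : BoundedPartition n →₀ ℤ) :
    schurCoeff a (c.sum fun lam m => m • schur n lam.1) = c a := by
  have h : schurCoeff a (c.sum fun lam m => m • schur n lam.1) =
      c.sum fun lam m => m * schurCoeff a (schur n lam.1) := by
    simp only [schurCoeff, Finsupp.sum, Finset.sum_mul, MvPolynomial.coeff_sum, smul_mul_assoc,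
      MvPolynomial.coeff_smul, smul_eq_mul]
  rw [h]
  simp only [schurCoeff_schur]
  simp +contextual [Finsupp.sum, eq_comm]

theorem lrCoeff_spec (n : ℕ) (mu nu : BoundedPartition n) :
    schur n mu.1 * schur n nu.1 = (lrCoeff n mu nu).sum fun lam m => m • schur n lam.1 := by
  have h := exists_schur_expansion ((schur_isSymmetric n mu.1).mul (schur_isSymmetric n nu.1))
  unfold lrCoeff
  rw [dif_pos h]
  exact h.choose_spec

/-- `schurCoeff` is dual to the Schur polynomials, so Schur expansions are unique and the choice
made in `lrCoeff` does not matter. -/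
theorem lrCoeff_eq_schurCoeff (n : ℕ) (mu nu lam : BoundedPartition n) :
    lrCoeff n mu nu lam = schurCoeff lam (schur n mu.1 * schur n nu.1) := by
  rw [lrCoeff_spec, schurCoeff_sum]

/-- The coefficient is that of `x^{λ+δ}` in `s_μ` times the alternant of `ν + δ`. The exponents of
that product dominate permutations of `ν + δ`, which bounds every `ν_i` in terms of `λ`. -/
theorem lrCoeff_finite (n : ℕ) (mu lam : BoundedPartition n) :
    {nu : BoundedPartition n | lrCoeff n mu nu lam ≠ 0}.Finite := by
  have hbound : ∀ nu : BoundedPartition n, lrCoeff n mu nu lam ≠ 0 →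
      ∀ i, nu.1 i ≤ ∑ j, (shift lam.1 j : ℤ) := by
    intro nu h i
    rw [lrCoeff_eq_schurCoeff, schurCoeff, mul_assoc, schur_mul_alternant _ nu.2.2, mul_comm,
      alternant_mul_of_isSymmetric _ (schur_isSymmetric n mu.1), MvPolynomial.coeff_sum] at h
    obtain ⟨d, _, hd⟩ := Finset.exists_ne_zero_of_sum_ne_zero h
    rw [MvPolynomial.coeff_smul, alternant_eq_sum_perm, MvPolynomial.coeff_sum] at hd
    obtain ⟨σ, _, hσ⟩ := Finset.exists_ne_zero_of_sum_ne_zero (right_ne_zero_of_smul hd)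
    classical
    rw [MvPolynomial.coeff_smul, MvPolynomial.coeff_monomial] at hσ
    have he := (Finsupp.equivFunOnFinite.symm.injective
      (of_not_not fun h => hσ (by rw [if_neg h, smul_zero])))
    have h1 := congrFun he (σ i)
    rw [show σ⁻¹ (σ i) = i from σ.symm_apply_apply i] at h1
    have h2 : shift lam.1 (σ i) ≤ ∑ j, shift lam.1 j :=
      Finset.single_le_sum (f := shift lam.1) (fun _ _ => Nat.zero_le _) (Finset.mem_univ _)
    have h3 : nu.1 i ≤ shift nu.1 i := by
      have := i.2
      unfold shift
      omega
    rw [← Nat.cast_sum]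
    omega
  refine Set.Finite.of_finite_image (f := Subtype.val) ?_ Subtype.val_injective.injOn
  refine (Set.Finite.pi' fun _ : Fin n =>
    Set.finite_Icc (0 : ℤ) (∑ j, (shift lam.1 j : ℤ))).subset ?_
  rintro _ ⟨nu, hnu, rfl⟩ i
  exact ⟨nu.2.2 i, hbound nu hnu i⟩

/-- The coefficient of a monomial with integer exponents (zero if an exponent is negative). -/
noncomputable def coeffZ {n : ℕ} {R : Type*} [CommRing R] (a : Fin n → ℤ)
    (p : MvPolynomial (Fin n) R) : R :=
  if ∀ i, 0 ≤ a i then p.coeff (Finsupp.equivFunOnFinite.symm fun i => (a i).toNat) else 0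

/-- Expanding the Vandermonde alternant shifts the exponent `a + δ` by permutations of `δ`, and
`(a_i + n - 1 - i) - (n - 1 - σ(i)) = a_i - i + σ(i)`. These are the indices in the determinant for
`s_a`, which is what links Schur coefficients to the representations `rowRep`. -/
theorem schurCoeff_eq_sum_perm {n : ℕ} (a : BoundedPartition n) (p : MvPolynomial (Fin n) ℤ) :
    schurCoeff a p = ∑ σ : Equiv.Perm (Fin n), (Equiv.Perm.sign σ : ℤ) *
      coeffZ (fun i => a.1 i - (i : ℕ) + (σ i : ℕ)) p := by
  rw [schurCoeff, alternant_eq_sum_perm, Finset.mul_sum, MvPolynomial.coeff_sum,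
    ← Equiv.sum_comp (Equiv.inv _)]
  refine Finset.sum_congr rfl fun σ _ => ?_
  rw [Equiv.inv_apply, mul_smul_comm, MvPolynomial.coeff_smul, smul_eq_mul, Equiv.Perm.sign_inv,
    MvPolynomial.coeff_mul_monomial', mul_one, inv_inv]
  congr 1
  unfold coeffZ
  -- Divisibility by the monomial of the Vandermonde term is nonnegativity of the shifted exponent,
  -- so the vanishing convention in `coeffZ` is the right one.
  have h1 : (Finsupp.equivFunOnFinite.symm (fun i => shift (0 : Fin n → ℤ) (σ i)) ≤
      Finsupp.equivFunOnFinite.symm (shift a.1)) ↔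
      ∀ i, 0 ≤ a.1 i - ((i : ℕ) : ℤ) + ((σ i : ℕ) : ℤ) := by
    rw [Finsupp.le_def]
    refine forall_congr' fun i => ?_
    have := i.2
    have := (σ i).2
    have := a.2.2 i
    simp only [Finsupp.equivFunOnFinite_symm_apply_apply, shift, Pi.zero_apply]
    omega
  simp only [h1]
  refine if_congr Iff.rfl (congrArg (fun d => p.coeff d) ?_) rfl
  ext i
  have := i.2
  have := (σ i).2
  have := a.2.2 i
  simp only [Finsupp.equivFunOnFinite_symm_apply_apply, shift, Pi.zero_apply, Finsupp.coe_tsub,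
    Pi.sub_apply]
  omega

end SymmetricFunctions

/-! ### Removing variables: stability of the Littlewood-Richardson coefficients. -/

section Restriction

open Finset

/-- Setting the last variable equal to zero. -/
noncomputable def killLast (n : ℕ) : MvPolynomial (Fin (n + 1)) ℤ →ₐ[ℤ] MvPolynomial (Fin n) ℤ :=
  MvPolynomial.aeval fun j => Fin.lastCases (motive := fun _ => MvPolynomial (Fin n) ℤ) 0
    MvPolynomial.X j

theorem killLast_X_castSucc {n : ℕ} (j : Fin n) :
    killLast n (MvPolynomial.X j.castSucc) = MvPolynomial.X j := by
  simp [killLast]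

theorem killLast_X_last (n : ℕ) : killLast n (MvPolynomial.X (Fin.last n)) = 0 := by
  simp [killLast]

theorem killLast_alternant {n : ℕ} (γ : Fin (n + 1) → ℕ) : killLast n (alternant γ) =
    (Matrix.of fun i j : Fin (n + 1) => killLast n (MvPolynomial.X j) ^ γ i).det := by
  unfold alternant
  rw [AlgHom.map_det]
  congr 1
  ext1 i j
  simp

theorem killLast_alternant_of_pos {n : ℕ} {γ : Fin (n + 1) → ℕ} (h : ∀ i, γ i ≠ 0) :
    killLast n (alternant γ) = 0 := by
  rw [killLast_alternant]
  refine Matrix.det_eq_zero_of_column_eq_zero (Fin.last n) fun i => ?_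
  rw [Matrix.of_apply, killLast_X_last, zero_pow (h i)]

/-- The last column becomes a unit vector, supported in the row with exponent zero. Laplace
expansion leaves a smaller alternant with one factor `x_j` to be taken out of each column. -/
theorem killLast_alternant_of_last {n : ℕ} {γ : Fin (n + 1) → ℕ} {γ' : Fin n → ℕ}
    (h0 : γ (Fin.last n) = 0) (h : ∀ i : Fin n, γ i.castSucc = γ' i + 1) :
    killLast n (alternant γ) = (∏ j, MvPolynomial.X j) * alternant γ' := by
  rw [killLast_alternant, Matrix.det_succ_column _ (Fin.last n), Fin.sum_univ_castSucc,
    Finset.sum_eq_zero, zero_add]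
  · rw [Matrix.of_apply, killLast_X_last, h0, pow_zero, mul_one, ← two_mul, pow_mul, neg_one_sq,
      one_pow, one_mul, alternant, ← Matrix.det_mul_row]
    congr 1
    ext1 i j
    simp [killLast_X_castSucc, h, pow_succ']
  · intro i _
    rw [Matrix.of_apply, killLast_X_last, h, zero_pow (Nat.succ_ne_zero _), mul_zero, zero_mul]

theorem shift_zero_last (n : ℕ) : shift (0 : Fin (n + 1) → ℤ) (Fin.last n) = 0 := by
  simp [shift]

theorem shift_zero_castSucc {n : ℕ} (i : Fin n) :
    shift (0 : Fin (n + 1) → ℤ) i.castSucc = shift (0 : Fin n → ℤ) i + 1 := by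
  have := i.2
  simp only [shift, Pi.zero_apply, Fin.val_castSucc]
  omega

theorem killLast_denominator (n : ℕ) : killLast n (alternant (shift (0 : Fin (n + 1) → ℤ))) =
    (∏ j, MvPolynomial.X j) * alternant (shift (0 : Fin n → ℤ)) :=
  killLast_alternant_of_last (shift_zero_last n) shift_zero_castSucc

theorem killLast_denominator_ne_zero (n : ℕ) :
    killLast n (alternant (shift (0 : Fin (n + 1) → ℤ))) ≠ 0 := by
  rw [killLast_denominator]
  exact mul_ne_zero (Finset.prod_ne_zero_iff.2 fun j _ => MvPolynomial.X_ne_zero j)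
    (alternant_ne_zero (BoundedPartition.zero n))

theorem pad_castSucc {n : ℕ} (a : Fin n → ℤ) (i : Fin n) : pad (n + 1) a i.castSucc = a i := by
  simp [pad]

theorem pad_last {n : ℕ} (a : Fin n → ℤ) : pad (n + 1) a (Fin.last n) = 0 := by
  simp [pad]

/-- Numerator and denominator of the bialternant quotient both acquire the factor `∏ x_j`, which
cancels. -/
theorem killLast_schur_pad {n : ℕ} (a : BoundedPartition n) :
    killLast n (schur (n + 1) (a.pad (n + 1)).1) = schur n a.1 := by
  refine mul_right_cancel₀ (killLast_denominator_ne_zero n) ?_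
  rw [← map_mul, schur_mul_alternant _ (a.pad (n + 1)).2.2, killLast_denominator, mul_left_comm,
    schur_mul_alternant _ a.2.2]
  refine killLast_alternant_of_last ?_ fun i => ?_
  · change shift (pad (n + 1) a.1) _ = 0
    simp [shift, pad_last]
  · change shift (pad (n + 1) a.1) _ = _
    have := i.2
    have := a.2.2 i
    simp only [shift, pad_castSucc, Fin.val_castSucc]
    omega

/-- All exponents in the numerator are positive, so it vanishes, while the denominator restricts to
a nonzero polynomial. -/
theorem killLast_schur_of_pos {n : ℕ} (a : BoundedPartition (n + 1)) (h : a.1 (Fin.last n) ≠ 0) :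
    killLast n (schur (n + 1) a.1) = 0 := by
  refine (mul_eq_zero.1 ?_).resolve_right (killLast_denominator_ne_zero n)
  rw [← map_mul, schur_mul_alternant _ a.2.2]
  refine killLast_alternant_of_pos fun i => ?_
  have := i.2
  have h1 := a.2.2 (Fin.last n)
  have h2 : a.1 (Fin.last n) ≤ a.1 i := a.2.1 (Fin.le_last i)
  unfold shift
  omega

theorem exists_eq_pad_succ {n : ℕ} (a : BoundedPartition (n + 1)) (h : a.1 (Fin.last n) = 0) :
    ∃ b : BoundedPartition n, b.pad (n + 1) = a := by
  refine ⟨⟨fun i => a.1 i.castSucc, fun i j hij => a.2.1 (by simpa using hij), fun i => a.2.2 _⟩, ?_⟩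
  refine Subtype.ext (funext fun i => ?_)
  change pad (n + 1) _ i = _
  induction i using Fin.lastCases with
  | last => rw [pad_last, h]
  | cast i => rw [pad_castSucc]

theorem BoundedPartition.pad_injective {r n : ℕ} (hrn : r ≤ n) :
    Function.Injective (BoundedPartition.pad n : BoundedPartition r → BoundedPartition n) := by
  intro a b h
  refine Subtype.ext (funext fun i => ?_)
  have h1 := congrFun (congrArg Subtype.val h) ⟨i, i.2.trans_le hrn⟩
  simpa [BoundedPartition.pad, SkewSchur.pad] using h1

/-- Coefficient extraction is compatible with setting the last variable equal to zero. -/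
theorem schurCoeff_killLast {n : ℕ} {p : MvPolynomial (Fin (n + 1)) ℤ} (hp : p.IsSymmetric)
    (a : BoundedPartition n) : schurCoeff a (killLast n p) = schurCoeff (a.pad (n + 1)) p := by
  obtain ⟨c, rfl⟩ := exists_schur_expansion hp
  have hinj := BoundedPartition.pad_injective (Nat.le_succ n)
  rw [schurCoeff_sum]
  -- Only Schur polynomials whose last part is zero survive the restriction. Their partitions are
  -- the padded ones, and `comapDomain` keeps exactly those coefficients.
  have h : killLast n (c.sum fun lam m => m • schur (n + 1) lam.1) =
      (c.comapDomain (BoundedPartition.pad (n + 1)) hinj.injOn).sum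
        fun lam m => m • schur n lam.1 := by
    rw [Finsupp.sum, Finsupp.sum, map_sum]
    symm
    refine Finset.sum_of_injOn (BoundedPartition.pad (n + 1)) hinj.injOn ?_ ?_ ?_
    · intro b hb
      simpa using hb
    · intro b _ hb'
      rw [map_zsmul]
      by_cases hl : b.1 (Fin.last n) = 0
      · obtain ⟨b', rfl⟩ := exists_eq_pad_succ b hl
        have : c (b'.pad (n + 1)) = 0 := by
          by_contra hne
          exact hb' ⟨b', by simpa using hne, rfl⟩
        rw [this, zero_smul]
      · rw [killLast_schur_of_pos b hl, smul_zero]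
    · intro b _
      rw [map_zsmul, killLast_schur_pad]
      rfl
  rw [h, schurCoeff_sum]
  rfl

theorem lrCoeff_pad_succ {n : ℕ} (mu nu lam : BoundedPartition n) :
    lrCoeff (n + 1) (mu.pad (n + 1)) (nu.pad (n + 1)) (lam.pad (n + 1)) =
      lrCoeff n mu nu lam := by
  rw [lrCoeff_eq_schurCoeff, lrCoeff_eq_schurCoeff, ← schurCoeff_killLast
    ((schur_isSymmetric _ _).mul (schur_isSymmetric _ _)), map_mul, killLast_schur_pad,
    killLast_schur_pad]

theorem lrCoeff_pad_succ_of_pos {n : ℕ} (mu lam : BoundedPartition n)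
    (nu : BoundedPartition (n + 1)) (h : nu.1 (Fin.last n) ≠ 0) :
    lrCoeff (n + 1) (mu.pad (n + 1)) nu (lam.pad (n + 1)) = 0 := by
  rw [lrCoeff_eq_schurCoeff, ← schurCoeff_killLast
    ((schur_isSymmetric _ _).mul (schur_isSymmetric _ _)), map_mul, killLast_schur_of_pos nu h,
    mul_zero]
  simp [schurCoeff]

theorem BoundedPartition.pad_self {r : ℕ} (a : BoundedPartition r) : a.pad r = a := by
  refine Subtype.ext (funext fun i => ?_)
  simp [BoundedPartition.pad, SkewSchur.pad]

theorem BoundedPartition.pad_pad_succ {r n : ℕ} (hrn : r ≤ n) (a : BoundedPartition r) :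
    (a.pad n).pad (n + 1) = a.pad (n + 1) := by
  refine Subtype.ext (funext fun i => ?_)
  simp only [BoundedPartition.pad, SkewSchur.pad]
  split_ifs <;> first | rfl | omega

theorem lrCoeff_pad {r n : ℕ} (hrn : r ≤ n) (mu nu lam : BoundedPartition r) :
    lrCoeff n (mu.pad n) (nu.pad n) (lam.pad n) = lrCoeff r mu nu lam := by
  induction n, hrn using Nat.le_induction with
  | base => simp only [BoundedPartition.pad_self]
  | succ n hn ih =>
    rw [← ih, ← lrCoeff_pad_succ (mu.pad n)]
    simp only [BoundedPartition.pad_pad_succ hn]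

/-- Variables are removed one at a time: as long as `λ` ends in a padded zero, a nonzero last part
of `ν` would make the coefficient vanish. -/
theorem exists_eq_pad_of_lrCoeff_ne_zero {r n : ℕ} (hrn : r ≤ n) (mu lam : BoundedPartition r)
    (nu : BoundedPartition n) (h : lrCoeff n (mu.pad n) nu (lam.pad n) ≠ 0) :
    ∃ nu' : BoundedPartition r, nu'.pad n = nu := by
  induction n, hrn using Nat.le_induction with
  | base => exact ⟨nu, nu.pad_self⟩
  | succ n hn ih =>
    rw [← BoundedPartition.pad_pad_succ hn, ← BoundedPartition.pad_pad_succ hn] at h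
    by_cases hl : nu.1 (Fin.last n) = 0
    · obtain ⟨nu, rfl⟩ := exists_eq_pad_succ nu hl
      rw [lrCoeff_pad_succ] at h
      obtain ⟨nu', rfl⟩ := ih nu h
      exact ⟨nu', (BoundedPartition.pad_pad_succ hn nu').symm⟩
    · exact absurd (lrCoeff_pad_succ_of_pos _ _ _ hl) h

theorem finsum_comp_of_support_subset_range {ι κ M : Type*} [AddCommMonoid M] {g : ι → κ}
    (hg : Function.Injective g) (f : κ → M) (h : ∀ k, f k ≠ 0 → k ∈ Set.range g) :
    ∑ᶠ i, f (g i) = ∑ᶠ k, f k := by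
  rw [← finsum_mem_range hg, ← finsum_mem_univ f]
  exact finsum_mem_inter_support_eq' f _ _ fun k hk => by simpa using h k hk

/-- Only padded `ν` contribute. The coefficients may then be computed in `r` variables, although the
Schur polynomials remain in `n` variables. -/
theorem skewSchur_pad {r n : ℕ} (hrn : r ≤ n) (lam mu : BoundedPartition r) :
    skewSchur n (lam.pad n) (mu.pad n) =
      ∑ᶠ nu : BoundedPartition r, lrCoeff r mu nu lam • schur n (pad n nu.1) := by
  unfold skewSchur
  rw [← finsum_comp_of_support_subset_range (BoundedPartition.pad_injective hrn)]
  · exact finsum_congr fun nu => by rw [lrCoeff_pad hrn]; rfl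
  · intro nu hnu
    exact exists_eq_pad_of_lrCoeff_ne_zero hrn mu lam nu (left_ne_zero_of_smul hnu)

end Restriction

/-! ### Dimensions of Hom spaces over a complex algebra; virtual modules of norm one. -/

section HomDimensions

universe u

/-- The dimension of the space of homomorphisms between modules over a complex algebra. -/
noncomputable def homDim (R : Type*) [Ring R] [Algebra ℂ R] (M N : Type*)
    [AddCommGroup M] [AddCommGroup N] [Module R M] [Module R N] [Module ℂ N]
    [IsScalarTower ℂ R N] : ℕ :=
  Module.finrank ℂ (M →ₗ[R] N)

variable {R : Type*} [Ring R] [Algebra ℂ R]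

section Congr

variable {M M' N N' : Type*} [AddCommGroup M] [AddCommGroup M'] [AddCommGroup N] [AddCommGroup N']
  [Module R M] [Module R M'] [Module R N] [Module R N'] [Module ℂ N] [Module ℂ N']
  [IsScalarTower ℂ R N] [IsScalarTower ℂ R N']

theorem homDim_congr_right (e : N ≃ₗ[R] N') : homDim R M N = homDim R M N' :=
  LinearEquiv.finrank_eq
    { toFun := fun f => e.toLinearMap ∘ₗ f
      invFun := fun f => e.symm.toLinearMap ∘ₗ f
      map_add' := fun f g => by ext x; simp
      map_smul' := fun c f => by
        ext x
        exact (e.toLinearMap.restrictScalars ℂ).map_smul c (f x)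
      left_inv := fun f => by ext x; simp
      right_inv := fun f => by ext x; simp }

theorem homDim_congr_left (e : M ≃ₗ[R] M') : homDim R M N = homDim R M' N :=
  LinearEquiv.finrank_eq
    { toFun := fun f => f ∘ₗ e.symm.toLinearMap
      invFun := fun f => f ∘ₗ e.toLinearMap
      map_add' := fun f g => by ext x; simp
      map_smul' := fun c f => by ext x; simp
      left_inv := fun f => by ext x; simp
      right_inv := fun f => by ext x; simp }

end Congr

-- Schur's lemma: a nonzero map between simple modules is an isomorphism, and the endomorphisms are
-- scalars because `ℂ` is algebraically closed.
open Classical in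
theorem homDim_simple {M N : Type*} [AddCommGroup M] [AddCommGroup N]
    [Module R M] [Module R N] [Module ℂ M] [Module ℂ N] [IsScalarTower ℂ R M] [IsScalarTower ℂ R N]
    [Module.Finite ℂ M] [IsSimpleModule R M] [IsSimpleModule R N] :
    homDim R M N = if Nonempty (M ≃ₗ[R] N) then 1 else 0 := by
  split_ifs with h
  · obtain ⟨e⟩ := h
    rw [← homDim_congr_right e]
    have h1 : Module.finrank ℂ (Module.End R M) = 1 := by
      rw [← LinearEquiv.finrank_eq (LinearEquiv.ofBijective (Algebra.linearMap ℂ (Module.End R M))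
        (IsSimpleModule.algebraMap_end_bijective_of_isAlgClosed ℂ))]
      exact CommSemiring.finrank_self ℂ
    exact h1
  · have h1 : ∀ f : M →ₗ[R] N, f = 0 := fun f =>
      (LinearMap.bijective_or_eq_zero f).resolve_left
        fun hf => h ⟨LinearEquiv.ofBijective f hf⟩
    have : Subsingleton (M →ₗ[R] N) := ⟨fun f g => (h1 f).trans (h1 g).symm⟩
    exact Module.finrank_zero_of_subsingleton

section Finite

variable {M N : Type*} [AddCommGroup M] [AddCommGroup N]
  [Module R M] [Module R N] [Module ℂ M] [Module ℂ N]
  [IsScalarTower ℂ R M] [IsScalarTower ℂ R N] [Module.Finite ℂ M] [Module.Finite ℂ N]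

theorem finite_linearMap : Module.Finite ℂ (M →ₗ[R] N) :=
  Module.Finite.of_injective
    ({ toFun := fun f => f.restrictScalars ℂ
       map_add' := fun _ _ => rfl
       map_smul' := fun _ _ => rfl } : (M →ₗ[R] N) →ₗ[ℂ] (M →ₗ[ℂ] N))
    fun _ _ h => LinearMap.ext fun x => LinearMap.congr_fun h x

theorem finite_submodule (S : Submodule R N) : Module.Finite ℂ S :=
  Module.Finite.of_injective (S.subtype.restrictScalars ℂ) S.injective_subtype

theorem exists_simple_decomposition [IsSemisimpleModule R N] :
    ∃ (n : ℕ) (S : Fin n → Submodule R N), (∀ i, IsSimpleModule R (S i)) ∧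
      Nonempty (N ≃ₗ[R] Π i, S i) := by
  have : Module.Finite R N := Module.Finite.of_restrictScalars_finite ℂ R N
  obtain ⟨n, S, e, h⟩ := IsSemisimpleModule.exists_linearEquiv_fin_dfinsupp R N
  exact ⟨n, S, h, ⟨e.trans DFinsupp.linearEquivFunOnFintype⟩⟩

theorem homDim_pi_right {ι : Type*} [Fintype ι] (S : ι → Submodule R N) :
    homDim R M (Π i, S i) = ∑ i, homDim R M (S i) := by
  have h1 : ∀ i, Module.Finite ℂ (S i) := fun i => finite_submodule (S i)
  have h2 : ∀ i, Module.Finite ℂ (M →ₗ[R] S i) := fun i => finite_linearMap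
  unfold homDim
  rw [← Module.finrank_pi_fintype]
  exact LinearEquiv.finrank_eq
    { toFun := fun f i => LinearMap.proj i ∘ₗ f
      invFun := fun f => LinearMap.pi f
      map_add' := fun f g => rfl
      map_smul' := fun c f => rfl
      left_inv := fun f => rfl
      right_inv := fun f => rfl }

theorem homDim_pi_left {ι : Type*} [Fintype ι] [DecidableEq ι] (S : ι → Submodule R N) :
    homDim R (Π i, S i) M = ∑ i, homDim R (S i) M := by
  have h1 : ∀ i, Module.Finite ℂ (S i) := fun i => finite_submodule (S i)
  have h2 : ∀ i, Module.Finite ℂ (S i →ₗ[R] M) := fun i => finite_linearMap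
  unfold homDim
  rw [← Module.finrank_pi_fintype]
  exact LinearEquiv.finrank_eq (LinearMap.lsum R (fun i => S i) ℂ).symm

theorem homDim_simple_comm [IsSimpleModule R M] [IsSimpleModule R N] :
    homDim R M N = homDim R N M := by
  classical
  rw [homDim_simple, homDim_simple]
  exact if_congr ⟨fun ⟨e⟩ => ⟨e.symm⟩, fun ⟨e⟩ => ⟨e.symm⟩⟩ rfl rfl

theorem homDim_simple_semisimple_comm [IsSimpleModule R M] [IsSemisimpleModule R N] :
    homDim R M N = homDim R N M := by
  obtain ⟨n, S, hS, ⟨e⟩⟩ := exists_simple_decomposition (R := R) (N := N)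
  have h1 : ∀ i, Module.Finite ℂ (S i) := fun i => finite_submodule (S i)
  rw [homDim_congr_right e, homDim_congr_left e, homDim_pi_right, homDim_pi_left]
  exact Finset.sum_congr rfl fun i _ => homDim_simple_comm

/-- Splitting both modules into simple ones reduces the symmetry to Schur's lemma. -/
theorem homDim_comm [IsSemisimpleModule R M] [IsSemisimpleModule R N] :
    homDim R M N = homDim R N M := by
  obtain ⟨n, S, hS, ⟨e⟩⟩ := exists_simple_decomposition (R := R) (N := N)
  have h1 : ∀ i, Module.Finite ℂ (S i) := fun i => finite_submodule (S i)
  rw [homDim_congr_right e, homDim_congr_left e, homDim_pi_right, homDim_pi_left]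
  exact Finset.sum_congr rfl fun i _ => homDim_simple_semisimple_comm.symm

end Finite

/-- A signed family of norm one is supported on one class. -/
theorem sum_eq_of_norm_one {J : Type*} [Fintype J] (s : Setoid J) [DecidableRel s.r]
    (ε : J → ℤ) (hε : ∑ j, ∑ k, ε j * ε k * (if s.r j k then 1 else 0) = 1) (j₀ : J)
    (h₀ : ∑ j, ε j * (if s.r j₀ j then 1 else 0) = 1) (g : J → ℤ) (hg : ∀ j k, s.r j k → g j = g k) :
    ∑ j, ε j * g j = g j₀ := by
  classical
  -- `P q` is the total sign of the class `q`. The norm is the sum of the squares of the `P q`, and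
  -- the class of `j₀` already contributes one, so all other classes have total sign zero.
  let P : Quotient s → ℤ := fun q => ∑ j, if (⟦j⟧ : Quotient s) = q then ε j else 0
  have hiff : ∀ j k, s.r j k ↔ (⟦k⟧ : Quotient s) = ⟦j⟧ := fun j k =>
    ⟨fun h => (Quotient.sound h).symm, fun h => Quotient.exact h.symm⟩
  have hP : ∀ j, P (Quotient.mk s j) = ∑ k, ε k * (if s.r j k then 1 else 0) := by
    intro j
    simp only [P, hiff, mul_ite, mul_one, mul_zero]
  have hsum : ∀ f : Quotient s → ℤ, ∑ j, ε j * f ⟦j⟧ = ∑ q, P q * f q := by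
    intro f
    simp only [P, Finset.sum_mul]
    rw [Finset.sum_comm]
    refine Finset.sum_congr rfl fun j _ => ?_
    simp
  have h1 : ∑ q, P q * P q = 1 := by
    rw [← hsum, ← hε]
    refine Finset.sum_congr rfl fun j _ => ?_
    rw [hP, Finset.mul_sum]
    exact Finset.sum_congr rfl fun k _ => by ring
  have h2 : P (Quotient.mk s j₀) = 1 := by rw [hP, h₀]
  have h3 : ∀ q, q ≠ Quotient.mk s j₀ → P q = 0 := by
    rw [← Finset.add_sum_erase _ _ (Finset.mem_univ (Quotient.mk s j₀)), h2] at h1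
    intro q hq
    have h4 : ∑ q ∈ Finset.univ.erase (Quotient.mk s j₀), P q * P q = 0 := by linarith
    have h5 := (Finset.sum_eq_zero_iff_of_nonneg fun q _ => mul_self_nonneg (P q)).1 h4 q
      (Finset.mem_erase.2 ⟨hq, Finset.mem_univ q⟩)
    exact mul_self_eq_zero.1 h5
  have h4 := hsum (Quotient.lift g hg)
  simp only [Quotient.lift_mk] at h4
  rw [h4, Finset.sum_eq_single (Quotient.mk s j₀), h2, one_mul, Quotient.lift_mk]
  · intro q _ hq
    rw [h3 q hq, zero_mul]
  · simp

/-- If a virtual semisimple module has norm one and contains a simple module once, then it has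
the same multiplicities as that simple module. -/
theorem sum_homDim_eq_of_norm_one {ι : Type*} [Fintype ι] (ε : ι → ℤ) {M : ι → Type u}
    [∀ i, AddCommGroup (M i)] [∀ i, Module R (M i)] [∀ i, Module ℂ (M i)]
    [∀ i, IsScalarTower ℂ R (M i)] [∀ i, Module.Finite ℂ (M i)] [∀ i, IsSemisimpleModule R (M i)]
    {P V : Type u} [AddCommGroup P] [Module R P] [Module ℂ P] [IsScalarTower ℂ R P]
    [Module.Finite ℂ P] [IsSimpleModule R P] [AddCommGroup V] [Module R V] [Module ℂ V]
    [IsScalarTower ℂ R V] [Module.Finite ℂ V]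
    (hnorm : ∑ i, ∑ j, ε i * ε j * homDim R (M i) (M j) = 1)
    (hP : ∑ i, ε i * homDim R P (M i) = 1) :
    ∑ i, ε i * homDim R V (M i) = homDim R V P := by
  classical
  choose n S hS e using fun i => exists_simple_decomposition (R := R) (N := M i)
  have hfin : ∀ i k, Module.Finite ℂ (S i k) := fun i k => finite_submodule (S i k)
  -- All simple constituents of all the modules are collected into one family, to be grouped by
  -- isomorphism class.
  let J := Σ i, Fin (n i)
  let s : Setoid J :=
    { r := fun j k => Nonempty (S j.1 j.2 ≃ₗ[R] S k.1 k.2)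
      iseqv := ⟨fun j => ⟨LinearEquiv.refl R _⟩, fun ⟨e⟩ => ⟨e.symm⟩,
        fun ⟨e⟩ ⟨e'⟩ => ⟨e.trans e'⟩⟩ }
  -- Only the second argument is decomposed, so that nothing like semisimplicity is asked of `W`,
  -- and hence of `V`.
  have hr : ∀ (W : Type u) [AddCommGroup W] [Module R W] [Module ℂ W] [IsScalarTower ℂ R W]
      [Module.Finite ℂ W], ∑ i, ε i * homDim R W (M i) =
        ∑ j : J, ε j.1 * homDim R W (S j.1 j.2) := by
    intro W _ _ _ _ _
    rw [Fintype.sum_sigma]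
    refine Finset.sum_congr rfl fun i _ => ?_
    rw [homDim_congr_right (e i).some, homDim_pi_right, Nat.cast_sum, Finset.mul_sum]
  have hl : ∀ (i : ι) (W : Type u) [AddCommGroup W] [Module R W] [Module ℂ W] [IsScalarTower ℂ R W]
      [Module.Finite ℂ W], homDim R (M i) W = ∑ k, homDim R (S i k) W := by
    intro i W _ _ _ _ _
    rw [homDim_congr_left (e i).some, homDim_pi_left]
  have hind : ∀ j k : J, homDim R (S j.1 j.2) (S k.1 k.2) = if s.r j k then 1 else 0 :=
    fun j k => homDim_simple
  rw [hr P] at hP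
  -- If no constituent were isomorphic to `P`, every term of `hP` would vanish by Schur's lemma.
  obtain ⟨j₀, e₀⟩ : ∃ j : J, Nonempty (P ≃ₗ[R] S j.1 j.2) := by
    obtain ⟨j, _, hj⟩ := Finset.exists_ne_zero_of_sum_ne_zero (hP.trans_ne one_ne_zero)
    refine ⟨j, of_not_not fun hne => hj ?_⟩
    rw [homDim_simple, if_neg hne, Nat.cast_zero, mul_zero]
  obtain ⟨e₀⟩ := e₀
  rw [hr V, homDim_congr_right e₀]
  refine sum_eq_of_norm_one s (fun j => ε j.1) ?_ j₀ ?_ (fun j => homDim R V (S j.1 j.2)) ?_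
  · refine Eq.trans ?_ hnorm
    rw [Fintype.sum_sigma]
    refine Finset.sum_congr rfl fun i _ => ?_
    have h1 : ∀ W : ι → ℤ, ∑ j, ε i * ε j * W j = ε i * ∑ j, ε j * W j := by
      intro W
      rw [Finset.mul_sum]
      exact Finset.sum_congr rfl fun j _ => mul_assoc _ _ _
    rw [h1, hr (M i), Finset.mul_sum, Finset.sum_comm]
    refine Finset.sum_congr rfl fun j _ => ?_
    rw [hl, Nat.cast_sum, Finset.mul_sum, Finset.mul_sum]
    refine Finset.sum_congr rfl fun k _ => ?_
    have h2 := hind ⟨i, k⟩ j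
    simp only at h2
    rw [h2, ← mul_assoc]
    push_cast
    rfl
  · refine Eq.trans ?_ hP
    refine Finset.sum_congr rfl fun j _ => ?_
    rw [homDim_congr_left e₀, hind]
    push_cast
    rfl
  · rintro j k ⟨e⟩
    exact congrArg _ (homDim_congr_right e)

end HomDimensions

/-! ### Translation of the Hom dimensions to representations of a group. -/

section RepresentationDimensions

open scoped MonoidAlgebra

variable {G : Type*} [Group G]

/-- The dimension of the space of intertwining maps. -/
noncomputable def repDim {V W : Type*} [AddCommGroup V] [Module ℂ V] [AddCommGroup W] [Module ℂ W]
    (ρ : Representation ℂ G V) (σ : Representation ℂ G W) : ℕ :=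
  Module.finrank ℂ (Representation.IntertwiningMap ρ σ)

theorem repDim_eq_homDim {V W : Type*} [AddCommGroup V] [Module ℂ V] [AddCommGroup W] [Module ℂ W]
    (ρ : Representation ℂ G V) (σ : Representation ℂ G W) :
    repDim ρ σ = homDim ℂ[G] ρ.asModule σ.asModule :=
  LinearEquiv.finrank_eq (Representation.IntertwiningMap.equivLinearMapAsModule ρ σ)

theorem repDim_comm {V W : Type*} [AddCommGroup V] [Module ℂ V] [AddCommGroup W] [Module ℂ W]
    [Module.Finite ℂ V] [Module.Finite ℂ W]
    (ρ : Representation ℂ G V) (σ : Representation ℂ G W)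
    (hρ : ρ.IsSemisimpleRepresentation) (hσ : σ.IsSemisimpleRepresentation) :
    repDim ρ σ = repDim σ ρ := by
  have h1 := (Representation.isSemisimpleRepresentation_iff_isSemisimpleModule_asModule ρ).1 hρ
  have h2 := (Representation.isSemisimpleRepresentation_iff_isSemisimpleModule_asModule σ).1 hσ
  rw [repDim_eq_homDim, repDim_eq_homDim]
  exact homDim_comm

theorem sum_repDim_eq_of_norm_one {ι : Type*} [Fintype ι] (ε : ι → ℤ) {M : ι → Type}
    [∀ i, AddCommGroup (M i)] [∀ i, Module ℂ (M i)] [∀ i, Module.Finite ℂ (M i)]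
    (ρ : ∀ i, Representation ℂ G (M i)) (hρ : ∀ i, (ρ i).IsSemisimpleRepresentation)
    {P V : Type} [AddCommGroup P] [Module ℂ P] [Module.Finite ℂ P]
    (σ : Representation ℂ G P) (hσ : σ.IsIrreducible)
    [AddCommGroup V] [Module ℂ V] [Module.Finite ℂ V] (τ : Representation ℂ G V)
    (hnorm : ∑ i, ∑ j, ε i * ε j * repDim (ρ i) (ρ j) = 1)
    (hP : ∑ i, ε i * repDim σ (ρ i) = 1) :
    ∑ i, ε i * repDim τ (ρ i) = repDim τ σ := by
  have h1 := fun i =>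
    (Representation.isSemisimpleRepresentation_iff_isSemisimpleModule_asModule (ρ i)).1 (hρ i)
  simp only [repDim_eq_homDim] at *
  exact sum_homDim_eq_of_norm_one ε (M := fun i => (ρ i).asModule) hnorm hP

end RepresentationDimensions

/-! ### Polynomials in the matrix entries, graded by row degrees. -/

section PolynomialFunctions

/-- Polynomials in the entries of an `r × r` matrix. -/
abbrev MatPoly (r : ℕ) : Type := MvPolynomial (Fin r × Fin r) ℂ

variable {r : ℕ}

/-- Evaluation of a polynomial at a matrix. -/
noncomputable def evalMat (x : Matrix (Fin r) (Fin r) ℂ) : MatPoly r →ₐ[ℂ] ℂ :=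
  MvPolynomial.aeval fun q => x q.1 q.2

theorem evalMat_X (x : Matrix (Fin r) (Fin r) ℂ) (q : Fin r × Fin r) :
    evalMat x (MvPolynomial.X q) = x q.1 q.2 := by
  simp [evalMat]

theorem evalMat_eq_sum (x : Matrix (Fin r) (Fin r) ℂ) (p : MatPoly r) :
    evalMat x p = ∑ d ∈ p.support, p.coeff d * ∏ q, x q.1 q.2 ^ d q := by
  rw [evalMat, MvPolynomial.aeval_def, MvPolynomial.eval₂_eq']
  rfl

theorem matPoly_ext_matrix {p q : MatPoly r} (h : ∀ x, evalMat x p = evalMat x q) : p = q := by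
  refine MvPolynomial.funext fun z => ?_
  have := h (Matrix.of fun i j => z (i, j))
  simpa [evalMat, MvPolynomial.aeval_eq_eval] using this

/-- Invertible matrices are dense: after multiplication by the determinant polynomial both sides
agree at every matrix, and that nonzero factor cancels. -/
theorem matPoly_ext {p q : MatPoly r} (h : ∀ g : GL (Fin r) ℂ, evalMat g.1 p = evalMat g.1 q) :
    p = q := by
  have hdet : ∀ x : Matrix (Fin r) (Fin r) ℂ,
      evalMat x (Matrix.mvPolynomialX (Fin r) (Fin r) ℂ).det = x.det := by
    intro x
    rw [AlgHom.map_det]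
    congr 1
    ext1 i j
    simp [evalMat]
  refine mul_right_cancel₀ (Matrix.det_mvPolynomialX_ne_zero (Fin r) ℂ) (matPoly_ext_matrix fun x => ?_)
  rw [map_mul, map_mul, hdet]
  by_cases hx : x.det = 0
  · rw [hx, mul_zero, mul_zero]
  · rw [show x = (Matrix.GeneralLinearGroup.mkOfDetNeZero x hx).1 from rfl, h]

/-- Right translation `p(x) ↦ p(x g)` of polynomials, for a matrix `g`. -/
noncomputable def polyTranslate (g : Matrix (Fin r) (Fin r) ℂ) : MatPoly r →ₐ[ℂ] MatPoly r :=
  MvPolynomial.aeval fun q => ∑ k, MvPolynomial.C (g k q.2) * MvPolynomial.X (q.1, k)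

theorem evalMat_polyTranslate (x g : Matrix (Fin r) (Fin r) ℂ) (p : MatPoly r) :
    evalMat x (polyTranslate g p) = evalMat (x * g) p := by
  have h : (evalMat x).comp (polyTranslate g) = evalMat (x * g) := by
    refine MvPolynomial.algHom_ext fun q => ?_
    simp only [polyTranslate, evalMat, AlgHom.comp_apply, MvPolynomial.aeval_X, map_sum, map_mul,
      MvPolynomial.aeval_C, Matrix.mul_apply]
    exact Finset.sum_congr rfl fun k _ => mul_comm _ _
  exact congrArg (fun f => f p) h

/-- The representation of `GL_r(ℂ)` on polynomials by right translation. -/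
noncomputable def polyRep (r : ℕ) : Representation ℂ (GL (Fin r) ℂ) (MatPoly r) where
  toFun g := (polyTranslate g.1).toLinearMap
  map_one' := LinearMap.ext fun p => matPoly_ext_matrix fun x => by
    simp [evalMat_polyTranslate]
  map_mul' g h := LinearMap.ext fun p => matPoly_ext_matrix fun x => by
    simp [evalMat_polyTranslate, Matrix.mul_assoc]

theorem evalMat_polyRep (x : Matrix (Fin r) (Fin r) ℂ) (g : GL (Fin r) ℂ) (p : MatPoly r) :
    evalMat x (polyRep r g p) = evalMat (x * g.1) p :=
  evalMat_polyTranslate x g.1 p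

/-- The invertible diagonal matrix with diagonal entries `t`. -/
noncomputable def diagGL (t : Fin r → ℂˣ) : GL (Fin r) ℂ where
  val := Matrix.diagonal fun i => (t i : ℂ)
  inv := Matrix.diagonal fun i => ((t i)⁻¹ : ℂˣ)
  val_inv := by simp
  inv_val := by simp

theorem diagGL_val (t : Fin r → ℂˣ) : (diagGL t).1 = Matrix.diagonal fun i => (t i : ℂ) := rfl

/-- The weight of the variable `x_ij` under left multiplication by diagonal matrices. -/
def rowWeight (r : ℕ) (q : Fin r × Fin r) : Fin r → ℤ := Pi.single q.1 1

/-- The weight of the variable `x_ij` under right multiplication by diagonal matrices. -/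
def colWeight (r : ℕ) (q : Fin r × Fin r) : Fin r → ℤ := Pi.single q.2 1

theorem weight_rowWeight_apply (d : Fin r × Fin r →₀ ℕ) (i : Fin r) :
    Finsupp.weight (rowWeight r) d i = ∑ j, (d (i, j) : ℤ) := by
  rw [Finsupp.weight_apply, Finsupp.sum_fintype _ _ (by simp), Finset.sum_apply,
    Fintype.sum_prod_type, Finset.sum_eq_single i]
  · simp [rowWeight]
  · intro k _ hk
    simp [rowWeight, hk.symm]
  · simp

theorem weight_colWeight_apply (d : Fin r × Fin r →₀ ℕ) (j : Fin r) :
    Finsupp.weight (colWeight r) d j = ∑ i, (d (i, j) : ℤ) := by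
  rw [Finsupp.weight_apply, Finsupp.sum_fintype _ _ (by simp), Finset.sum_apply,
    Fintype.sum_prod_type_right, Finset.sum_eq_single j]
  · simp [colWeight]
  · intro k _ hk
    simp [colWeight, hk.symm]
  · simp

/-- Rescaling the variables of a polynomial. -/
noncomputable def rescale {σ : Type*} (c : σ → ℂ) : MvPolynomial σ ℂ →ₐ[ℂ] MvPolynomial σ ℂ :=
  MvPolynomial.aeval fun i => MvPolynomial.C (c i) * MvPolynomial.X i

theorem coeff_rescale {σ : Type*} (c : σ → ℂ) (p : MvPolynomial σ ℂ) (d : σ →₀ ℕ) :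
    (rescale c p).coeff d = (d.prod fun i k => c i ^ k) * p.coeff d := by
  classical
  induction p using MvPolynomial.induction_on' with
  | monomial e a =>
    have h : rescale c (MvPolynomial.monomial e a) =
        MvPolynomial.monomial e ((e.prod fun i k => c i ^ k) * a) := by
      rw [rescale, MvPolynomial.aeval_monomial, mul_comm _ a, MvPolynomial.algebraMap_eq]
      simp only [mul_pow, Finsupp.prod_mul]
      rw [MvPolynomial.monomial_eq, map_mul, mul_assoc]
      simp [Finsupp.prod, map_prod]
    rw [h, MvPolynomial.coeff_monomial, MvPolynomial.coeff_monomial]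
    split_ifs with hde
    · rw [hde]
    · rw [mul_zero]
  | add p q hp hq => rw [map_add, MvPolynomial.coeff_add, hp, hq, MvPolynomial.coeff_add, mul_add]

theorem eval_rescale {σ : Type*} (c z : σ → ℂ) (p : MvPolynomial σ ℂ) :
    MvPolynomial.eval z (rescale c p) = MvPolynomial.eval (fun i => c i * z i) p := by
  have h : (MvPolynomial.aeval (R := ℂ) z).comp (rescale c) = MvPolynomial.aeval fun i => c i * z i := by
    refine MvPolynomial.algHom_ext fun i => ?_
    simp [rescale]
  have := congrArg (fun f => f p) h
  simpa [MvPolynomial.aeval_eq_eval] using this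

theorem prod_pow_rowWeight (t : Fin r → ℂˣ) (d : Fin r × Fin r →₀ ℕ) :
    (d.prod fun q k => (t q.1 : ℂ) ^ k) = ∏ i, (t i : ℂ) ^ Finsupp.weight (rowWeight r) d i := by
  rw [Finsupp.prod_fintype _ _ (by simp), Fintype.prod_prod_type]
  refine Finset.prod_congr rfl fun i _ => ?_
  rw [weight_rowWeight_apply, ← Nat.cast_sum, zpow_natCast]
  exact Finset.prod_pow_eq_pow_sum Finset.univ (fun j => d (i, j)) (t i : ℂ)

theorem prod_pow_colWeight (t : Fin r → ℂˣ) (d : Fin r × Fin r →₀ ℕ) :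
    (d.prod fun q k => (t q.2 : ℂ) ^ k) = ∏ i, (t i : ℂ) ^ Finsupp.weight (colWeight r) d i := by
  rw [Finsupp.prod_fintype _ _ (by simp), Fintype.prod_prod_type_right]
  refine Finset.prod_congr rfl fun i _ => ?_
  rw [weight_colWeight_apply, ← Nat.cast_sum, zpow_natCast]
  exact Finset.prod_pow_eq_pow_sum Finset.univ (fun j => d (j, i)) (t i : ℂ)

theorem eq_of_prod_zpow_eq {a b : Fin r → ℤ}
    (h : ∀ t : Fin r → ℂˣ, ∏ i, (t i : ℂ) ^ a i = ∏ i, (t i : ℂ) ^ b i) : a = b := by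
  funext i
  -- A torus element equal to `2` in place `i` and `1` elsewhere isolates the exponent at `i`, since
  -- `2` is not a root of unity.
  have h1 := h (Function.update 1 i (Units.mk0 2 two_ne_zero))
  have h2 : ∀ c : Fin r → ℤ, ∏ j, ((Function.update (1 : Fin r → ℂˣ) i (Units.mk0 2 two_ne_zero) j : ℂˣ) : ℂ) ^ c j
      = 2 ^ c i := by
    intro c
    rw [Finset.prod_eq_single i]
    · simp
    · intro j _ hj
      simp [hj]
    · simp
  rw [h2, h2] at h1
  have h3 : ((2 : ℝ) : ℂ) ^ a i = ((2 : ℝ) : ℂ) ^ b i := by simpa using h1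
  rw [← Complex.ofReal_zpow, ← Complex.ofReal_zpow, Complex.ofReal_inj] at h3
  exact zpow_right_injective₀ two_pos (by norm_num) h3

theorem evalMat_diag_mul (t : Fin r → ℂˣ) (x : Matrix (Fin r) (Fin r) ℂ) (p : MatPoly r) :
    evalMat ((diagGL t).1 * x) p = evalMat x (rescale (fun q => (t q.1 : ℂ)) p) := by
  have := eval_rescale (fun q : Fin r × Fin r => (t q.1 : ℂ)) (fun q => x q.1 q.2) p
  rw [evalMat, evalMat, MvPolynomial.aeval_eq_eval, MvPolynomial.aeval_eq_eval]
  simp only [diagGL_val, Matrix.diagonal_mul]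
  exact this.symm

theorem evalMat_mul_diag (t : Fin r → ℂˣ) (x : Matrix (Fin r) (Fin r) ℂ) (p : MatPoly r) :
    evalMat (x * (diagGL t).1) p = evalMat x (rescale (fun q => (t q.2 : ℂ)) p) := by
  have := eval_rescale (fun q : Fin r × Fin r => (t q.2 : ℂ)) (fun q => x q.1 q.2) p
  rw [evalMat, evalMat, MvPolynomial.aeval_eq_eval, MvPolynomial.aeval_eq_eval]
  simp only [diagGL_val, Matrix.mul_diagonal, mul_comm _ (t _ : ℂ)]
  exact this.symm

/-- Left multiplication by a diagonal matrix rescales the rows, so row degrees are weights of the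
left torus. As left and right multiplication commute, this makes the space of given row degrees
stable under right translation. -/
theorem isWeightedHomogeneous_row_iff (a : Fin r → ℤ) (p : MatPoly r) :
    p.IsWeightedHomogeneous (rowWeight r) a ↔ ∀ (t : Fin r → ℂˣ) (x : GL (Fin r) ℂ),
      evalMat (diagGL t * x).1 p = (∏ i, (t i : ℂ) ^ a i) * evalMat x.1 p := by
  constructor
  · intro h t x
    rw [Units.val_mul, evalMat_diag_mul, ← smul_eq_mul, ← map_smul]
    congr 1
    ext d
    rw [coeff_rescale, MvPolynomial.coeff_smul, smul_eq_mul, prod_pow_rowWeight]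
    by_cases hd : p.coeff d = 0
    · rw [hd, mul_zero, mul_zero]
    · rw [h hd]
  · intro h d hd
    refine eq_of_prod_zpow_eq fun t => ?_
    have h1 : rescale (fun q => (t q.1 : ℂ)) p = (∏ i, (t i : ℂ) ^ a i) • p := by
      refine matPoly_ext fun x => ?_
      rw [← evalMat_diag_mul, ← Units.val_mul, h, map_smul, smul_eq_mul]
    have h2 := congrArg (MvPolynomial.coeff d) h1
    rw [coeff_rescale, MvPolynomial.coeff_smul, smul_eq_mul, prod_pow_rowWeight] at h2
    exact mul_right_cancel₀ hd h2

theorem isWeightedHomogeneous_col (a : Fin r → ℤ) (p : MatPoly r)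
    (h : ∀ (t : Fin r → ℂˣ) (x : GL (Fin r) ℂ),
      evalMat (x * diagGL t).1 p = (∏ i, (t i : ℂ) ^ a i) * evalMat x.1 p) :
    p.IsWeightedHomogeneous (colWeight r) a := by
  intro d hd
  refine eq_of_prod_zpow_eq fun t => ?_
  have h1 : rescale (fun q => (t q.2 : ℂ)) p = (∏ i, (t i : ℂ) ^ a i) • p := by
    refine matPoly_ext fun x => ?_
    rw [← evalMat_mul_diag, ← Units.val_mul, h, map_smul, smul_eq_mul]
  have h2 := congrArg (MvPolynomial.coeff d) h1
  rw [coeff_rescale, MvPolynomial.coeff_smul, smul_eq_mul, prod_pow_colWeight] at h2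
  exact mul_right_cancel₀ hd h2

/-- The polynomials of multidegree `a` in the rows of the matrix. -/
noncomputable def rowPart (a : Fin r → ℤ) : Subrepresentation (polyRep r) where
  toSubmodule := MvPolynomial.weightedHomogeneousSubmodule ℂ (rowWeight r) a
  apply_mem_toSubmodule g p hp := by
    rw [MvPolynomial.mem_weightedHomogeneousSubmodule, isWeightedHomogeneous_row_iff] at hp ⊢
    intro t x
    rw [evalMat_polyRep, evalMat_polyRep, ← Units.val_mul, ← Units.val_mul, mul_assoc, hp]

theorem mem_rowPart {a : Fin r → ℤ} {p : MatPoly r} :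
    p ∈ (rowPart a).toSubmodule ↔ p.IsWeightedHomogeneous (rowWeight r) a := Iff.rfl

/-- The representation on the polynomials of multidegree `a` in the rows. -/
noncomputable def rowRep (a : Fin r → ℤ) :
    Representation ℂ (GL (Fin r) ℂ) (rowPart a).toSubmodule :=
  (rowPart a).toRepresentation

/-- The exponents of the monomials of multidegree `a` in the rows. -/
abbrev RowExponent (a : Fin r → ℤ) : Type :=
  {d : Fin r × Fin r →₀ ℕ // Finsupp.weight (rowWeight r) d = a}

instance (a : Fin r → ℤ) : Finite (RowExponent a) := by
  have h : ∀ d : RowExponent a, ∀ q, d.1 q ≤ (a q.1).toNat := by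
    rintro ⟨d, rfl⟩ q
    have h1 : (d q : ℤ) ≤ ∑ j, (d (q.1, j) : ℤ) :=
      Finset.single_le_sum (f := fun j => (d (q.1, j) : ℤ)) (fun _ _ => Int.natCast_nonneg _)
        (Finset.mem_univ q.2)
    rw [weight_rowWeight_apply]
    simp only
    omega
  refine Finite.of_injective (fun (d : RowExponent a) (q : Fin r × Fin r) =>
    (⟨d.1 q, Nat.lt_succ_of_le (h d q)⟩ : Fin ((a q.1).toNat + 1))) ?_
  intro d e hde
  refine Subtype.ext (Finsupp.ext fun q => ?_)
  simpa using congrFun hde q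

noncomputable instance (a : Fin r → ℤ) : Fintype (RowExponent a) := Fintype.ofFinite _

/-- The basis of monomials. -/
noncomputable def rowBasis (a : Fin r → ℤ) :
    Module.Basis (RowExponent a) ℂ (rowPart a).toSubmodule :=
  Module.Basis.ofEquivFun
    { toFun := fun p d => p.1.coeff d.1
      invFun := fun f => ⟨∑ d, MvPolynomial.monomial d.1 (f d), Submodule.sum_mem _ fun d _ =>
        mem_rowPart.2 (MvPolynomial.isWeightedHomogeneous_monomial _ _ _ d.2)⟩
      map_add' := fun p q => by ext d; simp
      map_smul' := fun c p => by ext d; simp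
      left_inv := fun p => by
        classical
        refine Subtype.ext (MvPolynomial.ext _ _ fun d => ?_)
        rw [MvPolynomial.coeff_sum]
        simp only [MvPolynomial.coeff_monomial]
        by_cases hd : Finsupp.weight (rowWeight r) d = a
        · rw [Finset.sum_eq_single ⟨d, hd⟩]
          · simp
          · intro e _ he
            exact if_neg fun h => he (Subtype.ext h)
          · simp
        · rw [Finset.sum_eq_zero, MvPolynomial.IsWeightedHomogeneous.coeff_eq_zero p.2 d hd]
          intro e _
          refine if_neg fun h => hd ?_
          rw [← h]
          exact e.2
      right_inv := fun f => by
        classical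
        ext d
        change MvPolynomial.coeff d.1 (∑ e : RowExponent a, MvPolynomial.monomial e.1 (f e)) = f d
        rw [MvPolynomial.coeff_sum]
        simp [MvPolynomial.coeff_monomial, Subtype.coe_inj] }

theorem rowBasis_repr (a : Fin r → ℤ) (p : (rowPart a).toSubmodule) (d : RowExponent a) :
    (rowBasis a).repr p d = p.1.coeff d.1 := rfl

theorem rowBasis_apply (a : Fin r → ℤ) (d : RowExponent a) :
    (rowBasis a d).1 = MvPolynomial.monomial d.1 1 := by
  classical
  ext e
  have h : (∑ d', MvPolynomial.monomial d'.1 (Pi.single (M := fun _ => ℂ) d 1 d') : MatPoly r) =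
      MvPolynomial.monomial d.1 1 := by
    rw [Finset.sum_eq_single d]
    · simp
    · intro d' _ h
      simp [h]
    · simp
  rw [← h]
  simp [rowBasis]

instance (a : Fin r → ℤ) : Module.Finite ℂ (rowPart a).toSubmodule :=
  Module.Finite.of_basis (rowBasis a)

end PolynomialFunctions

/-! ### The Fischer form and complete reducibility. -/

section FischerForm

open ComplexConjugate

variable {r : ℕ}

/-- The Fischer form `∑_d d! conj(p_d) q_d`. -/
noncomputable def fischer (p : MatPoly r) : MatPoly r →ₗ[ℂ] ℂ :=
  ∑ d ∈ p.support, ((∏ i, ((d i).factorial : ℂ)) * conj (p.coeff d)) • MvPolynomial.lcoeff ℂ d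

theorem fischer_apply_of_subset {p : MatPoly r} {S : Finset (Fin r × Fin r →₀ ℕ)}
    (h : p.support ⊆ S) (q : MatPoly r) :
    fischer p q = ∑ d ∈ S, (∏ i, ((d i).factorial : ℂ)) * conj (p.coeff d) * q.coeff d := by
  rw [fischer, LinearMap.sum_apply]
  refine Finset.sum_subset h fun d _ hd => ?_
  rw [MvPolynomial.notMem_support_iff.1 hd]
  simp

theorem fischer_monomial (e : Fin r × Fin r →₀ ℕ) (a : ℂ) (q : MatPoly r) :
    fischer (MvPolynomial.monomial e a) q =
      (∏ i, ((e i).factorial : ℂ)) * conj a * q.coeff e := by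
  rw [fischer_apply_of_subset MvPolynomial.support_monomial_subset, Finset.sum_singleton,
    MvPolynomial.coeff_monomial, if_pos rfl]

theorem fischer_add (p p' q : MatPoly r) : fischer (p + p') q = fischer p q + fischer p' q := by
  classical
  rw [fischer_apply_of_subset (MvPolynomial.support_add (p := p) (q := p')),
    fischer_apply_of_subset (Finset.subset_union_left (s₁ := p.support) (s₂ := p'.support)),
    fischer_apply_of_subset (Finset.subset_union_right (s₁ := p.support) (s₂ := p'.support)),
    ← Finset.sum_add_distrib]
  refine Finset.sum_congr rfl fun d _ => ?_
  rw [MvPolynomial.coeff_add, map_add]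
  ring

theorem fischer_smul (c : ℂ) (p q : MatPoly r) : fischer (c • p) q = conj c * fischer p q := by
  rw [fischer_apply_of_subset (MvPolynomial.support_smul (a := c) (f := p)),
    fischer_apply_of_subset (Finset.Subset.refl p.support), Finset.mul_sum]
  refine Finset.sum_congr rfl fun d _ => ?_
  rw [MvPolynomial.coeff_smul, smul_eq_mul, map_mul]
  ring

theorem fischer_sum {ι : Type*} (s : Finset ι) (p : ι → MatPoly r) (q : MatPoly r) :
    fischer (∑ i ∈ s, p i) q = ∑ i ∈ s, fischer (p i) q := by
  classical
  induction s using Finset.induction_on with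
  | empty => simp [fischer]
  | insert i s hi ih => rw [Finset.sum_insert hi, fischer_add, ih, Finset.sum_insert hi]

theorem fischer_self_eq_zero {p : MatPoly r} (h : fischer p p = 0) : p = 0 := by
  rw [fischer_apply_of_subset (Finset.Subset.refl p.support)] at h
  have h1 : ∀ d, (∏ i, ((d i).factorial : ℂ)) * conj (p.coeff d) * p.coeff d =
      (((∏ i, ((d i).factorial : ℝ)) * Complex.normSq (p.coeff d) : ℝ) : ℂ) := by
    intro d
    rw [mul_assoc, ← Complex.normSq_eq_conj_mul_self]
    push_cast
    rfl
  simp only [h1] at h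
  rw [← Complex.ofReal_sum, Complex.ofReal_eq_zero, Finset.sum_eq_zero_iff_of_nonneg] at h
  · rw [← MvPolynomial.support_eq_empty, Finset.eq_empty_iff_forall_notMem]
    intro d hd
    have h2 := h d hd
    rw [mul_eq_zero, Complex.normSq_eq_zero] at h2
    refine h2.elim (fun h3 => ?_) (MvPolynomial.mem_support_iff.1 hd)
    rw [Finset.prod_eq_zero_iff] at h3
    obtain ⟨i, _, hi⟩ := h3
    exact Nat.factorial_ne_zero _ (by exact_mod_cast hi)
  · intro d _
    exact mul_nonneg (Finset.prod_nonneg fun i _ => Nat.cast_nonneg _) (Complex.normSq_nonneg _)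

/-- The factorials are chosen for this adjointness of multiplication and differentiation: raising
`e_i` by one multiplies `e!` by `e_i + 1`, the factor produced by the derivative. -/
theorem fischer_X_mul (i : Fin r × Fin r) (p q : MatPoly r) :
    fischer (MvPolynomial.X i * p) q = fischer p (MvPolynomial.pderiv i q) := by
  classical
  induction p using MvPolynomial.induction_on' with
  | monomial e a =>
    rw [MvPolynomial.X, MvPolynomial.monomial_mul, one_mul, fischer_monomial, fischer_monomial,
      MvPolynomial.coeff_pderiv, add_comm (Finsupp.single i 1) e]
    have h : ∏ j, (((e + Finsupp.single i 1 : Fin r × Fin r →₀ ℕ) j).factorial : ℂ) =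
        (∏ j, ((e j).factorial : ℂ)) * (e i + 1) := by
      rw [← Finset.mul_prod_erase Finset.univ _ (Finset.mem_univ i),
        ← Finset.mul_prod_erase Finset.univ (fun j => ((e j).factorial : ℂ)) (Finset.mem_univ i)]
      have h2 : ∀ j ∈ Finset.univ.erase i, (((e + Finsupp.single i 1 : Fin r × Fin r →₀ ℕ) j).factorial : ℂ) =
          ((e j).factorial : ℂ) := by
        intro j hj
        simp [(Finset.ne_of_mem_erase hj).symm]
      rw [Finset.prod_congr rfl h2]
      simp [Nat.factorial_succ]
      ring
    rw [h]
    ring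
  | add p p' hp hp' => rw [mul_add, fischer_add, hp, hp', fischer_add]

/-- The chain rule for a linear substitution; by the Leibniz rule it is enough to check it on the
variables. -/
theorem pderiv_polyTranslate (h : Matrix (Fin r) (Fin r) ℂ) (i j : Fin r) (q : MatPoly r) :
    MvPolynomial.pderiv (i, j) (polyTranslate h q) =
      ∑ k, h j k • polyTranslate h (MvPolynomial.pderiv (i, k) q) := by
  classical
  induction q using MvPolynomial.induction_on with
  | C a => simp [polyTranslate]
  | add p q hp hq =>
    simp only [map_add, hp, hq, smul_add, Finset.sum_add_distrib]
  | mul_X p s hp =>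
    have h1 : MvPolynomial.pderiv (i, j) (polyTranslate h (MvPolynomial.X s)) =
        ∑ k, h j k • polyTranslate h (MvPolynomial.pderiv (i, k) (MvPolynomial.X s)) := by
      obtain ⟨s1, s2⟩ := s
      simp only [polyTranslate, MvPolynomial.aeval_X, map_sum, MvPolynomial.pderiv_C_mul,
        MvPolynomial.pderiv_X, Pi.single_apply, Prod.mk.injEq]
      by_cases hs : s1 = i
      · subst hs
        simp [MvPolynomial.smul_eq_C_mul, apply_ite]
      · simp [hs]
    rw [map_mul, Derivation.leibniz, hp, h1]
    simp only [Derivation.leibniz, map_add, smul_add, Finset.sum_add_distrib, smul_eq_mul, map_mul,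
      Finset.mul_sum, mul_smul_comm]

/-- Induction on `p`: a variable multiplying `p` becomes a derivative of `q`, and the chain rule
produces the entries of the conjugate transpose, matching the conjugate-linearity of the form in its
first argument. -/
theorem fischer_polyTranslate (g : Matrix (Fin r) (Fin r) ℂ) (p q : MatPoly r) :
    fischer (polyTranslate g p) q = fischer p (polyTranslate g.conjTranspose q) := by
  induction p using MvPolynomial.induction_on generalizing q with
  | C a =>
    have h1 : polyTranslate g (MvPolynomial.C a) = MvPolynomial.C a := by simp [polyTranslate]
    have h2 : (polyTranslate g.conjTranspose q).coeff 0 = q.coeff 0 := by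
      have h3 : (MvPolynomial.aeval (R := ℂ) (0 : Fin r × Fin r → ℂ)).comp
          (polyTranslate g.conjTranspose) = MvPolynomial.aeval (R := ℂ) 0 := by
        refine MvPolynomial.algHom_ext fun s => ?_
        simp [polyTranslate]
      have h4 := congrArg (fun f => f q) h3
      simpa [MvPolynomial.constantCoeff_eq] using h4
    rw [h1, MvPolynomial.C_apply, fischer_monomial, fischer_monomial, h2]
  | add p p' hp hp' => rw [map_add, fischer_add, hp, hp', fischer_add]
  | mul_X p s hp =>
    have h1 : polyTranslate g (MvPolynomial.X s) =
        ∑ k, g k s.2 • MvPolynomial.X (s.1, k) := by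
      simp [polyTranslate, MvPolynomial.smul_eq_C_mul]
    rw [map_mul, h1, Finset.mul_sum, fischer_sum, mul_comm p, fischer_X_mul,
      show s = (s.1, s.2) from rfl, pderiv_polyTranslate, map_sum]
    refine Finset.sum_congr rfl fun k _ => ?_
    rw [mul_smul_comm, fischer_smul, mul_comm (polyTranslate g p), fischer_X_mul, hp, map_smul,
      smul_eq_mul, Matrix.conjTranspose_apply]
    rfl

theorem fischer_polyRep (g : GL (Fin r) ℂ) (p q : MatPoly r) :
    fischer (polyRep r g p) q = fischer p (polyRep r (star g) q) :=
  fischer_polyTranslate g.1 p q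

/-- The orthogonal complement of a subrepresentation is stable, because the adjoint of `g` is `star
g`, again an element of the group; it is a complement because the form is definite. -/
theorem rowRep_isSemisimple (a : Fin r → ℤ) : (rowRep a).IsSemisimpleRepresentation := by
  refine ⟨fun W => ?_⟩
  let U : Submodule ℂ (rowPart a).toSubmodule := W.toSubmodule
  have : Module.Free ℂ U := Module.Free.of_divisionRing ℂ U
  let b := Module.finBasis ℂ U
  -- The orthogonal complement is the kernel of `finrank U` functionals, so its codimension is at
  -- most the dimension of `U`; this bound and disjointness give a complement.
  let f : (rowPart a).toSubmodule →ₗ[ℂ] (Fin (Module.finrank ℂ U) → ℂ) :=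
    LinearMap.pi fun i => (fischer ((b i).1 : MatPoly r)).comp (rowPart a).toSubmodule.subtype
  have hmem : ∀ v : (rowPart a).toSubmodule, f v = 0 ↔ ∀ w ∈ U, fischer (w : MatPoly r) v = 0 := by
    intro v
    constructor
    · intro hv w hw
      have h1 := congrArg (fun w : U => (w.1 : MatPoly r)) (b.sum_repr ⟨w, hw⟩)
      simp only [Submodule.coe_sum, Submodule.coe_smul] at h1
      rw [← h1, fischer_sum]
      refine Finset.sum_eq_zero fun i _ => ?_
      rw [fischer_smul, show fischer ((b i).1 : MatPoly r) v = 0 from congrFun hv i, mul_zero]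
    · intro hv
      funext i
      exact hv _ (b i).2
  let W' : Subrepresentation (rowRep a) :=
    { toSubmodule := LinearMap.ker f
      apply_mem_toSubmodule := fun g v hv => by
        rw [LinearMap.mem_ker, hmem] at hv ⊢
        intro w hw
        have h1 := hv _ (W.apply_mem_toSubmodule (star g) hw)
        change fischer (polyRep r (star g) w.1) v.1 = 0 at h1
        change fischer w.1 (polyRep r g v.1) = 0
        rw [fischer_polyRep, star_star] at h1
        exact h1 }
  have hdisj : Disjoint U (LinearMap.ker f) := by
    rw [Submodule.disjoint_def]
    intro v hv hv'
    exact Subtype.ext (fischer_self_eq_zero ((hmem v).1 hv' v hv))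
  have htop : U ⊔ LinearMap.ker f = ⊤ := by
    apply Submodule.eq_top_of_finrank_eq
    have h1 := Submodule.finrank_sup_add_finrank_inf_eq U (LinearMap.ker f)
    have h2 := LinearMap.finrank_range_add_finrank_ker f
    have h3 := Submodule.finrank_le (LinearMap.range f)
    have h4 := Submodule.finrank_le (U ⊔ LinearMap.ker f)
    rw [disjoint_iff.1 hdisj, finrank_bot] at h1
    rw [Module.finrank_fin_fun] at h3
    omega
  refine ⟨W', ?_⟩
  rw [isCompl_iff, disjoint_iff, codisjoint_iff]
  exact ⟨Subrepresentation.toSubmodule_injective (disjoint_iff.1 hdisj),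
    Subrepresentation.toSubmodule_injective htop⟩

end FischerForm

/-! ### Polynomial representations: Frobenius reciprocity, weights and characters. -/

section Characters

variable {r : ℕ}

/-- The matrix coefficients are polynomials in the matrix entries. -/
def IsPolynomialRep {V : Type*} [AddCommGroup V] [Module ℂ V]
    (ρ : Representation ℂ (GL (Fin r) ℂ) V) : Prop :=
  ∀ (v : V) (φ : Module.Dual ℂ V), ∃ p : MatPoly r, ∀ g, φ (ρ g v) = evalMat g.1 p

/-- Restriction of a polynomial to the diagonal matrices. -/
noncomputable def diagPart (r : ℕ) : MatPoly r →ₐ[ℂ] MvPolynomial (Fin r) ℂ :=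
  MvPolynomial.aeval fun q => if q.1 = q.2 then MvPolynomial.X q.1 else 0

theorem eval_diagPart (t : Fin r → ℂˣ) (p : MatPoly r) :
    MvPolynomial.eval (fun i => (t i : ℂ)) (diagPart r p) = evalMat (diagGL t).1 p := by
  have h : (MvPolynomial.aeval (R := ℂ) fun i => (t i : ℂ)).comp (diagPart r) =
      evalMat (diagGL t).1 := by
    refine MvPolynomial.algHom_ext fun q => ?_
    simp only [diagPart, AlgHom.comp_apply, MvPolynomial.aeval_X, evalMat_X, diagGL_val,
      Matrix.diagonal_apply]
    split_ifs <;> simp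
  have := congrArg (fun f => f p) h
  simpa [MvPolynomial.aeval_eq_eval] using this

theorem mvPolynomial_ext_units {p q : MvPolynomial (Fin r) ℂ}
    (h : ∀ t : Fin r → ℂˣ, MvPolynomial.eval (fun i => (t i : ℂ)) p =
      MvPolynomial.eval (fun i => (t i : ℂ)) q) : p = q := by
  have h0 : (∏ j : Fin r, MvPolynomial.X j : MvPolynomial (Fin r) ℂ) ≠ 0 :=
    Finset.prod_ne_zero_iff.2 fun j _ => MvPolynomial.X_ne_zero j
  refine mul_right_cancel₀ h0 (MvPolynomial.funext fun z => ?_)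
  rw [map_mul, map_mul, map_prod]
  simp only [MvPolynomial.eval_X]
  by_cases hz : ∏ j, z j = 0
  · rw [hz, mul_zero, mul_zero]
  · rw [← ne_eq, Finset.prod_ne_zero_iff] at hz
    have := h fun i => Units.mk0 (z i) (hz i (Finset.mem_univ i))
    simp only [Units.val_mk0] at this
    rw [this]

theorem repDim_rowRep_of_neg {V : Type*} [AddCommGroup V] [Module ℂ V]
    (ρ : Representation ℂ (GL (Fin r) ℂ) V) {a : Fin r → ℤ} (ha : ¬ ∀ i, 0 ≤ a i) :
    repDim ρ (rowRep a) = 0 := by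
  push Not at ha
  obtain ⟨i, hi⟩ := ha
  have h : ∀ p : (rowPart a).toSubmodule, p = 0 := by
    intro p
    refine Subtype.ext (MvPolynomial.ext _ _ fun d => ?_)
    refine MvPolynomial.IsWeightedHomogeneous.coeff_eq_zero p.2 d fun hd => ?_
    rw [← hd, weight_rowWeight_apply] at hi
    exact absurd hi (not_lt.2 (Finset.sum_nonneg fun j _ => Int.natCast_nonneg _))
  have : Subsingleton (ρ.IntertwiningMap (rowRep a)) :=
    ⟨fun f g => Representation.IntertwiningMap.ext
      (LinearMap.ext fun v => (h (f v)).trans (h (g v)).symm)⟩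
  exact Module.finrank_zero_of_subsingleton

section

variable {V : Type*} [AddCommGroup V] [Module ℂ V] {ρ : Representation ℂ (GL (Fin r) ℂ) V}

/-- The polynomial `φ(ρ(g) v)`. -/
noncomputable def matrixCoeff (hρ : IsPolynomialRep ρ) (φ : Module.Dual ℂ V) (v : V) : MatPoly r :=
  (hρ v φ).choose

theorem evalMat_matrixCoeff (hρ : IsPolynomialRep ρ) (φ : Module.Dual ℂ V) (v : V)
    (g : GL (Fin r) ℂ) : evalMat g.1 (matrixCoeff hρ φ v) = φ (ρ g v) :=
  ((hρ v φ).choose_spec g).symm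

theorem matrixCoeff_add_left (hρ : IsPolynomialRep ρ) (φ ψ : Module.Dual ℂ V) (v : V) :
    matrixCoeff hρ (φ + ψ) v = matrixCoeff hρ φ v + matrixCoeff hρ ψ v :=
  matPoly_ext fun g => by simp only [map_add, evalMat_matrixCoeff, LinearMap.add_apply]

theorem matrixCoeff_smul_left (hρ : IsPolynomialRep ρ) (c : ℂ) (φ : Module.Dual ℂ V) (v : V) :
    matrixCoeff hρ (c • φ) v = c • matrixCoeff hρ φ v :=
  matPoly_ext fun g => by simp only [map_smul, evalMat_matrixCoeff, LinearMap.smul_apply]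

theorem matrixCoeff_add_right (hρ : IsPolynomialRep ρ) (φ : Module.Dual ℂ V) (v w : V) :
    matrixCoeff hρ φ (v + w) = matrixCoeff hρ φ v + matrixCoeff hρ φ w :=
  matPoly_ext fun g => by simp only [map_add, evalMat_matrixCoeff]

theorem matrixCoeff_smul_right (hρ : IsPolynomialRep ρ) (c : ℂ) (φ : Module.Dual ℂ V) (v : V) :
    matrixCoeff hρ φ (c • v) = c • matrixCoeff hρ φ v :=
  matPoly_ext fun g => by simp only [map_smul, evalMat_matrixCoeff]

/-- Functionals of weight `a` under the diagonal matrices. -/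
def weightDual (ρ : Representation ℂ (GL (Fin r) ℂ) V) (a : Fin r → ℤ) :
    Submodule ℂ (Module.Dual ℂ V) where
  carrier := {φ | ∀ (t : Fin r → ℂˣ) (v : V), φ (ρ (diagGL t) v) = (∏ i, (t i : ℂ) ^ a i) * φ v}
  zero_mem' := by simp
  add_mem' {φ ψ} hφ hψ t v := by
    rw [LinearMap.add_apply, LinearMap.add_apply, hφ, hψ, mul_add]
  smul_mem' c φ hφ t v := by
    rw [LinearMap.smul_apply, LinearMap.smul_apply, hφ, smul_eq_mul, smul_eq_mul]
    ring

/-- Frobenius reciprocity. -/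
noncomputable def frobeniusEquiv (hρ : IsPolynomialRep ρ) (a : Fin r → ℤ) :
    ρ.IntertwiningMap (rowRep a) ≃ₗ[ℂ] weightDual ρ a where
  -- The functional is `v ↦ (T v)(1)`. At the identity, left and right multiplication by the torus
  -- coincide, so the row degree of `T v` becomes the weight of the functional.
  toFun T := ⟨(evalMat 1).toLinearMap ∘ₗ (rowPart a).toSubmodule.subtype ∘ₗ T.toLinearMap, by
    intro t v
    have h1 : T (ρ (diagGL t) v) = rowRep a (diagGL t) (T v) :=
      Representation.IntertwiningMap.isIntertwining ρ _ T _ _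
    change evalMat 1 (T (ρ (diagGL t) v)).1 = _ * evalMat 1 (T v).1
    rw [h1]
    change evalMat 1 (polyRep r (diagGL t) (T v).1) = _
    have h2 := (isWeightedHomogeneous_row_iff a (T v).1).1 (T v).2 t 1
    rw [mul_one] at h2
    rw [evalMat_polyRep, one_mul, h2]
    rfl⟩
  -- A functional `φ` gives back the map sending `v` to the polynomial `g ↦ φ(ρ(g) v)`, whose row
  -- degree is the weight of `φ`.
  invFun φ :=
    { toFun := fun v => ⟨matrixCoeff hρ φ.1 v, mem_rowPart.2
        ((isWeightedHomogeneous_row_iff a _).2 fun t x => by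
          rw [evalMat_matrixCoeff, evalMat_matrixCoeff, map_mul]
          exact φ.2 t (ρ x v))⟩
      map_add' := fun v w => Subtype.ext (matrixCoeff_add_right hρ φ.1 v w)
      map_smul' := fun c v => Subtype.ext (matrixCoeff_smul_right hρ c φ.1 v)
      isIntertwining' := fun g => LinearMap.ext fun v => Subtype.ext <| matPoly_ext fun x => by
        change evalMat x.1 (matrixCoeff hρ φ.1 (ρ g v)) =
          evalMat x.1 (polyRep r g (matrixCoeff hρ φ.1 v))
        rw [evalMat_polyRep, ← Units.val_mul, evalMat_matrixCoeff, evalMat_matrixCoeff, map_mul]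
        rfl }
  map_add' S T := by
    ext v
    exact map_add (evalMat 1) (S v).1 (T v).1
  map_smul' c T := by
    ext v
    exact map_smul (evalMat 1) c (T v).1
  left_inv T := by
    refine Representation.IntertwiningMap.ext (LinearMap.ext fun v => Subtype.ext <|
      matPoly_ext fun g => ?_)
    refine (evalMat_matrixCoeff hρ _ v g).trans ?_
    have h1 : T (ρ g v) = rowRep a g (T v) :=
      Representation.IntertwiningMap.isIntertwining ρ _ T _ _
    change evalMat 1 (T (ρ g v)).1 = evalMat g.1 (T v).1
    rw [h1]
    change evalMat 1 (polyRep r g (T v).1) = _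
    rw [evalMat_polyRep, one_mul]
  right_inv φ := by
    ext v
    have h1 := evalMat_matrixCoeff hρ φ.1 v 1
    rw [map_one] at h1
    exact h1

theorem repDim_rowRep_eq (hρ : IsPolynomialRep ρ) (a : Fin r → ℤ) :
    repDim ρ (rowRep a) = Module.finrank ℂ (weightDual ρ a) :=
  LinearEquiv.finrank_eq (frobeniusEquiv hρ a)

/-- The projection onto the functionals of weight `d`. -/
noncomputable def weightProj (hρ : IsPolynomialRep ρ) (d : Fin r →₀ ℕ) :
    Module.Dual ℂ V →ₗ[ℂ] Module.Dual ℂ V where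
  toFun φ :=
    { toFun := fun v => (diagPart r (matrixCoeff hρ φ v)).coeff d
      map_add' := fun v w => by rw [matrixCoeff_add_right, map_add, MvPolynomial.coeff_add]
      map_smul' := fun c v => by
        rw [matrixCoeff_smul_right, map_smul, MvPolynomial.coeff_smul, RingHom.id_apply] }
  map_add' φ ψ := LinearMap.ext fun v => by
    simp only [matrixCoeff_add_left, map_add, MvPolynomial.coeff_add, LinearMap.coe_mk,
      AddHom.coe_mk, LinearMap.add_apply]
  map_smul' c φ := LinearMap.ext fun v => by
    simp only [matrixCoeff_smul_left, map_smul, MvPolynomial.coeff_smul, LinearMap.coe_mk,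
      AddHom.coe_mk, LinearMap.smul_apply, RingHom.id_apply]

theorem weightProj_apply (hρ : IsPolynomialRep ρ) (d : Fin r →₀ ℕ) (φ : Module.Dual ℂ V) (v : V) :
    weightProj hρ d φ v = (diagPart r (matrixCoeff hρ φ v)).coeff d := rfl

theorem prod_zpow_natCast (t : Fin r → ℂˣ) (d : Fin r →₀ ℕ) :
    ∏ i, (t i : ℂ) ^ (d i : ℤ) = d.prod fun i k => (t i : ℂ) ^ k := by
  rw [Finsupp.prod_fintype _ _ (by simp)]
  simp

/-- On the torus `φ(ρ(t) v)` is a polynomial in `t`, and its coefficient at `t^d` is the component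
of weight `d` of `φ`, evaluated at `v`. -/
theorem weightProj_isProj (hρ : IsPolynomialRep ρ) (d : Fin r →₀ ℕ) :
    LinearMap.IsProj (weightDual ρ fun i => (d i : ℤ)) (weightProj hρ d) where
  map_mem φ := by
    intro t v
    rw [weightProj_apply, weightProj_apply, prod_zpow_natCast, ← coeff_rescale]
    congr 1
    refine mvPolynomial_ext_units fun s => ?_
    have h1 := eval_diagPart (s * t) (matrixCoeff hρ φ v)
    rw [eval_diagPart, eval_rescale]
    simp only [Pi.mul_apply, Units.val_mul] at h1
    simp only [mul_comm (t _ : ℂ)]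
    rw [h1, evalMat_matrixCoeff, evalMat_matrixCoeff, ← Module.End.mul_apply, ← map_mul]
    congr 3
    ext1
    simp [diagGL_val]
  map_id φ hφ := by
    ext v
    have h1 : diagPart r (matrixCoeff hρ φ v) = MvPolynomial.monomial d (φ v) := by
      refine mvPolynomial_ext_units fun t => ?_
      rw [eval_diagPart, evalMat_matrixCoeff, hφ, MvPolynomial.eval_monomial, prod_zpow_natCast,
        mul_comm]
    rw [weightProj_apply, h1, MvPolynomial.coeff_monomial, if_pos rfl]

/-- The character is the sum of the diagonal matrix coefficients restricted to the torus. Its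
coefficient at `d` is the trace of the projection `weightProj`, hence the dimension of a weight
space, which Frobenius reciprocity turns into a Hom dimension. At exponents with a negative entry
both sides are zero. -/
theorem exists_character [Module.Finite ℂ V] (hρ : IsPolynomialRep ρ) :
    ∃ χ : MvPolynomial (Fin r) ℂ,
      (∀ t : Fin r → ℂˣ, LinearMap.trace ℂ V (ρ (diagGL t)) =
        MvPolynomial.eval (fun i => (t i : ℂ)) χ) ∧
      ∀ a : Fin r → ℤ, coeffZ a χ = repDim ρ (rowRep a) := by
  let b := Module.finBasis ℂ V
  refine ⟨∑ i, diagPart r (matrixCoeff hρ (b.coord i) (b i)), fun t => ?_, fun a => ?_⟩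
  · rw [LinearMap.trace_eq_matrix_trace ℂ b, Matrix.trace, map_sum]
    refine Finset.sum_congr rfl fun i _ => ?_
    rw [eval_diagPart, evalMat_matrixCoeff, Matrix.diag_apply, LinearMap.toMatrix_apply]
    rfl
  · unfold coeffZ
    split_ifs with ha
    · obtain ⟨d, rfl⟩ : ∃ d : Fin r →₀ ℕ, a = fun i => (d i : ℤ) :=
        ⟨Finsupp.equivFunOnFinite.symm fun i => (a i).toNat, by
          funext i; simp [ha i]⟩
      rw [repDim_rowRep_eq hρ, ← (weightProj_isProj hρ d).trace,
        LinearMap.trace_eq_matrix_trace ℂ b.dualBasis, Matrix.trace, MvPolynomial.coeff_sum]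
      refine Finset.sum_congr rfl fun i _ => ?_
      rw [Matrix.diag_apply, LinearMap.toMatrix_apply, Module.Basis.dualBasis_repr,
        weightProj_apply]
      have h1 : (Finsupp.equivFunOnFinite.symm fun i => ((d i : ℤ)).toNat) = d := by
        ext i; simp
      rw [h1, Module.Basis.coe_dualBasis]
    · rw [repDim_rowRep_of_neg ρ ha, Nat.cast_zero]

end

end Characters

/-! ### Characters of the representations `rowRep` and the norm of the Jacobi-Trudi combination. -/

section RowRepresentations

variable {r : ℕ}

/-- Translation is carried out once with a generic matrix, whose entries are kept as variables in
the coefficient ring; evaluation of the coefficients at `g` recovers the translation by `g`. -/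
theorem exists_coeff_polyRep (p : MatPoly r) (d : Fin r × Fin r →₀ ℕ) :
    ∃ Q : MatPoly r, ∀ g : GL (Fin r) ℂ, (polyRep r g p).coeff d = evalMat g.1 Q := by
  let T : MatPoly r →+* MvPolynomial (Fin r × Fin r) (MatPoly r) :=
    MvPolynomial.eval₂Hom (MvPolynomial.C.comp MvPolynomial.C)
      fun q => ∑ k, MvPolynomial.C (MvPolynomial.X (k, q.2)) * MvPolynomial.X (q.1, k)
  refine ⟨(T p).coeff d, fun g => ?_⟩
  have h : (MvPolynomial.map (evalMat g.1 : MatPoly r →+* ℂ)).comp T =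
      (polyTranslate g.1 : MatPoly r →+* MatPoly r) := by
    refine MvPolynomial.ringHom_ext (fun a => ?_) fun q => ?_
    · simp [T, polyTranslate]
    · simp [T, polyTranslate, evalMat_X]
  have h1 : MvPolynomial.map (evalMat g.1 : MatPoly r →+* ℂ) (T p) = polyRep r g p :=
    congrArg (fun f => f p) h
  rw [← h1, MvPolynomial.coeff_map]
  rfl

theorem rowRep_isPolynomialRep (a : Fin r → ℤ) : IsPolynomialRep (rowRep a) := by
  intro v φ
  choose Q hQ using fun d : RowExponent a => exists_coeff_polyRep v.1 d.1
  refine ⟨∑ d, φ (rowBasis a d) • Q d, fun g => ?_⟩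
  rw [← (rowBasis a).sum_repr (rowRep a g v), map_sum, map_sum]
  refine Finset.sum_congr rfl fun d _ => ?_
  rw [map_smul, map_smul, ← hQ, smul_eq_mul, smul_eq_mul, mul_comm]
  rfl

theorem trace_rowRep (a : Fin r → ℤ) (t : Fin r → ℂˣ) :
    LinearMap.trace ℂ _ (rowRep a (diagGL t)) =
      ∑ d : RowExponent a, d.1.prod fun q k => (t q.2 : ℂ) ^ k := by
  rw [LinearMap.trace_eq_matrix_trace ℂ (rowBasis a), Matrix.trace]
  refine Finset.sum_congr rfl fun d _ => ?_
  rw [Matrix.diag_apply, LinearMap.toMatrix_apply, rowBasis_repr]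
  have h : (rowRep a (diagGL t) (rowBasis a d)).1 =
      rescale (fun q => (t q.2 : ℂ)) (MvPolynomial.monomial d.1 1) := by
    refine matPoly_ext fun x => ?_
    rw [← rowBasis_apply, ← evalMat_mul_diag]
    exact evalMat_polyRep _ _ _
  rw [h, coeff_rescale, MvPolynomial.coeff_monomial, if_pos rfl, mul_one]

-- The monomials form an eigenbasis for the torus. A monomial with row degrees `a` is an independent
-- choice of a monomial of degree `a_i` for each row, so the trace factors over the rows.
open Finset in
theorem trace_rowRep_eq_prod_completeSymm (a : Fin r → ℤ) (ha : ∀ i, 0 ≤ a i) (t : Fin r → ℂˣ) :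
    LinearMap.trace ℂ _ (rowRep a (diagGL t)) =
      MvPolynomial.eval (fun i => (t i : ℂ))
        (MvPolynomial.map (Int.castRingHom ℂ) (∏ i, completeSymm r (a i))) := by
  have h1 : ∀ i, MvPolynomial.eval (fun i => (t i : ℂ))
      (MvPolynomial.map (Int.castRingHom ℂ) (completeSymm r (a i))) =
      ∑ l ∈ finsuppAntidiag univ (a i).toNat, ∏ j, (t j : ℂ) ^ l j := by
    intro i
    rw [completeSymm, if_pos (ha i), hsymm_eq_sum_finsuppAntidiag]
    simp
  rw [trace_rowRep, map_prod, map_prod, Finset.prod_congr rfl fun i _ => h1 i,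
    Finset.prod_univ_sum]
  refine Finset.sum_bij' (fun d _ i => Finsupp.equivFunOnFinite.symm fun j => d.1 (i, j))
    (fun L hL => ⟨Finsupp.equivFunOnFinite.symm fun q => L q.1 q.2, ?_⟩) ?_ ?_ ?_ ?_ ?_
  · funext i
    rw [weight_rowWeight_apply]
    have := Fintype.mem_piFinset.1 hL i
    rw [mem_finsuppAntidiag] at this
    have h2 : (∑ j, (L i j : ℤ)) = ((univ.sum (L i) : ℕ) : ℤ) := by push_cast; rfl
    change (∑ j, (L i j : ℤ)) = a i
    rw [h2, this.1, Int.toNat_of_nonneg (ha i)]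
  · rintro d _
    rw [Fintype.mem_piFinset]
    intro i
    rw [mem_finsuppAntidiag]
    refine ⟨?_, by simp⟩
    have h2 := congrFun d.2 i
    rw [weight_rowWeight_apply, ← Nat.cast_sum] at h2
    rw [← h2, Int.toNat_natCast]
    rfl
  · simp
  · intro d _
    ext q
    rfl
  · intro L _
    funext i
    ext j
    rfl
  · intro d _
    rw [Finsupp.prod_fintype _ _ (by simp), Fintype.prod_prod_type]
    rfl

theorem coeffZ_map (a : Fin r → ℤ) (p : MvPolynomial (Fin r) ℤ) :
    coeffZ a (MvPolynomial.map (Int.castRingHom ℂ) p) = ((coeffZ a p : ℤ) : ℂ) := by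
  unfold coeffZ
  split_ifs
  · rw [MvPolynomial.coeff_map]
    rfl
  · simp

theorem repDim_rowRep_rowRep (a b : Fin r → ℤ) :
    (repDim (rowRep a) (rowRep b) : ℤ) = coeffZ b (∏ i, completeSymm r (a i)) := by
  by_cases ha : ∀ i, 0 ≤ a i
  · obtain ⟨χ, h1, h2⟩ := exists_character (rowRep_isPolynomialRep a)
    have h3 : χ = MvPolynomial.map (Int.castRingHom ℂ) (∏ i, completeSymm r (a i)) :=
      mvPolynomial_ext_units fun t => by rw [← h1, trace_rowRep_eq_prod_completeSymm a ha]
    have h4 := h2 b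
    rw [h3, coeffZ_map] at h4
    exact_mod_cast h4.symm
  -- If some `a_i` is negative, `rowRep a` is zero and so is the factor `completeSymm r (a i)`. The
  -- vanishing lemma concerns the target, hence the exchange of arguments.
  · rw [repDim_comm _ _ (rowRep_isSemisimple a) (rowRep_isSemisimple b),
      repDim_rowRep_of_neg _ ha]
    push Not at ha
    obtain ⟨i, hi⟩ := ha
    rw [Finset.prod_eq_zero (Finset.mem_univ i)]
    · simp [coeffZ]
    · rw [completeSymm, if_neg (not_le.2 hi)]

/-- The multidegrees occurring in the determinantal formula for the Schur polynomial. -/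
def jacobiTrudiExponent (a : Fin r → ℤ) (σ : Equiv.Perm (Fin r)) : Fin r → ℤ :=
  fun i => a i - (i : ℕ) + (σ i : ℕ)

theorem coeffZ_smul {n : ℕ} {R : Type*} [CommRing R] (a : Fin n → ℤ) (c : R)
    (p : MvPolynomial (Fin n) R) : coeffZ a (c • p) = c * coeffZ a p := by
  unfold coeffZ
  split_ifs <;> simp

theorem coeffZ_sum {n : ℕ} {R ι : Type*} [CommRing R] (a : Fin n → ℤ) (s : Finset ι)
    (p : ι → MvPolynomial (Fin n) R) : coeffZ a (∑ i ∈ s, p i) = ∑ i ∈ s, coeffZ a (p i) := by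
  unfold coeffZ
  split_ifs
  · rw [MvPolynomial.coeff_sum]
  · simp

theorem sum_sign_repDim_rowRep (a b : Fin r → ℤ) :
    ∑ σ : Equiv.Perm (Fin r), (Equiv.Perm.sign σ : ℤ) *
      repDim (rowRep (jacobiTrudiExponent a σ)) (rowRep b) = coeffZ b (schur r a) := by
  rw [schur_eq_sum_perm, coeffZ_sum]
  refine Finset.sum_congr rfl fun σ _ => ?_
  rw [coeffZ_smul, repDim_rowRep_rowRep]
  rfl

/-- The signed sum over `σ` gives coefficients of `s_a`, by the determinantal formula. The signed
sum of these over `τ` extracts the coefficient of `s_a` in `s_a`. -/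
theorem jacobiTrudi_norm_eq_one (a : BoundedPartition r) :
    ∑ σ : Equiv.Perm (Fin r), ∑ τ : Equiv.Perm (Fin r),
      (Equiv.Perm.sign σ : ℤ) * (Equiv.Perm.sign τ : ℤ) *
        repDim (rowRep (jacobiTrudiExponent a.1 σ)) (rowRep (jacobiTrudiExponent a.1 τ)) = 1 := by
  have h1 := schurCoeff_schur a a
  rw [if_pos rfl, schurCoeff_eq_sum_perm] at h1
  rw [← h1, Finset.sum_comm]
  refine Finset.sum_congr rfl fun τ _ => ?_
  have h2 := sum_sign_repDim_rowRep a.1 (jacobiTrudiExponent a.1 τ)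
  change _ = _ * coeffZ (jacobiTrudiExponent a.1 τ) _
  rw [← h2, Finset.mul_sum]
  exact Finset.sum_congr rfl fun σ _ => by ring

end RowRepresentations

/-! ### Highest weight vectors, and `ρ_a` as the Jacobi-Trudi combination. -/

section IrreducibleRepresentations

variable {r : ℕ}

theorem inv_lower (l : GL (Fin r) ℂ) (hl : ∀ k j : Fin r, k < j → l k j = 0) (k j : Fin r)
    (h : k < j) : (l⁻¹).1 k j = 0 := by
  have : Invertible (l.1) := l.invertible
  have h1 : Matrix.BlockTriangular l.1 (OrderDual.toDual : Fin r → (Fin r)ᵒᵈ) :=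
    fun i j hij => hl i j hij
  have h2 := Matrix.blockTriangular_inv_of_blockTriangular h1
  rw [Matrix.coe_units_inv]
  exact h2 (show OrderDual.toDual j < OrderDual.toDual k from h)

theorem reg_evalMat (p : MatPoly r) : Reg 0 fun g : GL (Fin r) ℂ => evalMat g.1 p := by
  let T : MatPoly r →+* MvPolynomial (Fin r × Fin r) (GL (Fin r) ℂ → ℂ) :=
    MvPolynomial.eval₂Hom (MvPolynomial.C.comp (Pi.constRingHom (GL (Fin r) ℂ) ℂ))
      fun q => ∑ k, MvPolynomial.C (fun x : GL (Fin r) ℂ => x.1 q.1 k) * MvPolynomial.X (k, q.2)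
  refine ⟨T p, fun x g => ?_⟩
  have h : (evalAt x g).comp T = (evalMat (x * g).1 : MatPoly r →+* ℂ) := by
    refine MvPolynomial.ringHom_ext (fun a => ?_) fun q => ?_
    · simp [T, evalAt_C]
    · simp [T, evalAt_C, evalAt_X, evalMat_X, Matrix.mul_apply]
  rw [zpow_zero, one_mul]
  exact (congrArg (fun f => f p) h).symm

/-- A polynomial that is a highest weight vector of weight `a`. -/
def IsHighestWeightPoly (a : Fin r → ℤ) (p : MatPoly r) : Prop :=
  ∀ x b : GL (Fin r) ℂ, (∀ k j : Fin r, j < k → b k j = 0) →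
    evalMat (x * b).1 p = (∏ i, b i i ^ a i) * evalMat x.1 p

/-- Otherwise each monomial contains a variable above the diagonal, so `p` vanishes on lower
triangular matrices. A generic matrix is lower triangular times upper triangular, so by equivariance
`p` vanishes there too, and therefore everywhere. -/
theorem IsHighestWeightPoly.exists_lower_exponent {a : Fin r → ℤ} {p : MatPoly r}
    (h : IsHighestWeightPoly a p) (hp : p ≠ 0) :
    ∃ d ∈ p.support, ∀ i j : Fin r, i < j → d (i, j) = 0 := by
  by_contra hd
  push Not at hd
  have h1 : ∀ l : GL (Fin r) ℂ, (∀ k j : Fin r, k < j → l k j = 0) → evalMat l.1 p = 0 := by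
    intro l hl
    rw [evalMat_eq_sum]
    refine Finset.sum_eq_zero fun d hds => ?_
    obtain ⟨i, j, hij, hne⟩ := hd d hds
    rw [Finset.prod_eq_zero (Finset.mem_univ (i, j)), mul_zero]
    rw [hl i j hij, zero_pow hne]
  have h2 := zero_of_generic (reg_evalMat p) fun x hx => by
    obtain ⟨l, hl, hlx⟩ := exists_lower x hx
    have h3 := h l⁻¹ (l * x) hlx
    rw [inv_mul_cancel_left, h1 l⁻¹ (inv_lower l hl), mul_zero] at h3
    exact h3
  exact hp (matPoly_ext fun g => by rw [map_zero]; exact congrFun h2 g)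

theorem IsHighestWeightPoly.isWeightedHomogeneous {a : Fin r → ℤ} {p : MatPoly r}
    (h : IsHighestWeightPoly a p) : p.IsWeightedHomogeneous (colWeight r) a := by
  refine isWeightedHomogeneous_col a p fun t x => ?_
  rw [h x (diagGL t) fun k j hkj => by rw [diagGL_val, Matrix.diagonal_apply_ne _ hkj.ne']]
  simp [diagGL_val]

/-- Induction down the rows. The entries `a_j` at `(j, j)` for `j < i` already exhaust column `j`,
so row `i` is concentrated at `(i, i)`. Its sum `a_i - i + σ(i)` is at most the column sum `a_i`, so
`σ(i) ≤ i`; as `σ` fixes every smaller index, injectivity gives `σ(i) ≥ i`. -/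
theorem lower_exponent_eq (a : Fin r → ℤ) (σ : Equiv.Perm (Fin r)) (d : Fin r × Fin r →₀ ℕ)
    (hd : ∀ i j : Fin r, i < j → d (i, j) = 0)
    (hrow : ∀ i, ∑ j, (d (i, j) : ℤ) = jacobiTrudiExponent a σ i)
    (hcol : ∀ j, ∑ i, (d (i, j) : ℤ) = a j) :
    σ = 1 ∧ ∀ i j, (d (i, j) : ℤ) = if i = j then a i else 0 := by
  have key : ∀ i : Fin r, σ i = i ∧ ∀ j, (d (i, j) : ℤ) = if i = j then a i else 0 := by
    intro i
    induction i using WellFoundedLT.induction with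
    | ind i ih =>
      have hpair : ∀ i' j : Fin r, i' ≠ i → (d (i', j) : ℤ) + d (i, j) ≤ a j := by
        intro i' j hne
        rw [← hcol j]
        exact Finset.add_le_sum (f := fun i => (d (i, j) : ℤ))
          (fun _ _ => Int.natCast_nonneg _) (Finset.mem_univ i') (Finset.mem_univ i) hne
      have hoff : ∀ j, j ≠ i → d (i, j) = 0 := by
        intro j hj
        rcases lt_or_gt_of_ne hj with h | h
        · have h1 := (ih j h).2 j
          rw [if_pos rfl] at h1
          have h2 := hpair j j hj
          omega
        · exact hd i j h
      have hdiag : (d (i, i) : ℤ) = a i - (i : ℕ) + (σ i : ℕ) := by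
        have h1 := hrow i
        rw [Finset.sum_eq_single i] at h1
        · exact h1
        · intro j _ hj
          rw [hoff j hj, Nat.cast_zero]
        · simp
      have hle : (d (i, i) : ℤ) ≤ a i := by
        rw [← hcol i]
        exact Finset.single_le_sum (f := fun k => (d (k, i) : ℤ))
          (fun _ _ => Int.natCast_nonneg _) (Finset.mem_univ i)
      have hge : i ≤ σ i := by
        by_contra hlt
        push Not at hlt
        have h1 := (ih (σ i) hlt).1
        exact hlt.ne (σ.injective h1)
      have hσ : σ i = i := by
        apply Fin.ext
        have := Fin.le_def.1 hge
        omega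
      refine ⟨hσ, fun j => ?_⟩
      split_ifs with hij
      · rw [← hij, hdiag, hσ]
        ring
      · rw [hoff j (Ne.symm hij), Nat.cast_zero]
  exact ⟨Equiv.ext fun i => (key i).1, fun i => (key i).2⟩

theorem IsHighestWeightPoly.exists_exponent {a : Fin r → ℤ} {σ : Equiv.Perm (Fin r)} {p : MatPoly r}
    (h : IsHighestWeightPoly a p)
    (hrow : p.IsWeightedHomogeneous (rowWeight r) (jacobiTrudiExponent a σ)) (hp : p ≠ 0) :
    σ = 1 ∧ ∃ d ∈ p.support, ∀ i j, (d (i, j) : ℤ) = if i = j then a i else 0 := by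
  obtain ⟨d, hds, hd⟩ := h.exists_lower_exponent hp
  have hd0 := MvPolynomial.mem_support_iff.1 hds
  obtain ⟨h1, h2⟩ := lower_exponent_eq a σ d hd
    (fun i => by rw [← weight_rowWeight_apply, hrow hd0])
    (fun j => by rw [← weight_colWeight_apply, h.isWeightedHomogeneous hd0])
  exact ⟨h1, d, hds, h2⟩

/-- At the identity only monomials in the diagonal variables survive. The row degrees leave a single
such monomial, and `exists_exponent` puts it into the support. -/
theorem IsHighestWeightPoly.evalMat_one_ne_zero {a : Fin r → ℤ} {p : MatPoly r}
    (h : IsHighestWeightPoly a p) (hrow : p.IsWeightedHomogeneous (rowWeight r) a) (hp : p ≠ 0) :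
    evalMat 1 p ≠ 0 := by
  obtain ⟨-, d, hds, hd⟩ := h.exists_exponent (σ := 1) (by
    convert hrow using 1
    funext i
    simp [jacobiTrudiExponent]) hp
  have hoff : ∀ i j, i ≠ j → d (i, j) = 0 := by
    intro i j hij
    have := hd i j
    rw [if_neg hij] at this
    exact_mod_cast this
  rw [evalMat_eq_sum, Finset.sum_eq_single d]
  · rw [Finset.prod_eq_one, mul_one]
    · exact MvPolynomial.mem_support_iff.1 hds
    · rintro ⟨i, j⟩ _
      by_cases hij : i = j
      · subst hij
        rw [Matrix.one_apply_eq, one_pow]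
      · rw [hoff i j hij, pow_zero]
  · intro e he hne
    by_contra h0
    apply hne
    have h1 := Finset.prod_ne_zero_iff.1 (right_ne_zero_of_mul h0)
    have he0 : ∀ i j, i ≠ j → e (i, j) = 0 := by
      intro i j hij
      by_contra hne
      apply h1 (i, j) (Finset.mem_univ _)
      rw [Matrix.one_apply_ne hij, zero_pow hne]
    ext ⟨i, j⟩
    by_cases hij : i = j
    · subst hij
      have h2 := congrFun (hrow (MvPolynomial.mem_support_iff.1 he)) i
      rw [weight_rowWeight_apply, Finset.sum_eq_single i] at h2
      · have h3 := hd i i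
        rw [if_pos rfl, ← h2] at h3
        exact_mod_cast h3.symm
      · intro j _ hj
        rw [he0 i j hj.symm, Nat.cast_zero]
      · simp
    · rw [he0 i j hij, hoff i j hij]
  · exact fun h => absurd hds h

theorem gap_nonneg (a : BoundedPartition r) (i : Fin r) : 0 ≤ gap a.1 i := by
  unfold gap
  split_ifs with h
  · rw [sub_nonneg]
    exact a.2.1 (by simp [Fin.le_def])
  · rw [sub_zero]
    exact a.2.2 i

/-- For a partition all the gaps are nonnegative, including the last one, `a_r`; so no power of the
determinant has to be inverted. -/
theorem exists_evalMat_eq_highestWeightFunction (a : BoundedPartition r) :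
    ∃ p : MatPoly r, ∀ g : GL (Fin r) ℂ, highestWeightFunction a.1 g = evalMat g.1 p := by
  refine ⟨∏ i, ((Matrix.mvPolynomialX (Fin r) (Fin r) ℂ).toSquareBlockProp fun j => j ≤ i).det ^
    (gap a.1 i).toNat, fun g => ?_⟩
  rw [map_prod]
  refine Finset.prod_congr rfl fun i _ => ?_
  rw [map_pow, ← zpow_natCast, Int.toNat_of_nonneg (gap_nonneg a i), AlgHom.map_det]
  unfold leadingMinor
  congr 2
  ext k j
  simp [Matrix.toSquareBlockProp_def, evalMat_X]

theorem exists_evalMat_eq_of_mem_irrepSub (a : BoundedPartition r) (F : GL (Fin r) ℂ → ℂ)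
    (hF : F ∈ (irrepSub a.toWeight).toSubmodule) :
    ∃ p : MatPoly r, ∀ g : GL (Fin r) ℂ, F g = evalMat g.1 p := by
  induction hF using Submodule.span_induction with
  | mem F h =>
    obtain ⟨g, rfl⟩ := h
    obtain ⟨p, hp⟩ := exists_evalMat_eq_highestWeightFunction a
    exact ⟨polyRep r g p, fun x => by rw [evalMat_polyRep]; exact hp (x * g)⟩
  | zero => exact ⟨0, fun g => by simp⟩
  | add F F' _ _ h h' =>
    obtain ⟨p, hp⟩ := h
    obtain ⟨p', hp'⟩ := h'
    exact ⟨p + p', fun g => by rw [Pi.add_apply, hp, hp', map_add]⟩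
  | smul c F _ h =>
    obtain ⟨p, hp⟩ := h
    exact ⟨c • p, fun g => by rw [Pi.smul_apply, hp, map_smul]⟩

/-- The polynomial representing a function in the space of `ρ_a`. -/
noncomputable def irrepPoly (a : BoundedPartition r) (F : IrrepSpace a.toWeight) : MatPoly r :=
  (exists_evalMat_eq_of_mem_irrepSub a F.1 F.2).choose

theorem evalMat_irrepPoly (a : BoundedPartition r) (F : IrrepSpace a.toWeight) (g : GL (Fin r) ℂ) :
    evalMat g.1 (irrepPoly a F) = F.1 g :=
  ((exists_evalMat_eq_of_mem_irrepSub a F.1 F.2).choose_spec g).symm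

theorem irrepPoly_mem (a : BoundedPartition r) (F : IrrepSpace a.toWeight) :
    irrepPoly a F ∈ (rowPart a.1).toSubmodule := by
  rw [mem_rowPart, isWeightedHomogeneous_row_iff]
  intro t x
  rw [evalMat_irrepPoly, evalMat_irrepPoly, mem_lower_mul a.toWeight F.1 F.2 (diagGL t) x
    fun k j hkj => by rw [diagGL_val, Matrix.diagonal_apply_ne _ hkj.ne],
    hwf_upper _ (diagGL t) fun k j hkj => by rw [diagGL_val, Matrix.diagonal_apply_ne _ hkj.ne']]
  simp only [diagGL_val, Matrix.diagonal_apply_eq]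
  rfl

/-- The embedding of `ρ_a` in the polynomials of multidegree `a`. -/
noncomputable def irrepEmbedding (a : BoundedPartition r) :
    (irrep a.toWeight).IntertwiningMap (rowRep a.1) where
  toFun F := ⟨irrepPoly a F, irrepPoly_mem a F⟩
  map_add' F F' := Subtype.ext <| matPoly_ext fun g => by
    simp only [Submodule.coe_add, map_add, evalMat_irrepPoly, Pi.add_apply]
  map_smul' c F := Subtype.ext <| matPoly_ext fun g => by
    simp only [Submodule.coe_smul, map_smul, evalMat_irrepPoly, Pi.smul_apply, RingHom.id_apply]
  isIntertwining' g := LinearMap.ext fun F => Subtype.ext <| matPoly_ext fun x => by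
    change evalMat x.1 (irrepPoly a (irrep a.toWeight g F)) =
      evalMat x.1 (polyRep r g (irrepPoly a F))
    rw [evalMat_polyRep, ← Units.val_mul, evalMat_irrepPoly, evalMat_irrepPoly]
    rfl

theorem irrepEmbedding_injective (a : BoundedPartition r) :
    Function.Injective (irrepEmbedding a).toLinearMap := by
  intro F F' h
  refine Subtype.ext (funext fun g => ?_)
  rw [← evalMat_irrepPoly, ← evalMat_irrepPoly]
  exact congrArg (fun p : (rowPart a.1).toSubmodule => evalMat g.1 p.1) h

theorem IsPolynomialRep.of_injective {V W : Type*} [AddCommGroup V] [Module ℂ V] [AddCommGroup W]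
    [Module ℂ W] {ρ : Representation ℂ (GL (Fin r) ℂ) V} {σ : Representation ℂ (GL (Fin r) ℂ) W}
    (hσ : IsPolynomialRep σ) (f : ρ.IntertwiningMap σ) (hf : Function.Injective f.toLinearMap) :
    IsPolynomialRep ρ := by
  intro v φ
  obtain ⟨k, hk⟩ := f.toLinearMap.exists_leftInverse_of_injective (LinearMap.ker_eq_bot.2 hf)
  obtain ⟨p, hp⟩ := hσ (f v) (φ ∘ₗ k)
  refine ⟨p, fun g => ?_⟩
  rw [← hp]
  have h1 : f (ρ g v) = σ g (f v) := Representation.IntertwiningMap.isIntertwining ρ _ f _ _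
  rw [← h1]
  exact congrArg φ (LinearMap.congr_fun hk (ρ g v)).symm

theorem irrep_isPolynomialRep (a : BoundedPartition r) : IsPolynomialRep (irrep a.toWeight) :=
  (rowRep_isPolynomialRep a.1).of_injective (irrepEmbedding a) (irrepEmbedding_injective a)

/-- The highest weight vector of `ρ_a`. -/
noncomputable def highestWeightVector (a : DominantWeight r) : IrrepSpace a :=
  ⟨highestWeightFunction a.1, Submodule.subset_span ⟨1, by simp⟩⟩

/-- The representation is spanned by the translates of its highest weight vector. -/
theorem intertwiningMap_eq_zero_of_highestWeightVector {W : Type*} [AddCommGroup W] [Module ℂ W]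
    {σ : Representation ℂ (GL (Fin r) ℂ) W} (a : DominantWeight r)
    (T : (irrep a).IntertwiningMap σ) (h : T (highestWeightVector a) = 0) : T = 0 := by
  have h1 : ∀ F (hF : F ∈ (irrepSub a).toSubmodule), T ⟨F, hF⟩ = 0 := by
    intro F hF
    induction hF using Submodule.span_induction with
    | mem F hF =>
      obtain ⟨g, rfl⟩ := hF
      have h2 : T (irrep a g (highestWeightVector a)) = σ g (T (highestWeightVector a)) :=
        Representation.IntertwiningMap.isIntertwining _ _ T _ _
      rw [h, map_zero] at h2
      exact h2
    | zero => exact map_zero T.toLinearMap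
    | add F F' hF hF' h h' =>
      have h2 := map_add T.toLinearMap (⟨F, hF⟩ : IrrepSpace a) ⟨F', hF'⟩
      exact h2.trans ((congrArg₂ (· + ·) h h').trans (add_zero 0))
    | smul c F hF h =>
      have h2 := map_smul T.toLinearMap c (⟨F, hF⟩ : IrrepSpace a)
      exact h2.trans ((congrArg (c • ·) h).trans (smul_zero c))
  exact Representation.IntertwiningMap.ext (LinearMap.ext fun F => h1 F.1 F.2)

theorem isHighestWeightPoly_apply (a : DominantWeight r) {b : Fin r → ℤ}
    (T : (irrep a).IntertwiningMap (rowRep b)) :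
    IsHighestWeightPoly a.1 (T (highestWeightVector a)).1 := by
  intro x u hu
  have h1 : irrep a u (highestWeightVector a) = (∏ i, u i i ^ a.1 i) • highestWeightVector a := by
    refine Subtype.ext (funext fun x => ?_)
    change highestWeightFunction a.1 (x * u) = (∏ i, u i i ^ a.1 i) * highestWeightFunction a.1 x
    rw [hwf_mul_upper a.1 x u hu, hwf_upper a.1 u hu, mul_comm]
  have h2 : T (irrep a u (highestWeightVector a)) = rowRep b u (T (highestWeightVector a)) :=
    Representation.IntertwiningMap.isIntertwining _ _ T _ _
  have h3 : T ((∏ i, u i i ^ a.1 i) • highestWeightVector a) =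
      (∏ i, u i i ^ a.1 i) • T (highestWeightVector a) := map_smul T.toLinearMap _ _
  rw [h1, h3] at h2
  have h4 := congrArg (fun p : (rowPart b).toSubmodule => evalMat x.1 p.1) h2
  simp only [Submodule.coe_smul, map_smul, smul_eq_mul] at h4
  rw [h4]
  exact (evalMat_polyRep x.1 u _).symm

/-- The image of the highest weight vector is a highest weight polynomial whose column degrees are
`a` and whose row degrees come from `σ`; unless it is zero, the exponent argument forces `σ = 1`. -/
theorem repDim_irrep_rowRep_of_ne_one (a : BoundedPartition r) {σ : Equiv.Perm (Fin r)}
    (hσ : σ ≠ 1) : repDim (irrep a.toWeight) (rowRep (jacobiTrudiExponent a.1 σ)) = 0 := by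
  have h : ∀ T : (irrep a.toWeight).IntertwiningMap (rowRep (jacobiTrudiExponent a.1 σ)), T = 0 := by
    intro T
    refine intertwiningMap_eq_zero_of_highestWeightVector _ T (Subtype.ext ?_)
    by_contra hne
    exact hσ ((isHighestWeightPoly_apply a.toWeight T).exists_exponent
      (T (highestWeightVector a.toWeight)).2 hne).1
  have : Subsingleton ((irrep a.toWeight).IntertwiningMap (rowRep (jacobiTrudiExponent a.1 σ))) :=
    ⟨fun S T => (h S).trans (h T).symm⟩
  exact Module.finrank_zero_of_subsingleton

theorem repDim_irrep_rowRep_self (a : BoundedPartition r) :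
    repDim (irrep a.toWeight) (rowRep a.1) = 1 := by
  -- A map is determined by the value at the identity matrix of the image of the highest weight
  -- vector: this is injectivity of `E`, by `evalMat_one_ne_zero`. The embedding of `ρ_a` has value
  -- one, which gives surjectivity.
  let E : (irrep a.toWeight).IntertwiningMap (rowRep a.1) →ₗ[ℂ] ℂ :=
    { toFun := fun T => evalMat 1 (T (highestWeightVector a.toWeight)).1
      map_add' := fun S T => map_add (evalMat 1) (S _).1 (T _).1
      map_smul' := fun c T => map_smul (evalMat 1) c (T _).1 }
  have hE : Function.Injective E := by
    intro S T' hST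
    let T := S + (-1 : ℂ) • T'
    have hT : E T = 0 := by
      rw [map_add, map_smul, hST, neg_one_smul, add_neg_cancel]
    suffices hT0 : T = 0 by
      have h : T + T' = T' := by rw [hT0, zero_add]
      refine Eq.trans ?_ h
      rw [add_assoc, show (-1 : ℂ) • T' + T' = 0 by
        rw [← one_smul ℂ T', smul_smul, ← add_smul, mul_one, neg_add_cancel, zero_smul], add_zero]
    refine intertwiningMap_eq_zero_of_highestWeightVector _ T (Subtype.ext ?_)
    by_contra hne
    exact (isHighestWeightPoly_apply a.toWeight T).evalMat_one_ne_zero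
      (T (highestWeightVector a.toWeight)).2 hne hT
  have h1 : E (irrepEmbedding a) = 1 :=
    (evalMat_irrepPoly a (highestWeightVector a.toWeight) 1).trans (hwf_one a.1)
  have h2 : Function.Surjective E := fun c => ⟨c • irrepEmbedding a, by
    rw [map_smul, h1, smul_eq_mul, mul_one]⟩
  exact (LinearEquiv.finrank_eq (LinearEquiv.ofBijective E ⟨hE, h2⟩)).trans
    (CommSemiring.finrank_self ℂ)

theorem sum_sign_repDim_irrep (a : BoundedPartition r) :
    ∑ σ : Equiv.Perm (Fin r), (Equiv.Perm.sign σ : ℤ) *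
      repDim (irrep a.toWeight) (rowRep (jacobiTrudiExponent a.1 σ)) = 1 := by
  rw [Finset.sum_eq_single 1]
  · have h : jacobiTrudiExponent a.1 1 = a.1 := by
      funext i
      simp [jacobiTrudiExponent]
    rw [h, repDim_irrep_rowRep_self]
    simp
  · intro σ _ hσ
    rw [repDim_irrep_rowRep_of_ne_one a hσ, Nat.cast_zero, mul_zero]
  · simp

/-- The multiplicity of `ρ_a` in terms of the multiplicities of the `rowRep b`. -/
theorem sum_sign_repDim (a : BoundedPartition r) {V : Type} [AddCommGroup V] [Module ℂ V]
    [Module.Finite ℂ V] (ρ : Representation ℂ (GL (Fin r) ℂ) V) :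
    ∑ σ : Equiv.Perm (Fin r), (Equiv.Perm.sign σ : ℤ) *
      repDim ρ (rowRep (jacobiTrudiExponent a.1 σ)) = repDim ρ (irrep a.toWeight) := by
  have := irrep_finite a.toWeight
  -- Norm one and a single occurrence of `ρ_a` leave no other net constituent. The representation
  -- `ρ` in the first argument need not be semisimple.
  exact sum_repDim_eq_of_norm_one (fun σ => (Equiv.Perm.sign σ : ℤ))
    (fun σ => rowRep (jacobiTrudiExponent a.1 σ)) (fun σ => rowRep_isSemisimple _)
    (irrep a.toWeight) (irrep_irreducible _) ρ (jacobiTrudi_norm_eq_one a)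
    (sum_sign_repDim_irrep a)

/-- The weight multiplicities of `ρ_a` are the coefficients of the Schur polynomial `s_a`. -/
theorem repDim_irrep_rowRep (a : BoundedPartition r) (b : Fin r → ℤ) :
    (repDim (irrep a.toWeight) (rowRep b) : ℤ) = coeffZ b (schur r a.1) := by
  have := irrep_finite a.toWeight
  have := irrep_irreducible a.toWeight
  -- With `ρ_a` moved to the second argument it may be replaced by the alternating combination;
  -- exchanging the arguments in each term then gives the determinantal expansion of `s_a`.
  rw [repDim_comm _ _ inferInstance (rowRep_isSemisimple b), ← sum_sign_repDim,
    ← sum_sign_repDim_rowRep]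
  refine Finset.sum_congr rfl fun σ _ => ?_
  rw [repDim_comm _ _ (rowRep_isSemisimple _) (rowRep_isSemisimple _)]

/-- The character of `ρ_a` is the Schur polynomial `s_a`. -/
theorem trace_irrep (a : BoundedPartition r) (t : Fin r → ℂˣ) :
    LinearMap.trace ℂ _ (irrep a.toWeight (diagGL t)) = MvPolynomial.eval (fun i => (t i : ℂ))
      (MvPolynomial.map (Int.castRingHom ℂ) (schur r a.1)) := by
  have := irrep_finite a.toWeight
  obtain ⟨χ, h1, h2⟩ := exists_character (irrep_isPolynomialRep a)
  rw [h1]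
  congr 1
  ext d
  -- Each coefficient of the character is a Hom dimension into some `rowRep`, and the previous lemma
  -- finds the same number as a coefficient of `s_a`.
  have h3 := h2 fun i => (d i : ℤ)
  have h4 : ∀ p : MvPolynomial (Fin r) ℂ, coeffZ (fun i => (d i : ℤ)) p = p.coeff d := by
    intro p
    rw [coeffZ, if_pos fun i => Int.natCast_nonneg _]
    congr 1
    ext i
    simp
  rw [← h4, ← h4, h3, coeffZ_map, ← repDim_irrep_rowRep]
  rfl

theorem IsPolynomialRep.tprod {V W : Type*} [AddCommGroup V] [Module ℂ V] [AddCommGroup W]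
    [Module ℂ W] [Module.Finite ℂ V] [Module.Finite ℂ W]
    {ρ : Representation ℂ (GL (Fin r) ℂ) V} {σ : Representation ℂ (GL (Fin r) ℂ) W}
    (hρ : IsPolynomialRep ρ) (hσ : IsPolynomialRep σ) : IsPolynomialRep (ρ.tprod σ) := by
  intro v φ
  induction v using TensorProduct.induction_on with
  | zero => exact ⟨0, fun g => by simp⟩
  | add v w hv hw =>
    obtain ⟨p, hp⟩ := hv
    obtain ⟨q, hq⟩ := hw
    exact ⟨p + q, fun g => by rw [map_add, map_add, hp, hq, map_add]⟩
  | tmul v w =>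
    let b := Module.finBasis ℂ V
    let c := Module.finBasis ℂ W
    refine ⟨∑ i, ∑ j, φ (b i ⊗ₜ c j) •
      (matrixCoeff hρ (b.coord i) v * matrixCoeff hσ (c.coord j) w), fun g => ?_⟩
    have h : (ρ.tprod σ) g (v ⊗ₜ w) = ρ g v ⊗ₜ σ g w := rfl
    rw [h, ← b.sum_repr (ρ g v), ← c.sum_repr (σ g w), TensorProduct.sum_tmul, map_sum, map_sum]
    refine Finset.sum_congr rfl fun i _ => ?_
    rw [TensorProduct.tmul_sum, map_sum, map_sum]
    refine Finset.sum_congr rfl fun j _ => ?_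
    rw [TensorProduct.smul_tmul_smul, map_smul, map_smul, map_mul, evalMat_matrixCoeff,
      evalMat_matrixCoeff, smul_eq_mul, smul_eq_mul, mul_comm]
    rfl

/-- The character of the tensor product is `s_μ s_ν`. Both sides are the same alternating sum of its
coefficients: one by the Jacobi-Trudi description of `ρ_λ`, the other by the formula for Schur
coefficients. -/
theorem repDim_tprod_irrep (mu nu lam : BoundedPartition r) :
    (repDim (V := IrrepSpace nu.toWeight ⊗[ℂ] IrrepSpace mu.toWeight)
      ((irrep nu.toWeight).tprod (irrep mu.toWeight)) (irrep lam.toWeight) : ℤ) =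
      lrCoeff r mu nu lam := by
  have := irrep_finite mu.toWeight
  have := irrep_finite nu.toWeight
  obtain ⟨χ, h1, h2⟩ := exists_character
    ((irrep_isPolynomialRep nu).tprod (irrep_isPolynomialRep mu))
  have h3 : χ = MvPolynomial.map (Int.castRingHom ℂ) (schur r mu.1 * schur r nu.1) := by
    refine mvPolynomial_ext_units fun t => ?_
    rw [← h1, map_mul, map_mul, ← trace_irrep, ← trace_irrep, mul_comm]
    exact LinearMap.trace_tensorProduct' _ _
  rw [← sum_sign_repDim, lrCoeff_eq_schurCoeff, schurCoeff_eq_sum_perm]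
  refine Finset.sum_congr rfl fun σ _ => ?_
  have h4 := h2 (jacobiTrudiExponent lam.1 σ)
  rw [h3, coeffZ_map] at h4
  congr 1
  exact_mod_cast h4.symm

end IrreducibleRepresentations

/-! ### Tensor-hom adjunction and comparison of the two expansions. -/

theorem BoundedPartition.toWeight_injective (r : ℕ) :
    Function.Injective (BoundedPartition.toWeight : BoundedPartition r → DominantWeight r) :=
  fun _ _ h => Subtype.ext (congrArg (fun a : DominantWeight r => a.1) h)

theorem mem_range_toWeight {r : ℕ} (nu : DominantWeight r) (h : ∀ i, 0 ≤ nu.1 i) :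
    nu ∈ Set.range (BoundedPartition.toWeight : BoundedPartition r → DominantWeight r) :=
  ⟨⟨nu.1, nu.2, h⟩, rfl⟩

/-- Currying an intertwining map out of a tensor product. -/
noncomputable def intertwiningMapCurry {G U V W : Type*} [Group G] [AddCommGroup U] [Module ℂ U]
    [AddCommGroup V] [Module ℂ V] [AddCommGroup W] [Module ℂ W] (ρ : Representation ℂ G U)
    (σ : Representation ℂ G V) (τ : Representation ℂ G W) :
    (ρ.tprod σ).IntertwiningMap τ ≃ₗ[ℂ] ρ.IntertwiningMap (Representation.linHom σ τ) where
  toFun T :=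
    { toLinearMap := TensorProduct.curry T.toLinearMap
      isIntertwining' := fun g => by
        ext u v
        have h := Representation.IntertwiningMap.isIntertwining _ _ T g (u ⊗ₜ[ℂ] σ g⁻¹ v)
        simpa using h }
  invFun S :=
    { toLinearMap := TensorProduct.lift S.toLinearMap
      isIntertwining' := fun g => by
        ext u v
        have h := Representation.IntertwiningMap.isIntertwining _ _ S g u
        have h := LinearMap.congr_fun h (σ g v)
        simpa using h }
  map_add' _ _ := rfl
  map_smul' _ _ := rfl
  left_inv T := by
    ext u v
    rfl
  right_inv S := by
    ext u v
    rfl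

/-- Postcomposition with an equivalence of representations. -/
noncomputable def intertwiningMapCongr {G U V W : Type*} [Group G] [AddCommGroup U] [Module ℂ U]
    [AddCommGroup V] [Module ℂ V] [AddCommGroup W] [Module ℂ W] (ρ : Representation ℂ G U)
    {σ : Representation ℂ G V} {τ : Representation ℂ G W} (e : σ.Equiv τ) :
    ρ.IntertwiningMap σ ≃ₗ[ℂ] ρ.IntertwiningMap τ where
  toFun T := e.toIntertwiningMap.comp T
  invFun T := e.symm.toIntertwiningMap.comp T
  map_add' S T := by ext; simp
  map_smul' c T := by ext; simp
  left_inv T := by ext; simp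
  right_inv T := by ext; simp

/-- `ρ_μ^∨ ⊗ ρ_λ` is `Hom(ρ_μ, ρ_λ)`, and currying moves `ρ_μ` to the source. What results involves
only polynomial representations, although the dual in general is not one. -/
theorem multiplicity_eq_lrCoeff {r : ℕ} (mu lam nu : BoundedPartition r) :
    (multiplicity mu.toWeight lam.toWeight nu.toWeight : ℤ) = lrCoeff r mu nu lam := by
  have := irrep_finite mu.toWeight
  have := irrep_finite lam.toWeight
  rw [← repDim_tprod_irrep]
  congr 1
  exact LinearEquiv.finrank_eq ((intertwiningMapCongr _ (Representation.Equiv.dualTensorHom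
    (irrep mu.toWeight) (irrep lam.toWeight))).trans (intertwiningMapCurry _ _ _).symm)

theorem truncMultiplicity_eq_lrCoeff {r : ℕ} (mu lam nu : BoundedPartition r) :
    (truncMultiplicity mu.toWeight lam.toWeight nu.toWeight : ℤ) = lrCoeff r mu nu lam := by
  rw [← multiplicity_eq_lrCoeff, truncMultiplicity, if_pos]
  exact nu.2.2

theorem mem_range_of_truncMultiplicity_ne_zero {r : ℕ} (mu lam nu : DominantWeight r)
    (h : truncMultiplicity mu lam nu ≠ 0) :
    nu ∈ Set.range (BoundedPartition.toWeight : BoundedPartition r → DominantWeight r) :=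
  mem_range_toWeight nu (of_not_not fun h' => h (if_neg h'))

end SkewSchur

theorem mainTheorem2 (r n : ℕ) (hrn : r < n) (lam mu : SkewSchur.BoundedPartition r) :
    {nu : SkewSchur.BoundedPartition n |
        SkewSchur.lrCoeff n (mu.pad n) nu (lam.pad n) ≠ 0}.Finite ∧
      {nu : SkewSchur.DominantWeight r |
        SkewSchur.truncMultiplicity mu.toWeight lam.toWeight nu ≠ 0}.Finite ∧
      SkewSchur.skewSchur n (lam.pad n) (mu.pad n) =
        ∑ᶠ nu : SkewSchur.DominantWeight r,
          SkewSchur.truncMultiplicity mu.toWeight lam.toWeight nu •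
            SkewSchur.schur n (SkewSchur.pad n nu.1) := by
  refine ⟨SkewSchur.lrCoeff_finite n _ _, ?_, ?_⟩
  · refine ((SkewSchur.lrCoeff_finite r mu lam).image SkewSchur.BoundedPartition.toWeight).subset ?_
    intro nu hnu
    obtain ⟨nu, rfl⟩ := SkewSchur.mem_range_of_truncMultiplicity_ne_zero _ _ nu hnu
    refine ⟨nu, ?_, rfl⟩
    rw [Set.mem_ofPred_eq, ← SkewSchur.truncMultiplicity_eq_lrCoeff]
    exact_mod_cast hnu
  -- The truncation makes the right-hand sum run over partitions only, so both sums become sums over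
  -- partitions with at most `r` parts and agree term by term.
  · rw [SkewSchur.skewSchur_pad hrn.le, ← SkewSchur.finsum_comp_of_support_subset_range
      (SkewSchur.BoundedPartition.toWeight_injective r)]
    · refine finsum_congr fun nu => ?_
      rw [← SkewSchur.truncMultiplicity_eq_lrCoeff, natCast_zsmul]
      rfl
    · intro nu hnu
      exact SkewSchur.mem_range_of_truncMultiplicity_ne_zero _ _ nu (left_ne_zero_of_smul hnu)
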